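/- Write $\bar x=x^{-1}$ and $\sigma(x)=x-\bar x$. For $n\ge 0$ let $\mathcal T_n$ be the triangular grid graph with vertices $(0,j)$ for $1\le j\le 2n+1$ (top vertices), $(i,j)$ for $1\le i\le n$ and $i\le j\le 2n+2-i$, and $(n+1,n+1)$ (bottom vertex). Its edges are the vertical edges joining $(i-1,j)$ to $(i,j)$ for $1\le i\le n+1$, $i\le j\le 2n+2-i$, and the horizontal edges joining $(i,j)$ to $(i,j+1)$ for $1\le i\le n$, $i\le j\le 2n+1-i$; row indices increase downwards and column indices increase to the right. For $1\le i\le n$, the vertex $(i,i)$ is a left boundary vertex, $(i,2n+2-i)$ is a right boundary vertex, and the $(i,j)$ with $i<j<2n+2-i$ are bulk vertices. A configuration $C$ of the six-vertex model on $\mathcal T_n$ is an orientation of the edges such that each edge incident to a top vertex is directed upwards, and at each bulk vertex exactly two of the four incident edges are directed inwards. The weight of a vertex with parameter $x$ in a configuration is defined as follows. * Bulk vertex: $1$ if its two horizontal edges are both directed inwards or both directed outwards (its two vertical edges then being directed oppositely to this with respect to the vertex); $\sigma(q^2x)/\sigma(q^4)$ if its edges are directed all upwards and rightwards, or all downwards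 and leftwards; $\sigma(q^2\bar x)/\sigma(q^4)$ if its edges are directed all upwards and leftwards, or all downwards and rightwards. * Left (respectively right) boundary vertex: $1$ if exactly one of its two edges is directed inwards, and otherwise $\sigma(qx)/\sigma(q)$ (respectively $\sigma(q\bar x)/\sigma(q)$). The odd-order DASASM partition function is $$Z(u_1,\ldots,u_{n+1})=\sum_C\prod_{v}W_v(C),$$ where $C$ runs over all configurations on $\mathcal T_n$, $v$ runs over all boundary and bulk vertices, and $W_v(C)$ is the weight of $v$ with parameter $u_i$ if $v$ is the boundary vertex $(i,i)$ or $(i,2n+2-i)$, and with parameter $u_iu_{\min(j,2n+2-j)}$ if $v$ is the bulk vertex $(i,j)$. Let $n\ge0$, and let $q,u_1,\ldots,u_n$ be nonzero elements of a field of characteristic zero (for example, complex numbers, or indeterminates over $\mathbb{Q}$) for which no denominator below vanishes, i.e., $\sigma(q^4)\ne0$ (hence also $\sigma(q)\neq0$), $\sigma(u_i\bar u_j)\ne0$ for $1\le i<j\le n$, and $\sigma(q^2u_iu_j)\ne0$, $\sigma(q^2\bar u_i\bar u_j)\neq0$ for $1\le i,j\le n$. Then $$Z(u_1,\ldots,u_n,1)=\frac{\sigma(q^2)^n}{\sigma(q)^{2n}\,\sigma(q^4)^{n^2}}\prod_{i=1}^n\sigma(qu_i)\,\sigma(q\bar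 u_i)\,\sigma(q^2u_i)\,\sigma(q^2\bar u_i)\prod_{1\le i<j\le n}\left(\frac{\sigma(q^2u_iu_j)\,\sigma(q^2\bar u_i\bar u_j)}{\sigma(u_i\bar u_j)}\right)^2\det_{1\le i,j\le n}\left(\frac{q^2+\bar q^2+u_i^2+\bar u_j^2}{\sigma(q^2u_iu_j)\,\sigma(q^2\bar u_i\bar u_j)}\right).$$ -/

import Mathlib

namespace DASASM

/-- `σ(x) = x - x⁻¹`. -/
def sigma {K : Type*} [Field K] (x : K) : K := x - x⁻¹

/-- The vertical edges of the triangular grid graph `T_n`: the pair `(i, j)` stands for the edge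
joining the vertex `(i, j)` to the vertex `(i - 1, j)` above it,
for `1 ≤ i ≤ n + 1` and `i ≤ j ≤ 2n + 2 - i`. -/
def vertEdges (n : ℕ) : Finset (ℕ × ℕ) :=
  (Finset.Icc 1 (n + 1) ×ˢ Finset.Icc 1 (2 * n + 1)).filter
    fun p => p.1 ≤ p.2 ∧ p.1 + p.2 ≤ 2 * n + 2

/-- The horizontal edges of `T_n`: the pair `(i, j)` stands for the edge joining the vertex `(i, j)`
to the vertex `(i, j + 1)` on its right, for `1 ≤ i ≤ n` and `i ≤ j ≤ 2n + 1 - i`. -/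
def horizEdges (n : ℕ) : Finset (ℕ × ℕ) :=
  (Finset.Icc 1 n ×ˢ Finset.Icc 1 (2 * n + 1)).filter
    fun p => p.1 ≤ p.2 ∧ p.1 + p.2 ≤ 2 * n + 1

/-- An orientation of the edges of a grid graph, encoded as the set of the vertical edges that
are directed upwards together with the set of the horizontal edges that are directed rightwards
(all other edges being directed downwards, respectively leftwards). -/
abbrev Orientation := Finset (ℕ × ℕ) × Finset (ℕ × ℕ)

/-- The edge to the left of `(i, j)` is directed into `(i, j)`. -/
def leftIn (C : Orientation) (i j : ℕ) : Bool := decide ((i, j - 1) ∈ C.2)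

/-- The edge below `(i, j)` is directed into `(i, j)`. -/
def bottomIn (C : Orientation) (i j : ℕ) : Bool := decide ((i + 1, j) ∈ C.1)

/-- The edge to the right of `(i, j)` is directed into `(i, j)`. -/
def rightIn (C : Orientation) (i j : ℕ) : Bool := decide ((i, j) ∉ C.2)

/-- The edge above `(i, j)` is directed into `(i, j)`. -/
def topIn (C : Orientation) (i j : ℕ) : Bool := decide ((i, j) ∉ C.1)

/-- Each top edge is directed upwards. -/
def TopUp (n : ℕ) (C : Orientation) : Prop :=
  ∀ j ∈ Finset.Icc 1 (2 * n + 1), (1, j) ∈ C.1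

/-- The six-vertex rule: of the four edges incident to each bulk vertex `(i, j)`
(`1 ≤ i ≤ n`, `i + 1 ≤ j ≤ 2n + 1 - i`) exactly two are directed into it. -/
def SixVertexRule (n : ℕ) (C : Orientation) : Prop :=
  ∀ i ∈ Finset.Icc 1 n, ∀ j ∈ Finset.Icc (i + 1) (2 * n + 1 - i),
    (leftIn C i j).toNat + (bottomIn C i j).toNat + (rightIn C i j).toNat + (topIn C i j).toNat = 2

instance (n : ℕ) : DecidablePred (TopUp n) := fun C => by unfold TopUp; infer_instance

instance (n : ℕ) : DecidablePred (SixVertexRule n) := fun C => by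
  unfold SixVertexRule; infer_instance

/-- The configurations of the six-vertex model on `T_n`. -/
def configurations (n : ℕ) : Finset Orientation :=
  ((vertEdges n).powerset ×ˢ (horizEdges n).powerset).filter
    fun C => TopUp n C ∧ SixVertexRule n C

/-- The weight of a bulk vertex; the four arguments tell whether the left, bottom, right and top
edge, in this order, is directed into the vertex. -/
def bulkWeight {K : Type*} [Field K] (q u : K) : Bool → Bool → Bool → Bool → K
  | true, false, true, false => 1
  | false, true, false, true => 1
  | true, true, false, false => sigma (q ^ 2 * u) / sigma (q ^ 4)
  | false, false, true, true => sigma (q ^ 2 * u) / sigma (q ^ 4)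
  | false, true, true, false => sigma (q ^ 2 * u⁻¹) / sigma (q ^ 4)
  | true, false, false, true => sigma (q ^ 2 * u⁻¹) / sigma (q ^ 4)
  | _, _, _, _ => 0

/-- The weight of a left boundary vertex; the two arguments tell whether the right edge and the top
edge is directed into the vertex. -/
def leftWeight {K : Type*} [Field K] (q u : K) : Bool → Bool → K
  | true, false => 1
  | false, true => 1
  | true, true => sigma (q * u) / sigma q
  | false, false => sigma (q * u) / sigma q

/-- The weight of a right boundary vertex; the two arguments tell whether the left edge and the top
edge is directed into the vertex. -/
def rightWeight {K : Type*} [Field K] (q u : K) : Bool → Bool → K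
  | true, false => 1
  | false, true => 1
  | true, true => sigma (q * u⁻¹) / sigma q
  | false, false => sigma (q * u⁻¹) / sigma q

/-- The odd-order DASASM partition function `Z(u₁, …, u_{n+1})`. Of the sequence `u` only the
terms `u 1, …, u (n + 1)` are used. -/
def partitionFunction {K : Type*} [Field K] (n : ℕ) (q : K) (u : ℕ → K) : K :=
  ∑ C ∈ configurations n, ∏ i ∈ Finset.Icc 1 n,
    leftWeight q (u i) (rightIn C i i) (topIn C i i) *
    (∏ j ∈ Finset.Icc (i + 1) (2 * n + 1 - i),
      bulkWeight q (u i * u (min j (2 * n + 2 - j)))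
        (leftIn C i j) (bottomIn C i j) (rightIn C i j) (topIn C i j)) *
    rightWeight q (u i) (leftIn C i (2 * n + 2 - i)) (topIn C i (2 * n + 2 - i))

end DASASM

/-!
The partition function is computed by transfer operators. A state `s : ℕ → Bool` lists the
orientations of the edges cut by a line that runs through the grid from left to right (`true` for
downwards or rightwards), and a function `Φ` of states is the partition function of the part of the
grid on the far side of the line. Adding a bulk, left boundary or right boundary vertex to that part
is a linear operator on such functions (`crossing`, `leftRefl`, `rightRefl`), so `Z` is the value
`zfun` at the all-upwards state of a product of row operators applied to the constant function `1`
(`partitionFunction_eq_zfun`).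

* Symmetry. The Yang–Baxter equation and the two reflection equations move an extra crossing of the
  lines `i` and `i + 1` from the left end of the grid to the right end. At both ends it meets only
  edges directed upwards, so that it contributes the same factor. Hence `Z` is
  symmetric in `u₁, …, uₙ` (`crossing_tri`, `zfun_perm`).
* Degree. `u₁ ^ (2 * n) * Z` is a polynomial in `u₁ ^ 2` of degree at most `2 * n`
  (`evenLaurent_zfun`).
* Specializations. When `u₁ = q ^ (±1)` the first row is frozen, and `Z` reduces to the partition
  function of size `n - 1`; when `u₁ * u₂ = q ^ (±2)` two rows combine to a frozen pair, and `Z`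
  reduces to size `n - 2`; by symmetry the latter applies to each `u₁ * u_j`. When some parameter is
  `q ^ 2` and the last one is `1`, `Z` vanishes (`zfun_cons_self`, `zfun_cons_inv`,
  `zfun_cons_cons`, `zfun_cons_cons_inv`, `tri_append_eq_zero`). These are `2 * n + 1` values of
  `u₁ ^ 2`, enough to determine `Z` by induction on `n`.

The determinantal side satisfies the same conditions. Expanding the determinant along the row and
the column of `u₁` and clearing denominators gives the polynomial `bordered` in `u₁ ^ 2`. Its
degree is too large by twice the number of the remaining parameters, but it has a double zero at
each `u₁ ^ 2 = u_j ^ 2` (`sq_dvd_bordered`): there both the first row and the first column of the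
matrix become proportional to others. Those zeros cancel the squared denominators
`σ(u₁ / u_j) ^ 2`, so the product formula is a polynomial of the right degree, and its values at
the nodes follow the same recursions (`interpolates_self`, `interpolates_inv`, `interpolates_mul`,
`interpolates_mul_inv`, `interpolates_sq`).

The interpolation requires distinct nodes and other non-vanishing conditions that are not part of
the hypotheses (`Generic`). They hold for all but finitely many `s` when `q` is replaced by `q + s`
and `u_i` by `u_i + s ^ (5 * (i + 1))`; since both sides are rational functions of `s` without a
pole at `0`, the identity persists at `s = 0`.
-/

namespace DASASM

variable {K : Type*} [Field K]

/-! ### Local operators of the six-vertex model -/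

/-- The operator that adds a bulk vertex whose left and top edges are the cut edges at positions `i`
and `i + 1`; behind the new vertex these positions carry its bottom and its right edge. The vertex
has weight `a` if the left and the top edge agree (all edges upwards and leftwards, or all downwards
and rightwards), weight `b` if the orientations of the positions are exchanged, and weight `1`
otherwise. -/
def vtx (i : ℕ) (a b : K) : Module.End K ((ℕ → Bool) → K) where
  toFun Φ s := if s i = s (i + 1) then a * Φ s else Φ s + b * Φ (s ∘ Equiv.swap i (i + 1))
  map_add' Φ Ψ := by
    funext s
    simp only [Pi.add_apply]
    split_ifs <;> ring
  map_smul' r Φ := by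
    funext s
    simp only [Pi.smul_apply, smul_eq_mul, RingHom.id_apply]
    split_ifs <;> ring

/-- The operator that adds a left boundary vertex: position `0` carries its top edge before, and its
right edge behind the vertex. The weight is `1` if the orientation of the position is kept, and `l`
if it is reversed. -/
def leftRefl (l : K) : Module.End K ((ℕ → Bool) → K) where
  toFun Φ s := Φ s + l * Φ (Function.update s 0 (!s 0))
  map_add' Φ Ψ := by
    funext s
    simp only [Pi.add_apply]
    ring
  map_smul' r Φ := by
    funext s
    simp only [Pi.smul_apply, smul_eq_mul, RingHom.id_apply]
    ring

/-- The operator that adds a right boundary vertex, whose left and top edges are the cut edges at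
positions `m` and `m + 1`. Its weight is `r` if both are directed inwards or both outwards, and `1`
otherwise. -/
def rightRefl (m : ℕ) (r : K) : Module.End K ((ℕ → Bool) → K) where
  toFun Φ s := (if s m = s (m + 1) then r else 1) * Φ s
  map_add' Φ Ψ := by
    funext s
    simp only [Pi.add_apply]
    ring
  map_smul' r Φ := by
    funext s
    simp only [Pi.smul_apply, smul_eq_mul, RingHom.id_apply]
    ring

theorem vtx_apply (i : ℕ) (a b : K) (Φ : (ℕ → Bool) → K) (s : ℕ → Bool) :
    vtx i a b Φ s =
      if s i = s (i + 1) then a * Φ s else Φ s + b * Φ (s ∘ Equiv.swap i (i + 1)) := rfl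

theorem leftRefl_apply (l : K) (Φ : (ℕ → Bool) → K) (s : ℕ → Bool) :
    leftRefl l Φ s = Φ s + l * Φ (Function.update s 0 (!s 0)) := rfl

theorem rightRefl_apply (m : ℕ) (r : K) (Φ : (ℕ → Bool) → K) (s : ℕ → Bool) :
    rightRefl m r Φ s = (if s m = s (m + 1) then r else 1) * Φ s := rfl

/-- The state `s` with the four entries from position `i` on replaced by `x`, `y`, `z`, `w`. -/
def patch (i : ℕ) (x y z w : Bool) (s : ℕ → Bool) : ℕ → Bool := fun j =>
  if j = i then x else if j = i + 1 then y else if j = i + 2 then z else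
    if j = i + 3 then w else s j

theorem patch_self (i : ℕ) (s : ℕ → Bool) :
    patch i (s i) (s (i + 1)) (s (i + 2)) (s (i + 3)) s = s := by
  funext j
  unfold patch
  split_ifs <;> simp_all

section patch
variable (i : ℕ) (x y z w : Bool) (s : ℕ → Bool)
@[simp] theorem patch_zero : patch i x y z w s i = x := by simp [patch]
@[simp] theorem patch_one : patch i x y z w s (i + 1) = y := by simp [patch]
@[simp] theorem patch_two : patch i x y z w s (i + 2) = z := by simp [patch]
@[simp] theorem patch_three : patch i x y z w s (i + 3) = w := by simp [patch]
theorem patch_swap_zero : patch i x y z w s ∘ Equiv.swap i (i + 1) = patch i y x z w s := by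
  funext j
  simp only [Function.comp, Equiv.swap_apply_def, patch]
  split_ifs <;> first | rfl | omega
theorem patch_swap_one : patch i x y z w s ∘ Equiv.swap (i + 1) (i + 2) = patch i x z y w s := by
  funext j
  simp only [Function.comp, Equiv.swap_apply_def, patch]
  split_ifs <;> first | rfl | omega
theorem patch_swap_two : patch i x y z w s ∘ Equiv.swap (i + 2) (i + 3) = patch i x y w z s := by
  funext j
  simp only [Function.comp, Equiv.swap_apply_def, patch]
  split_ifs <;> first | rfl | omega
theorem patch_flip : Function.update (patch 0 x y z w s) 0 (!patch 0 x y z w s 0) =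
    patch 0 (!x) y z w s := by
  funext j
  simp only [Function.update_apply, patch]
  split_ifs <;> rfl

variable (a b : K) (Φ : (ℕ → Bool) → K)
theorem vtx_patch_zero : vtx i a b Φ (patch i x y z w s) =
    if x = y then a * Φ (patch i x y z w s)
    else Φ (patch i x y z w s) + b * Φ (patch i y x z w s) := by
  rw [vtx_apply, patch_zero, patch_one, patch_swap_zero]
theorem vtx_patch_one : vtx (i + 1) a b Φ (patch i x y z w s) =
    if y = z then a * Φ (patch i x y z w s)
    else Φ (patch i x y z w s) + b * Φ (patch i x z y w s) := by
  rw [vtx_apply, patch_one, patch_two, patch_swap_one]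
theorem vtx_patch_two : vtx (i + 2) a b Φ (patch i x y z w s) =
    if z = w then a * Φ (patch i x y z w s)
    else Φ (patch i x y z w s) + b * Φ (patch i x y w z s) := by
  rw [vtx_apply, patch_two, patch_three, patch_swap_two]
theorem leftRefl_patch : leftRefl a Φ (patch 0 x y z w s) =
    Φ (patch 0 x y z w s) + a * Φ (patch 0 (!x) y z w s) := by
  rw [leftRefl_apply, patch_flip]
theorem rightRefl_patch_zero : rightRefl i a Φ (patch i x y z w s) =
    (if x = y then a else 1) * Φ (patch i x y z w s) := by
  rw [rightRefl_apply, patch_zero, patch_one]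
theorem rightRefl_patch_two : rightRefl (i + 2) a Φ (patch i x y z w s) =
    (if z = w then a else 1) * Φ (patch i x y z w s) := by
  rw [rightRefl_apply, patch_two, patch_three]
end patch

/-! ### Yang–Baxter and reflection equations -/

theorem end_ext_patch {A B : Module.End K ((ℕ → Bool) → K)} (i : ℕ)
    (h : ∀ Φ s x y z w, A Φ (patch i x y z w s) = B Φ (patch i x y z w s)) : A = B := by
  refine LinearMap.ext fun Φ => funext fun s => ?_
  rw [← patch_self i s]
  exact h _ _ _ _ _ _

/-- The braid form of the Yang–Baxter equation; the hypotheses are the relations between the three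
pairs of weights that it amounts to. -/
theorem vtx_yang_baxter (i : ℕ) {a₁ b₁ a₂ b₂ a₃ b₃ : K}
    (h₁ : a₁ * a₃ = a₂ + b₁ * b₃) (h₂ : a₃ * b₂ = a₂ * b₃ + b₁) (h₃ : a₁ * b₂ = a₂ * b₁ + b₃) :
    vtx i a₁ b₁ * vtx (i + 1) a₂ b₂ * vtx i a₃ b₃ =
      vtx (i + 1) a₃ b₃ * vtx i a₂ b₂ * vtx (i + 1) a₁ b₁ := by
  refine end_ext_patch i fun Φ s x y z w => ?_
  simp only [Module.End.mul_apply, vtx_patch_zero, vtx_patch_one]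
  cases x <;> cases y <;> cases z <;>
    simp only [if_true, Bool.false_eq_true, Bool.true_eq_false, if_false]
  all_goals grind

/-- The reflection equation at the left boundary. -/
theorem vtx_left_reflection {a b a' b' l₁ l₂ : K}
    (h₁ : a' * b * l₁ = a * b' * l₁ + (b + b') * l₂)
    (h₂ : (1 + b * b' - a * a') * l₂ = (a' - a) * l₁) :
    vtx 0 a' b' * leftRefl l₁ * vtx 0 a b * leftRefl l₂ =
      leftRefl l₂ * vtx 0 a b * leftRefl l₁ * vtx 0 a' b' := by
  refine end_ext_patch 0 fun Φ s x y z w => ?_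
  simp only [Module.End.mul_apply, vtx_patch_zero, leftRefl_patch]
  cases x <;> cases y <;>
    simp only [if_true, Bool.false_eq_true, Bool.true_eq_false, if_false, Bool.not_true,
      Bool.not_false]
  all_goals grind

/-- `Φ s` depends only on the entries of `s` at positions less than `N`. -/
def DependsBelow (N : ℕ) (Φ : (ℕ → Bool) → K) : Prop :=
  ∀ s s', (∀ j < N, s j = s' j) → Φ s = Φ s'

omit [Field K] in
theorem DependsBelow.patch {p : ℕ} {Φ : (ℕ → Bool) → K} (h : DependsBelow p Φ) (x y z w : Bool)
    (s : ℕ → Bool) : Φ (patch p x y z w s) = Φ s := by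
  refine h _ _ fun j hj => ?_
  unfold DASASM.patch
  split_ifs <;> first | rfl | omega

/-- The reflection equation at the right boundary. It holds only on functions that do not depend on
the four positions involved, as both right boundary vertices absorb two edges each. -/
theorem vtx_right_reflection (p : ℕ) {a b a' b' r₁ r₂ : K} {Φ : (ℕ → Bool) → K}
    (hΦ : DependsBelow p Φ)
    (h₁ : (a * a' - b * b') * r₂ = (a + b') * r₁)
    (h₂ : (a' - b) * r₂ = (1 + a * b' - a' * b) * r₁) :
    (vtx p a' b' * vtx (p + 1) a b * rightRefl (p + 2) r₁ * rightRefl p r₂) Φ =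
      (vtx (p + 2) a' b' * vtx (p + 1) a b * rightRefl (p + 2) r₂ * rightRefl p r₁) Φ := by
  funext s
  rw [← patch_self p s]
  generalize s p = x, s (p + 1) = y, s (p + 2) = z, s (p + 3) = w
  simp only [Module.End.mul_apply, vtx_patch_zero, vtx_patch_one, vtx_patch_two,
    rightRefl_patch_zero, rightRefl_patch_two, hΦ.patch]
  cases x <;> cases y <;> cases z <;> cases w <;>
    simp only [if_true, Bool.false_eq_true, Bool.true_eq_false, if_false]
  all_goals grind

/-! ### Commutation of distant operators -/

theorem swap_comp_swap_comm {i j : ℕ} (h : i + 2 ≤ j) (s : ℕ → Bool) :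
    (s ∘ Equiv.swap i (i + 1)) ∘ Equiv.swap j (j + 1) =
      (s ∘ Equiv.swap j (j + 1)) ∘ Equiv.swap i (i + 1) := by
  funext k
  simp only [Function.comp, Equiv.swap_apply_def]
  congr 1
  split_ifs <;> omega

theorem comp_swap_apply_of_ne (s : ℕ → Bool) {i k : ℕ} (h : k ≠ i) (h' : k ≠ i + 1) :
    (s ∘ Equiv.swap i (i + 1)) k = s k := by
  simp [Function.comp, Equiv.swap_apply_of_ne_of_ne h h']

theorem vtx_commute {i j : ℕ} (h : i + 2 ≤ j) (a b a' b' : K) :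
    Commute (vtx i a b) (vtx j a' b') := by
  refine LinearMap.ext fun Φ => funext fun s => ?_
  simp only [Module.End.mul_apply, vtx_apply, swap_comp_swap_comm h]
  rw [comp_swap_apply_of_ne s (i := i) (k := j) (by omega) (by omega),
    comp_swap_apply_of_ne s (i := i) (k := j + 1) (by omega) (by omega),
    comp_swap_apply_of_ne s (i := j) (k := i) (by omega) (by omega),
    comp_swap_apply_of_ne s (i := j) (k := i + 1) (by omega) (by omega)]
  split_ifs <;> ring

theorem leftRefl_commute_vtx {i : ℕ} (h : 1 ≤ i) (l a b : K) :
    Commute (leftRefl l) (vtx i a b) := by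
  refine LinearMap.ext fun Φ => funext fun s => ?_
  have hu : ∀ c, Function.update s 0 c ∘ Equiv.swap i (i + 1) =
      Function.update (s ∘ Equiv.swap i (i + 1)) 0 c := by
    intro c
    funext k
    rcases Nat.eq_zero_or_pos k with rfl | hk
    · simp [Function.comp, Equiv.swap_apply_of_ne_of_ne (show 0 ≠ i by omega)
        (show 0 ≠ i + 1 by omega)]
    · have h0 : Equiv.swap i (i + 1) k ≠ 0 := by
        rw [Equiv.swap_apply_def]
        split_ifs <;> omega
      rw [Function.update_of_ne (by omega), Function.comp, Function.update_of_ne h0, Function.comp]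
  simp only [Module.End.mul_apply, vtx_apply, leftRefl_apply, hu]
  rw [comp_swap_apply_of_ne s (i := i) (k := 0) (by omega) (by omega),
    Function.update_of_ne (by omega), Function.update_of_ne (by omega)]
  split_ifs <;> ring

theorem leftRefl_commute_rightRefl {m : ℕ} (h : 1 ≤ m) (l r : K) :
    Commute (leftRefl l) (rightRefl m r) := by
  refine LinearMap.ext fun Φ => funext fun s => ?_
  simp only [Module.End.mul_apply, rightRefl_apply, leftRefl_apply]
  rw [Function.update_of_ne (by omega), Function.update_of_ne (by omega)]
  ring

theorem vtx_commute_rightRefl {i m : ℕ} (h : i + 2 ≤ m) (a b r : K) :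
    Commute (vtx i a b) (rightRefl m r) := by
  refine LinearMap.ext fun Φ => funext fun s => ?_
  simp only [Module.End.mul_apply, rightRefl_apply, vtx_apply]
  rw [comp_swap_apply_of_ne s (i := i) (k := m) (by omega) (by omega),
    comp_swap_apply_of_ne s (i := i) (k := m + 1) (by omega) (by omega)]
  split_ifs <;> ring

/-! ### Trigonometric weights -/

/-- The bulk vertex with spectral parameter `z`. The weights of the model with vertex parameter `x`
are obtained at `z = q ^ 2 * x`; in terms of `z` the Yang–Baxter equation reads `z₂ = z₁ * z₃`. -/
def crossing (q : K) (i : ℕ) (z : K) : Module.End K ((ℕ → Bool) → K) :=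
  vtx i (sigma (q ^ 4 * z⁻¹) / sigma (q ^ 4)) (sigma z / sigma (q ^ 4))

theorem crossing_yang_baxter {q z₁ z₂ z₃ : K} (hq : q ≠ 0) (hq4 : sigma (q ^ 4) ≠ 0)
    (h₁ : z₁ ≠ 0) (h₃ : z₃ ≠ 0) (h₂ : z₂ = z₁ * z₃) (i : ℕ) :
    crossing q i z₁ * crossing q (i + 1) z₂ * crossing q i z₃ =
      crossing q (i + 1) z₃ * crossing q i z₂ * crossing q (i + 1) z₁ := by
  subst h₂
  apply vtx_yang_baxter <;> field_simp <;> simp only [sigma] <;> field_simp <;> ring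

theorem sigma_sq (x : K) : sigma (x ^ 2) = sigma x * (x + x⁻¹) := by
  by_cases hx : x = 0
  · simp [hx, sigma]
  · simp only [sigma]; field_simp; ring

theorem sigma_ne_zero_of_sq {x : K} (h : sigma (x ^ 2) ≠ 0) : sigma x ≠ 0 := by
  rw [sigma_sq] at h
  exact left_ne_zero_of_mul h

theorem sigma_ne_zero_of_pow_four {x : K} (h : sigma (x ^ 4) ≠ 0) : sigma x ≠ 0 :=
  sigma_ne_zero_of_sq (sigma_ne_zero_of_sq (by rwa [← pow_mul]))

theorem crossing_left_reflection {q u₁ u₂ : K} (hq : q ≠ 0) (hq4 : sigma (q ^ 4) ≠ 0)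
    (h₁ : u₁ ≠ 0) (h₂ : u₂ ≠ 0) :
    crossing q 0 (u₁ / u₂) * leftRefl (sigma (q * u₁) / sigma q) *
        crossing q 0 (q ^ 2 * (u₁ * u₂)) * leftRefl (sigma (q * u₂) / sigma q) =
      leftRefl (sigma (q * u₂) / sigma q) * crossing q 0 (q ^ 2 * (u₁ * u₂)) *
        leftRefl (sigma (q * u₁) / sigma q) * crossing q 0 (u₁ / u₂) := by
  have hq1 := sigma_ne_zero_of_pow_four hq4
  apply vtx_left_reflection
  · field_simp
    simp only [sigma]; field_simp; ring
  · field_simp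
    simp only [sigma]; field_simp; ring

theorem crossing_right_reflection {q u₁ u₂ : K} (hq : q ≠ 0) (hq4 : sigma (q ^ 4) ≠ 0)
    (h₁ : u₁ ≠ 0) (h₂ : u₂ ≠ 0) (p : ℕ) {Φ : (ℕ → Bool) → K} (hΦ : DependsBelow p Φ) :
    (crossing q p (u₁ / u₂) * crossing q (p + 1) (q ^ 2 * (u₁ * u₂)) *
        rightRefl (p + 2) (sigma (q * u₁⁻¹) / sigma q) *
        rightRefl p (sigma (q * u₂⁻¹) / sigma q)) Φ =
      (crossing q (p + 2) (u₁ / u₂) * crossing q (p + 1) (q ^ 2 * (u₁ * u₂)) *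
        rightRefl (p + 2) (sigma (q * u₂⁻¹) / sigma q) *
        rightRefl p (sigma (q * u₁⁻¹) / sigma q)) Φ := by
  have hq1 := sigma_ne_zero_of_pow_four hq4
  apply vtx_right_reflection p hΦ
  · field_simp
    simp only [sigma]; field_simp; ring
  · field_simp
    simp only [sigma]; field_simp; ring

/-! ### Row operators and the exchange of adjacent rows -/

/-- The bulk vertices of a row with parameter `u`, in columns with parameters `ws`, starting at
position `k`. -/
def chain (q u : K) : ℕ → List K → Module.End K ((ℕ → Bool) → K)
  | _, [] => 1
  | k, w :: ws => crossing q k (q ^ 2 * (u * w)) * chain q u (k + 1) ws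

theorem chain_append (q u : K) (k : ℕ) (ws ws' : List K) :
    chain q u k (ws ++ ws') = chain q u k ws * chain q u (k + ws.length) ws' := by
  induction ws generalizing k with
  | nil => simp [chain]
  | cons w ws ih =>
    simp only [List.cons_append, chain, ih, List.length_cons, mul_assoc, Nat.add_assoc,
      Nat.add_comm 1]

theorem chain_commute_of_le {T : Module.End K ((ℕ → Bool) → K)} {m : ℕ}
    (hT : ∀ j, m ≤ j → ∀ a b, Commute T (vtx j a b)) (q u : K) {k : ℕ} (hk : m ≤ k) (ws : List K) :
    Commute T (chain q u k ws) := by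
  induction ws generalizing k with
  | nil => exact Commute.one_right _
  | cons w ws ih => exact (hT k hk _ _).mul_right (ih (by omega))

theorem chain_commute_of_lt {T : Module.End K ((ℕ → Bool) → K)} {m : ℕ}
    (hT : ∀ j, j < m → ∀ a b, Commute (vtx j a b) T) (q u : K) {k : ℕ} (ws : List K)
    (hk : k + ws.length ≤ m) : Commute (chain q u k ws) T := by
  induction ws generalizing k with
  | nil => exact Commute.one_left _
  | cons w ws ih =>
    simp only [List.length_cons] at hk
    exact (hT k (by omega) _ _).mul_left (ih (by omega))

/-- A complete row with parameter `u`: left boundary vertex, bulk vertices, right boundary vertex.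
-/
def row (q u : K) (ws : List K) : Module.End K ((ℕ → Bool) → K) :=
  leftRefl (sigma (q * u) / sigma q) * chain q u 0 ws *
    rightRefl ws.length (sigma (q * u⁻¹) / sigma q)

/-- The partition function of the triangle with row parameters `us`, as a function of the
orientations of its top edges. The columns crossed by the first row have the parameters of the
remaining rows, once in this order and once in reverse, and the middle column has parameter `c`. -/
def tri (q c : K) : List K → (ℕ → Bool) → K
  | [] => fun _ => 1
  | u :: us => row q u (us ++ c :: us.reverse) (tri q c us)

theorem DependsBelow.vtx {N i : ℕ} {Φ : (ℕ → Bool) → K} (h : DependsBelow N Φ) (hi : i + 2 ≤ N)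
    (a b : K) : DependsBelow N (vtx i a b Φ) := by
  intro s s' hs
  simp only [vtx_apply]
  rw [hs i (by omega), hs (i + 1) (by omega), h s s' hs, h (s ∘ _) (s' ∘ Equiv.swap i (i + 1))]
  intro j hj
  refine hs _ ?_
  rw [Equiv.swap_apply_def]
  split_ifs <;> omega

theorem DependsBelow.leftRefl {N : ℕ} {Φ : (ℕ → Bool) → K} (h : DependsBelow N Φ) (hi : 1 ≤ N)
    (l : K) : DependsBelow N (leftRefl l Φ) := by
  intro s s' hs
  simp only [leftRefl_apply]
  rw [h s s' hs, h (Function.update s 0 (!s 0)) (Function.update s' 0 (!s' 0))]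
  intro j hj
  simp only [Function.update_apply]
  rw [hs 0 (by omega), hs j hj]

theorem DependsBelow.rightRefl {N m : ℕ} {Φ : (ℕ → Bool) → K} (h : DependsBelow N Φ)
    (hm : m + 2 ≤ N) (r : K) : DependsBelow N (rightRefl m r Φ) := by
  intro s s' hs
  simp only [rightRefl_apply]
  rw [hs m (by omega), hs (m + 1) (by omega), h s s' hs]

omit [Field K] in
theorem DependsBelow.mono {N M : ℕ} {Φ : (ℕ → Bool) → K} (h : DependsBelow N Φ) (hm : N ≤ M) :
    DependsBelow M Φ := fun s s' hs => h s s' fun j hj => hs j (by omega)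

theorem DependsBelow.chain {N : ℕ} {Φ : (ℕ → Bool) → K} (h : DependsBelow N Φ) (q u : K) {k : ℕ}
    (ws : List K) (hk : k + ws.length + 1 ≤ N) : DependsBelow N (chain q u k ws Φ) := by
  induction ws generalizing k with
  | nil => exact h
  | cons w ws ih =>
    simp only [List.length_cons] at hk
    exact (ih (by omega)).vtx (by omega) _ _

theorem DependsBelow.row {Φ : (ℕ → Bool) → K} (q u : K) (ws : List K)
    (h : DependsBelow ws.length Φ) : DependsBelow (ws.length + 2) (row q u ws Φ) :=
  (((h.mono (by omega)).rightRefl le_rfl _).chain q u ws (by omega)).leftRefl (by omega) _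

theorem dependsBelow_tri (q c : K) (us : List K) :
    DependsBelow (2 * us.length + 1) (tri q c us) := by
  induction us with
  | nil => exact fun _ _ _ => rfl
  | cons u us ih =>
    have h : (us ++ c :: us.reverse).length = 2 * us.length + 1 := by
      simp only [List.length_append, List.length_cons, List.length_reverse]; omega
    rw [← h] at ih
    have := ih.row q u
    rw [h] at this
    exact this.mono (by simp only [List.length_cons]; omega)

/-- A crossing travels through two adjacent rows of bulk vertices, by repeated use of the
Yang–Baxter equation. -/
theorem crossing_chain_chain {q u₁ u₂ : K} (hq : q ≠ 0) (hq4 : sigma (q ^ 4) ≠ 0)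
    (h₁ : u₁ ≠ 0) (h₂ : u₂ ≠ 0) (k : ℕ) {ws : List K} (hws : ∀ w ∈ ws, w ≠ 0) :
    crossing q k (u₁ / u₂) * (chain q u₁ (k + 1) ws * chain q u₂ k ws) =
      chain q u₂ (k + 1) ws * chain q u₁ k ws * crossing q (k + ws.length) (u₁ / u₂) := by
  induction ws generalizing k with
  | nil => simp [chain]
  | cons w ws ih =>
    have hw : w ≠ 0 := hws w (by simp)
    have hc : ∀ u z, crossing q k z * chain q u (k + 1 + 1) ws =
        chain q u (k + 1 + 1) ws * crossing q k z := fun u z =>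
      chain_commute_of_le (m := k + 2) (fun j hj a b => vtx_commute hj _ _ _ _) q u le_rfl ws
    have hyb := crossing_yang_baxter (z₁ := u₁ / u₂) (z₂ := q ^ 2 * (u₁ * w))
      (z₃ := q ^ 2 * (u₂ * w)) hq hq4 (by positivity) (by positivity) (by field_simp) k
    have ih' := ih (k + 1) (fun w hw => hws w (by simp [hw]))
    simp only [chain, List.length_cons]
    calc _ = crossing q k (u₁ / u₂) * crossing q (k + 1) (q ^ 2 * (u₁ * w)) *
          (chain q u₁ (k + 1 + 1) ws * crossing q k (q ^ 2 * (u₂ * w))) *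
          chain q u₂ (k + 1) ws := by simp only [mul_assoc]
      _ = crossing q k (u₁ / u₂) * crossing q (k + 1) (q ^ 2 * (u₁ * w)) *
          crossing q k (q ^ 2 * (u₂ * w)) *
          (chain q u₁ (k + 1 + 1) ws * chain q u₂ (k + 1) ws) := by
        rw [← hc]; simp only [mul_assoc]
      _ = crossing q (k + 1) (q ^ 2 * (u₂ * w)) * crossing q k (q ^ 2 * (u₁ * w)) *
          (crossing q (k + 1) (u₁ / u₂) *
          (chain q u₁ (k + 1 + 1) ws * chain q u₂ (k + 1) ws)) := by
        rw [hyb]; simp only [mul_assoc]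
      _ = crossing q (k + 1) (q ^ 2 * (u₂ * w)) * (crossing q k (q ^ 2 * (u₁ * w)) *
          chain q u₂ (k + 1 + 1) ws) * chain q u₁ (k + 1) ws *
          crossing q (k + 1 + ws.length) (u₁ / u₂) := by
        rw [ih']; simp only [mul_assoc]
      _ = _ := by
        rw [hc, show k + 1 + ws.length = k + (ws.length + 1) by omega]; simp only [mul_assoc]

/-- Two adjacent rows, whose outermost columns carry each other's parameter, are exchanged at the
price of moving a crossing from the left end to the right end. The steps are the left reflection
equation, the passage through the bulk, and the right reflection equation. -/
theorem crossing_row_row {q u₁ u₂ : K} (hq : q ≠ 0) (hq4 : sigma (q ^ 4) ≠ 0)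
    (h₁ : u₁ ≠ 0) (h₂ : u₂ ≠ 0) {ws : List K} (hws : ∀ w ∈ ws, w ≠ 0) {Φ : (ℕ → Bool) → K}
    (hΦ : DependsBelow ws.length Φ) :
    crossing q 0 (u₁ / u₂) (row q u₁ (u₂ :: ws ++ [u₂]) (row q u₂ ws Φ)) =
      crossing q (ws.length + 2) (u₁ / u₂) (row q u₂ (u₁ :: ws ++ [u₁]) (row q u₁ ws Φ)) := by
  set m := ws.length with hm
  set X := crossing q 0 (q ^ 2 * (u₁ * u₂)) with hX
  set Y := crossing q (m + 1) (q ^ 2 * (u₁ * u₂)) with hY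
  -- normal form of a product of two rows
  have key : ∀ v₁ v₂ : K, v₁ * v₂ = u₁ * u₂ →
      row q v₁ (v₂ :: ws ++ [v₂]) * row q v₂ ws =
      leftRefl (sigma (q * v₁) / sigma q) * X * leftRefl (sigma (q * v₂) / sigma q) *
      (chain q v₁ 1 ws * chain q v₂ 0 ws) *
      (Y * rightRefl (m + 2) (sigma (q * v₁⁻¹) / sigma q) *
        rightRefl m (sigma (q * v₂⁻¹) / sigma q)) := by
    intro v₁ v₂ hv
    have e : (v₂ :: (ws ++ [v₂])).length = m + 2 := by simp [hm]
    have c1 : leftRefl (sigma (q * v₂) / sigma q) * chain q v₁ 1 ws =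
        chain q v₁ 1 ws * leftRefl (sigma (q * v₂) / sigma q) :=
      chain_commute_of_le (fun j hj a b => leftRefl_commute_vtx hj _ a b) q v₁ le_rfl ws
    have c2 : leftRefl (sigma (q * v₂) / sigma q) * Y =
        Y * leftRefl (sigma (q * v₂) / sigma q) := leftRefl_commute_vtx (by omega) _ _ _
    have c3 : leftRefl (sigma (q * v₂) / sigma q) *
        rightRefl (m + 2) (sigma (q * v₁⁻¹) / sigma q) =
        rightRefl (m + 2) (sigma (q * v₁⁻¹) / sigma q) * leftRefl (sigma (q * v₂) / sigma q) :=
      leftRefl_commute_rightRefl (by omega) _ _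
    have c4 : chain q v₂ 0 ws * Y = Y * chain q v₂ 0 ws :=
      chain_commute_of_lt (m := m) (fun j hj a b => vtx_commute (by omega) a b _ _) q v₂ ws
        (by omega)
    have c5 : chain q v₂ 0 ws * rightRefl (m + 2) (sigma (q * v₁⁻¹) / sigma q) =
        rightRefl (m + 2) (sigma (q * v₁⁻¹) / sigma q) * chain q v₂ 0 ws :=
      chain_commute_of_lt (m := m) (fun j hj a b => vtx_commute_rightRefl (by omega) a b _) q v₂ ws
        (by omega)
    simp only [row, e, ← hm, List.cons_append, chain, chain_append, mul_one, zero_add, hv,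
      Nat.add_comm 1, ← hX, ← hY]
    generalize leftRefl (sigma (q * v₂) / sigma q) = L₂ at *
    generalize rightRefl (m + 2) (sigma (q * v₁⁻¹) / sigma q) = R₁ at *
    generalize chain q v₁ 1 ws = A at *
    generalize chain q v₂ 0 ws = B at *
    simp only [mul_assoc]
    congr 2
    rw [← mul_assoc R₁ L₂, ← c3, mul_assoc L₂, ← mul_assoc Y L₂, ← c2, mul_assoc L₂,
      ← mul_assoc A L₂, ← c1, mul_assoc L₂, ← mul_assoc R₁ B, ← c5, mul_assoc B,
      ← mul_assoc Y B, ← c4, mul_assoc B]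
  have k1 := key u₁ u₂ rfl
  have k2 := key u₂ u₁ (mul_comm _ _)
  have hl := crossing_left_reflection hq hq4 h₁ h₂
  have hr := crossing_right_reflection hq hq4 h₁ h₂ m hΦ
  have hcc := crossing_chain_chain hq hq4 h₁ h₂ 0 hws
  simp only [zero_add, ← hX, ← hY, ← hm] at hl hr hcc
  have d1 : leftRefl (sigma (q * u₂) / sigma q) * crossing q (m + 2) (u₁ / u₂) =
      crossing q (m + 2) (u₁ / u₂) * leftRefl (sigma (q * u₂) / sigma q) :=
    leftRefl_commute_vtx (by omega) _ _ _
  have d1' : leftRefl (sigma (q * u₁) / sigma q) * crossing q (m + 2) (u₁ / u₂) =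
      crossing q (m + 2) (u₁ / u₂) * leftRefl (sigma (q * u₁) / sigma q) :=
    leftRefl_commute_vtx (by omega) _ _ _
  have d2 : X * crossing q (m + 2) (u₁ / u₂) = crossing q (m + 2) (u₁ / u₂) * X :=
    vtx_commute (by omega) _ _ _ _
  have d3 : chain q u₂ 1 ws * crossing q (m + 2) (u₁ / u₂) =
      crossing q (m + 2) (u₁ / u₂) * chain q u₂ 1 ws :=
    chain_commute_of_lt (m := m + 1) (fun j hj a b => vtx_commute (by omega) a b _ _) q u₂ ws
        (by omega)
  have d4 : chain q u₁ 0 ws * crossing q (m + 2) (u₁ / u₂) =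
      crossing q (m + 2) (u₁ / u₂) * chain q u₁ 0 ws :=
    chain_commute_of_lt (m := m) (fun j hj a b => vtx_commute (by omega) a b _ _) q u₁ ws
        (by omega)
  rw [← Module.End.mul_apply (row q u₁ _), ← Module.End.mul_apply (row q u₂ _), k1, k2,
    ← Module.End.mul_apply (crossing q 0 _), ← Module.End.mul_apply (crossing q (m + 2) _)]
  generalize leftRefl (sigma (q * u₂) / sigma q) = L₂ at *
  generalize leftRefl (sigma (q * u₁) / sigma q) = L₁ at *
  generalize crossing q (m + 2) (u₁ / u₂) = T at *
  calc _ = ((crossing q 0 (u₁ / u₂) * L₁ * X * L₂) * ((chain q u₁ 1 ws * chain q u₂ 0 ws) *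
        (Y * rightRefl (m + 2) (sigma (q * u₁⁻¹) / sigma q) *
        rightRefl m (sigma (q * u₂⁻¹) / sigma q)))) Φ := by simp only [mul_assoc]
    _ = ((L₂ * X * L₁) * ((crossing q 0 (u₁ / u₂) * (chain q u₁ 1 ws * chain q u₂ 0 ws)) *
        (Y * rightRefl (m + 2) (sigma (q * u₁⁻¹) / sigma q) *
        rightRefl m (sigma (q * u₂⁻¹) / sigma q)))) Φ := by rw [hl]; simp only [mul_assoc]
    _ = ((L₂ * X * L₁) * (chain q u₂ 1 ws * chain q u₁ 0 ws))
        ((crossing q m (u₁ / u₂) * Y * rightRefl (m + 2) (sigma (q * u₁⁻¹) / sigma q) *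
        rightRefl m (sigma (q * u₂⁻¹) / sigma q)) Φ) := by
      rw [hcc, ← Module.End.mul_apply]; simp only [mul_assoc]
    _ = _ := by
      rw [hr, ← Module.End.mul_apply]
      congr 1
      simp only [mul_assoc]
      rw [← mul_assoc (chain q u₁ 0 ws) T, d4, mul_assoc T, ← mul_assoc (chain q u₂ 1 ws) T, d3,
        mul_assoc T, ← mul_assoc L₁ T, d1', mul_assoc T, ← mul_assoc X T, d2, mul_assoc T,
        ← mul_assoc L₂ T, d1, mul_assoc T]

/-! ### Symmetry of the partition function -/

/-- A crossing of two adjacent columns passes through a row from top to bottom, exchanging the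
column parameters. -/
theorem crossing_mul_row {q u a b : K} (hq : q ≠ 0) (hq4 : sigma (q ^ 4) ≠ 0) (hu : u ≠ 0)
    (ha : a ≠ 0) (hb : b ≠ 0) (l t : List K) :
    crossing q (l.length + 1) (a / b) * row q u (l ++ a :: b :: t) =
      row q u (l ++ b :: a :: t) * crossing q l.length (a / b) := by
  have hyb := crossing_yang_baxter (z₁ := q ^ 2 * (u * b)) (z₂ := q ^ 2 * (u * a))
    (z₃ := a / b) hq hq4 (by positivity) (by positivity) (by field_simp) l.length
  have e : (l ++ b :: a :: t).length = (l ++ a :: b :: t).length := by simp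
  have c1 : leftRefl (sigma (q * u) / sigma q) * crossing q (l.length + 1) (a / b) =
      crossing q (l.length + 1) (a / b) * leftRefl (sigma (q * u) / sigma q) :=
    leftRefl_commute_vtx (by omega) _ _ _
  have c2 : chain q u 0 l * crossing q (l.length + 1) (a / b) =
      crossing q (l.length + 1) (a / b) * chain q u 0 l :=
    chain_commute_of_lt (m := l.length) (fun j hj a b => vtx_commute (by omega) a b _ _) q u l
      (by omega)
  have c3 : crossing q l.length (a / b) * chain q u (l.length + 1 + 1) t =
      chain q u (l.length + 1 + 1) t * crossing q l.length (a / b) :=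
    chain_commute_of_le (m := l.length + 2) (fun j hj a b => vtx_commute hj _ _ _ _) q u le_rfl t
  have c4 : crossing q l.length (a / b) *
        rightRefl (l ++ a :: b :: t).length (sigma (q * u⁻¹) / sigma q) =
      rightRefl (l ++ a :: b :: t).length (sigma (q * u⁻¹) / sigma q) *
        crossing q l.length (a / b) :=
    vtx_commute_rightRefl (by simp) _ _ _
  simp only [row, e]
  generalize rightRefl (l ++ a :: b :: t).length (sigma (q * u⁻¹) / sigma q) = R at *
  simp only [chain_append, chain, zero_add]
  generalize leftRefl (sigma (q * u) / sigma q) = L at *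
  generalize chain q u 0 l = A at *
  generalize chain q u (l.length + 1 + 1) t = B at *
  calc _ = crossing q (l.length + 1) (a / b) * L * A * crossing q l.length (q ^ 2 * (u * a)) *
        crossing q (l.length + 1) (q ^ 2 * (u * b)) * B * R := by simp only [mul_assoc]
    _ = L * A * (crossing q (l.length + 1) (a / b) * crossing q l.length (q ^ 2 * (u * a)) *
        crossing q (l.length + 1) (q ^ 2 * (u * b))) * B * R := by
      rw [← c1, mul_assoc L, ← c2]; simp only [mul_assoc]
    _ = L * A * (crossing q l.length (q ^ 2 * (u * b)) *
        crossing q (l.length + 1) (q ^ 2 * (u * a))) *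
        ((crossing q l.length (a / b) * B) * R) := by
      rw [← hyb]; simp only [mul_assoc]
    _ = _ := by
      rw [c3, mul_assoc B, c4]; simp only [mul_assoc]

theorem row_mul_crossing {q u a b : K} (hq : q ≠ 0) (hq4 : sigma (q ^ 4) ≠ 0) (hu : u ≠ 0)
    (ha : a ≠ 0) (hb : b ≠ 0) (l t : List K) :
    row q u (l ++ b :: a :: t) * crossing q l.length (a / b) =
      crossing q (l.length + 1) (a / b) * row q u (l ++ a :: b :: t) :=
  (crossing_mul_row hq hq4 hu ha hb l t).symm

/-- Exchange of two adjacent row parameters in a triangle. The crossing sits on top of the triangle: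
on the left-hand side of the equation between the two columns left of the middle that continue the
two rows, after the exchange between those right of the middle. -/
theorem crossing_tri {q c a b : K} (hq : q ≠ 0) (hq4 : sigma (q ^ 4) ≠ 0) (hc : c ≠ 0)
    (ha : a ≠ 0) (hb : b ≠ 0) (l r : List K) (hl : ∀ w ∈ l, w ≠ 0) (hr : ∀ w ∈ r, w ≠ 0) :
    crossing q l.length (a / b) (tri q c (l ++ a :: b :: r)) =
      crossing q (l.length + 2 * r.length + 3) (a / b) (tri q c (l ++ b :: a :: r)) := by
  induction l with
  | nil =>
    have e : (r ++ c :: r.reverse).length = 2 * r.length + 1 := by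
      simp only [List.length_append, List.length_cons, List.length_reverse]; omega
    have := crossing_row_row (ws := r ++ c :: r.reverse) (Φ := tri q c r) hq hq4 ha hb
      (by simp only [List.mem_append, List.mem_cons, List.mem_reverse]; aesop)
      (by rw [e]; exact dependsBelow_tri q c r)
    rw [e] at this
    simpa [tri] using this
  | cons u l ih =>
    have hu : u ≠ 0 := hl u (by simp)
    have ih' := ih fun w hw => hl w (by simp [hw])
    have h1 := crossing_mul_row hq hq4 hu ha hb l (r ++ c :: (r.reverse ++ b :: a :: l.reverse))
    have h2 := row_mul_crossing hq hq4 hu ha hb (l ++ b :: a :: (r ++ c :: r.reverse)) l.reverse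
    have e : (l ++ b :: a :: (r ++ c :: r.reverse)).length = l.length + 2 * r.length + 3 := by
      simp only [List.length_append, List.length_cons, List.length_reverse]; omega
    rw [e] at h2
    simp only [List.cons_append, tri, List.length_cons, List.reverse_append, List.reverse_cons,
      List.append_assoc, List.nil_append] at h1 h2 ⊢
    rw [← Module.End.mul_apply, h1, Module.End.mul_apply, ih', ← Module.End.mul_apply, h2,
      Module.End.mul_apply, show l.length + 1 + 2 * r.length + 3 = l.length + 2 * r.length + 3 + 1
        by omega]

/-- The partition function with row parameters `us` and middle parameter `c`: the value of `tri` at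
the state with all edges directed upwards. -/
def zfun (q c : K) (us : List K) : K := tri q c us fun _ => false

theorem vtx_allFalse (i : ℕ) (a b : K) (Φ : (ℕ → Bool) → K) :
    vtx i a b Φ (fun _ => false) = a * Φ fun _ => false := by
  simp [vtx_apply]

/-- One of the two ratios suffices: the crossing acts on the all-upwards state by the same non-zero
factor at both ends, and either order of the two parameters may be used. -/
theorem zfun_swap {q c a b : K} (hq : q ≠ 0) (hq4 : sigma (q ^ 4) ≠ 0) (hc : c ≠ 0)
    (ha : a ≠ 0) (hb : b ≠ 0) (hab : sigma (q ^ 4 * (a / b)) ≠ 0 ∨ sigma (q ^ 4 * (b / a)) ≠ 0)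
    (l r : List K) (hl : ∀ w ∈ l, w ≠ 0) (hr : ∀ w ∈ r, w ≠ 0) :
    zfun q c (l ++ a :: b :: r) = zfun q c (l ++ b :: a :: r) := by
  have key : ∀ {a b : K}, a ≠ 0 → b ≠ 0 → sigma (q ^ 4 * (b / a)) ≠ 0 →
      zfun q c (l ++ a :: b :: r) = zfun q c (l ++ b :: a :: r) := by
    intro a b ha hb h
    have := congrFun (crossing_tri hq hq4 hc ha hb l r hl hr) fun _ => false
    simp only [crossing, vtx_allFalse, inv_div] at this
    exact mul_left_cancel₀ (div_ne_zero h hq4) this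
  rcases hab with h | h
  · exact (key hb ha h).symm
  · exact key ha hb h

theorem zfun_perm {q c : K} (hq : q ≠ 0) (hq4 : sigma (q ^ 4) ≠ 0) (hc : c ≠ 0) {us vs : List K}
    (h : us.Perm vs) (hus : ∀ a ∈ us, a ≠ 0)
    (hab : ∀ a ∈ us, ∀ b ∈ us, sigma (q ^ 4 * (a / b)) ≠ 0 ∨ sigma (q ^ 4 * (b / a)) ≠ 0)
    (l : List K) (hl : ∀ a ∈ l, a ≠ 0) : zfun q c (l ++ us) = zfun q c (l ++ vs) := by
  induction h generalizing l with
  | nil => rfl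
  | cons x _ ih =>
    have := ih (fun a ha => hus a (by simp [ha]))
      (fun a ha b hb => hab a (by simp [ha]) b (by simp [hb])) (l ++ [x]) (by
        intro a ha
        simp only [List.mem_append, List.mem_singleton] at ha
        rcases ha with ha | rfl
        · exact hl a ha
        · exact hus a (by simp))
    simpa using this
  | swap x y t =>
    exact zfun_swap hq hq4 hc (hus _ (by simp)) (hus _ (by simp)) (hab _ (by simp) _ (by simp)) l t
      hl fun w hw => hus w (by simp [hw])
  | trans h₁ h₂ ih₁ ih₂ =>
    rw [ih₁ hus hab l hl]
    exact ih₂ (fun a ha => hus a (h₁.mem_iff.2 ha))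
      (fun a ha b hb => hab a (h₁.mem_iff.2 ha) b (h₁.mem_iff.2 hb)) l hl

/-! ### States with at most one reversed edge -/

/-- The state with `true` at position `j` only. -/
def single (j : ℕ) : ℕ → Bool := fun i => decide (i = j)

theorem vtx_single_self (i : ℕ) (a b : K) (Φ : (ℕ → Bool) → K) :
    vtx i a b Φ (single i) = Φ (single i) + b * Φ (single (i + 1)) := by
  have : single i ∘ Equiv.swap i (i + 1) = single (i + 1) := by
    funext k
    simp only [single, Function.comp, Equiv.swap_apply_def]
    split_ifs <;> simp_all
  rw [vtx_apply, this]
  simp [single]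

theorem vtx_single_of_lt {i j : ℕ} (h : j < i) (a b : K) (Φ : (ℕ → Bool) → K) :
    vtx i a b Φ (single j) = a * Φ (single j) := by
  have h1 : ¬ i = j := by omega
  have h2 : ¬ i + 1 = j := by omega
  simp [vtx_apply, single, h1, h2]

/-- The weight of the bulk vertex with parameter `x` whose edges are all directed upwards and
leftwards, or all downwards and rightwards. It is written as a weight of `crossing q i (q ^ 2 * x)`;
see `wA_eq` for the usual form. -/
def wA (q x : K) : K := sigma (q ^ 4 * (q ^ 2 * x)⁻¹) / sigma (q ^ 4)
/-- The weight of the bulk vertex with parameter `x` whose edges are all directed upwards and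
rightwards, or all downwards and leftwards. -/
def wB (q x : K) : K := sigma (q ^ 2 * x) / sigma (q ^ 4)

/-- The product of the weights `wA` along a row with parameter `u`. -/
def prodA (q u : K) (ws : List K) : K := (ws.map fun w => wA q (u * w)).prod
/-- The product of the weights `wB` along a row with parameter `u`. -/
def prodB (q u : K) (ws : List K) : K := (ws.map fun w => wB q (u * w)).prod

theorem chain_allFalse (q u : K) (k : ℕ) (ws : List K) (Φ : (ℕ → Bool) → K) :
    chain q u k ws Φ (fun _ => false) = prodA q u ws * Φ fun _ => false := by
  induction ws generalizing k with
  | nil => simp [chain, prodA]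
  | cons w ws ih =>
    simp only [chain, Module.End.mul_apply, crossing, vtx_allFalse, ih, prodA, List.map_cons,
      List.prod_cons, wA, mul_assoc]

theorem chain_single_of_lt (q u : K) {j k : ℕ} (h : j < k) (ws : List K) (Φ : (ℕ → Bool) → K) :
    chain q u k ws Φ (single j) = prodA q u ws * Φ (single j) := by
  induction ws generalizing k with
  | nil => simp [chain, prodA]
  | cons w ws ih =>
    simp only [chain, Module.End.mul_apply, crossing, vtx_single_of_lt h, ih (Nat.lt_succ_of_lt h),
      prodA, List.map_cons, List.prod_cons, wA, mul_assoc]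

theorem chain_cons_single (q u : K) (k : ℕ) (w : K) (ws : List K) (Φ : (ℕ → Bool) → K) :
    chain q u k (w :: ws) Φ (single k) =
      prodA q u ws * Φ (single k) + wB q (u * w) * chain q u (k + 1) ws Φ (single (k + 1)) := by
  simp only [chain, Module.End.mul_apply, crossing, vtx_single_self,
    chain_single_of_lt q u (Nat.lt_succ_self k), wB]

/-- If `Φ` vanishes on the states in which the single `true` has stopped before the end of the row,
only the configuration in which it runs along the whole row contributes. -/
theorem chain_single_of_eq_zero (q u : K) (k : ℕ) (ws : List K) (Φ : (ℕ → Bool) → K)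
    (h : ∀ j < k + ws.length, Φ (single j) = 0) :
    chain q u k ws Φ (single k) = prodB q u ws * Φ (single (k + ws.length)) := by
  induction ws generalizing k with
  | nil => simp [chain, prodB]
  | cons w ws ih =>
    rw [List.length_cons] at h
    rw [chain_cons_single, h k (by omega), ih (k + 1) fun j hj => h j (by omega), List.length_cons,
      show k + 1 + ws.length = k + (ws.length + 1) by omega]
    simp only [prodB, List.map_cons, List.prod_cons]
    ring

theorem leftRefl_allFalse (l : K) (Φ : (ℕ → Bool) → K) :
    leftRefl l Φ (fun _ => false) = Φ (fun _ => false) + l * Φ (single 0) := by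
  have : Function.update (fun _ => false) 0 true = single 0 := by
    funext k
    by_cases h : k = 0 <;> simp [single, h]
  rw [leftRefl_apply, Bool.not_false, this]

theorem leftRefl_single_zero (l : K) (Φ : (ℕ → Bool) → K) :
    leftRefl l Φ (single 0) = Φ (single 0) + l * Φ (fun _ => false) := by
  have : Function.update (single 0) 0 false = fun _ => false := by
    funext k
    by_cases h : k = 0 <;> simp [single, h]
  rw [leftRefl_apply, show (!single 0 0) = false by simp [single], this]

theorem rightRefl_allFalse (m : ℕ) (r : K) (Φ : (ℕ → Bool) → K) :
    rightRefl m r Φ (fun _ => false) = r * Φ (fun _ => false) := by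
  simp [rightRefl_apply]

theorem rightRefl_single_self (m : ℕ) (r : K) (Φ : (ℕ → Bool) → K) :
    rightRefl m r Φ (single m) = Φ (single m) := by
  simp [rightRefl_apply, single]

theorem rightRefl_single_of_lt {m j : ℕ} (h : j < m) (r : K) (Φ : (ℕ → Bool) → K) :
    rightRefl m r Φ (single j) = r * Φ (single j) := by
  have h1 : ¬ m = j := by omega
  have h2 : ¬ m + 1 = j := by omega
  simp [rightRefl_apply, single, h1, h2]

theorem row_allFalse (q u : K) (ws : List K) (Φ : (ℕ → Bool) → K) :
    row q u ws Φ (fun _ => false) =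
      prodA q u ws * (sigma (q * u⁻¹) / sigma q) * Φ (fun _ => false) +
      sigma (q * u) / sigma q *
        chain q u 0 ws (rightRefl ws.length (sigma (q * u⁻¹) / sigma q) Φ) (single 0) := by
  simp only [row, Module.End.mul_apply, leftRefl_allFalse, chain_allFalse, rightRefl_allFalse,
    mul_assoc]

omit [Field K] in
theorem length_columns (c : K) (us : List K) :
    (us ++ c :: us.reverse).length = 2 * us.length + 1 := by
  simp only [List.length_append, List.length_cons, List.length_reverse]; omega

omit [Field K] in
theorem DependsBelow.single_eq {N : ℕ} {Φ : (ℕ → Bool) → K} (h : DependsBelow N Φ) {j : ℕ}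
    (hj : N ≤ j) : Φ (single j) = Φ fun _ => false := by
  refine h _ _ fun i hi => ?_
  simp only [single, decide_eq_false_iff_not]
  omega

/-! ### Frozen rows and recursions -/

/-- At `u₁ = q` the right boundary vertex of the first row cannot have weight `σ(q * u₁⁻¹) / σ q =
0`, which freezes the row: all its horizontal edges are directed rightwards. -/
theorem zfun_cons_self {q : K} (hq : q ≠ 0) (c : K) (us : List K) :
    zfun q c (q :: us) =
      sigma (q ^ 2) / sigma q * prodB q q (us ++ c :: us.reverse) * zfun q c us := by
  have h0 : sigma (q * q⁻¹) / sigma q = 0 := by rw [mul_inv_cancel₀ hq]; simp [sigma]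
  rw [zfun, tri, row_allFalse, h0, chain_single_of_eq_zero, zero_add, rightRefl_single_self,
    (dependsBelow_tri q c us).single_eq (length_columns c us).ge, zfun]
  · ring_nf
  · intro j hj
    rw [rightRefl_single_of_lt (by simpa using hj), zero_mul]

/-- At `u₁ = q⁻¹` the left boundary vertex of the first row freezes the row: all its horizontal
edges are directed leftwards. -/
theorem zfun_cons_inv {q : K} (hq : q ≠ 0) (c : K) (us : List K) :
    zfun q c (q⁻¹ :: us) =
      sigma (q ^ 2) / sigma q * prodA q q⁻¹ (us ++ c :: us.reverse) * zfun q c us := by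
  have h0 : sigma (q * q⁻¹) / sigma q = 0 := by rw [mul_inv_cancel₀ hq]; simp [sigma]
  rw [zfun, tri, row_allFalse, h0, inv_inv, zfun]
  ring_nf

theorem sigma_inv (x : K) : sigma x⁻¹ = -sigma x := by
  simp [sigma]

/-- For `x * w = q ^ (-2)` the weight `wB` vanishes at the first crossing of the first two lines,
and the two rows are frozen up to the orientation of the edges near the left corner, whose two
possibilities give the factor `1 - (σ(q * x) / σ q) ^ 2`. -/
theorem zfun_cons_cons_inv {q x w : K} (hq4 : sigma (q ^ 4) ≠ 0)
    (hx : x * w = (q ^ 2)⁻¹) (c : K) (us : List K) :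
    zfun q c (x :: w :: us) =
      (sigma (q * x⁻¹) / sigma q) * (sigma (q * w⁻¹) / sigma q) *
        (1 - (sigma (q * x) / sigma q) ^ 2) *
        prodA q x (us ++ c :: us.reverse) * prodA q w (us ++ c :: us.reverse) * zfun q c us := by
  have hq : q ≠ 0 := by rintro rfl; simp [sigma] at hq4
  have hA : wA q (x * w) = 1 := by
    rw [wA, hx, mul_inv_cancel₀ (by positivity), inv_one, mul_one, div_self hq4]
  have hB : wB q (x * w) = 0 := by
    rw [wB, hx, mul_inv_cancel₀ (by positivity)]; simp [sigma]
  have hl : sigma (q * w) / sigma q = -(sigma (q * x) / sigma q) := by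
    have hx0 : x ≠ 0 := by
      rintro rfl
      rw [zero_mul, eq_comm, inv_eq_zero] at hx
      exact pow_ne_zero 2 hq hx
    have : q * w = (q * x)⁻¹ := by
      refine eq_inv_of_mul_eq_one_left ?_
      calc q * w * (q * x) = q ^ 2 * (x * w) := by ring
        _ = 1 := by rw [hx, mul_inv_cancel₀ (by positivity)]
    rw [this, sigma_inv, neg_div]
  have hp : prodA q x (w :: us ++ c :: (w :: us).reverse) = prodA q x (us ++ c :: us.reverse) := by
    simp [prodA, hA]
  have hp' : prodA q x (us ++ c :: (w :: us).reverse) = prodA q x (us ++ c :: us.reverse) := by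
    simp [prodA, hA]
  rw [zfun, tri, row_allFalse, hp, List.cons_append, chain_cons_single, hB, hp',
    rightRefl_single_of_lt (by simp), tri, row]
  simp only [Module.End.mul_apply, leftRefl_allFalse, chain_allFalse, rightRefl_allFalse,
    leftRefl_single_zero, hl]
  rw [zfun]
  ring

/-- The operator that fixes the entry at position `p` to be `true`. -/
def setTrue (p : ℕ) : Module.End K ((ℕ → Bool) → K) where
  toFun Φ s := Φ (Function.update s p true)
  map_add' _ _ := rfl
  map_smul' _ _ := rfl

theorem setTrue_apply (p : ℕ) (Φ : (ℕ → Bool) → K) (s : ℕ → Bool) :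
    setTrue p Φ s = Φ (Function.update s p true) := rfl

theorem vtx_commute_setTrue {i p : ℕ} (h : i + 2 ≤ p) (a b : K) :
    Commute (vtx i a b) (setTrue p) := by
  refine LinearMap.ext fun Φ => funext fun s => ?_
  have hu : Function.update s p true ∘ Equiv.swap i (i + 1) =
      Function.update (s ∘ Equiv.swap i (i + 1)) p true := by
    funext k
    by_cases hk : k = p
    · subst hk
      simp [Function.comp, Equiv.swap_apply_of_ne_of_ne (show k ≠ i by omega)
        (show k ≠ i + 1 by omega)]
    · have h0 : Equiv.swap i (i + 1) k ≠ p := by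
        rw [Equiv.swap_apply_def]
        split_ifs <;> omega
      rw [Function.update_of_ne hk, Function.comp, Function.update_of_ne h0, Function.comp]
  simp only [Module.End.mul_apply, vtx_apply, setTrue_apply, hu]
  rw [Function.update_of_ne (by omega), Function.update_of_ne (by omega)]

theorem leftRefl_commute_setTrue {p : ℕ} (h : 1 ≤ p) (l : K) :
    Commute (leftRefl l) (setTrue p) := by
  refine LinearMap.ext fun Φ => funext fun s => ?_
  simp only [Module.End.mul_apply, leftRefl_apply, setTrue_apply]
  rw [Function.update_of_ne (show 0 ≠ p by omega), Function.update_comm (by omega)]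

/-- For `x * w = q ^ 2` the weight `wA` vanishes at both crossings of the first two lines, and the
two rows are frozen up to the orientation of the edges near the right corner. The combination `Φ + ρ
• setTrue (m + 1) Φ` collects the two possibilities; its value before the second row is added
vanishes on all states but one. -/
theorem zfun_cons_cons {q x w : K} (hq4 : sigma (q ^ 4) ≠ 0)
    (hx : x * w = q ^ 2) (c : K) (us : List K) :
    zfun q c (x :: w :: us) =
      (sigma (q * x) / sigma q) * (sigma (q * w) / sigma q) *
        (1 - (sigma (q * x⁻¹) / sigma q) ^ 2) *
        prodB q x (us ++ c :: us.reverse) * prodB q w (us ++ c :: us.reverse) * zfun q c us := by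
  have hq : q ≠ 0 := by rintro rfl; simp [sigma] at hq4
  have hA : wA q (x * w) = 0 := by
    rw [wA, hx, ← pow_add, mul_inv_cancel₀ (by positivity)]; simp [sigma]
  have hB : wB q (x * w) = 1 := by
    rw [wB, hx, ← pow_add, div_self hq4]
  have hr : sigma (q * w⁻¹) / sigma q = -(sigma (q * x⁻¹) / sigma q) := by
    have hx0 : x ≠ 0 := by
      rintro rfl
      rw [zero_mul, eq_comm] at hx
      exact pow_ne_zero 2 hq hx
    have hw0 : w ≠ 0 := by
      rintro rfl
      rw [mul_zero, eq_comm] at hx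
      exact pow_ne_zero 2 hq hx
    have : q * w⁻¹ = (q * x⁻¹)⁻¹ := by
      field_simp
      rw [← hx]; ring
    rw [this, sigma_inv, neg_div]
  set ws := us ++ c :: us.reverse with hws
  set m := ws.length with hm
  have hcol : w :: us ++ c :: (w :: us).reverse = w :: (ws ++ [w]) := by simp [hws]
  have hcol' : w :: (ws ++ [w]) = (w :: ws) ++ [w] := by simp
  set ρ := sigma (q * x⁻¹) / sigma q with hρ
  set Θ := tri q c us with hΘ
  have hΘd : DependsBelow m Θ := by
    rw [hm, hws, length_columns]; exact dependsBelow_tri q c us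
  set Φ := row q w ws Θ with hΦ
  have hΦd : DependsBelow (m + 2) Φ := hΘd.row q w ws
  have hlen : (w :: (ws ++ [w])).length = m + 2 := by simp [hm]
  -- the first row is frozen, except possibly at its last crossing
  have h1 : zfun q c (x :: w :: us) = sigma (q * x) / sigma q * prodB q x ws *
      (Φ (fun _ => false) + ρ * Φ (single (m + 1))) := by
    rw [zfun, tri, row_allFalse, hcol, hlen]
    have : prodA q x (w :: (ws ++ [w])) = 0 := by simp [prodA, hA]
    rw [this, hcol', chain_append, Module.End.mul_apply, chain_single_of_eq_zero]
    · simp only [List.length_cons, ← hm, zero_add, chain, mul_one, crossing, vtx_single_self]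
      rw [show sigma (q ^ 2 * (x * w)) / sigma (q ^ 4) = 1 from hB, rightRefl_single_of_lt (by omega),
        rightRefl_single_self, tri, ← hws, ← hΘ, ← hΦ, hΦd.single_eq (j := m + 2) le_rfl]
      simp only [prodB, List.map_cons, List.prod_cons, hB]
      ring
    · intro j hj
      simp only [List.length_cons, ← hm, zero_add, chain, mul_one, crossing] at hj ⊢
      rw [vtx_single_of_lt hj]
      change wA q (x * w) * _ = 0
      rw [hA, zero_mul]
  -- the two possibilities combine so that the second row is frozen
  have h2 : Φ (fun _ => false) + ρ * Φ (single (m + 1)) =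
      sigma (q * w) / sigma q * prodB q w ws * (1 - ρ ^ 2) * Θ (fun _ => false) := by
    have hs : Function.update (fun _ => false) (m + 1) true = single (m + 1) := by
      funext k
      by_cases h : k = m + 1 <;> simp [single, h]
    set Ψ := rightRefl m (sigma (q * w⁻¹) / sigma q) Θ with hΨ
    have c1 := leftRefl_commute_setTrue (K := K) (show 1 ≤ m + 1 by omega) (sigma (q * w) / sigma q)
    have c2 : Commute (chain q w 0 ws) (setTrue (m + 1)) :=
      chain_commute_of_lt (m := m) (fun j hj a b => vtx_commute_setTrue (by omega) a b) q w ws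
        (by omega)
    have h3 : Φ + ρ • setTrue (m + 1) Φ =
        (leftRefl (sigma (q * w) / sigma q) * chain q w 0 ws) (Ψ + ρ • setTrue (m + 1) Ψ) := by
      rw [map_add, map_smul, ← Module.End.mul_apply _ (setTrue (m + 1)), (c1.mul_left c2).eq]
      rfl
    have h4 := congrFun h3 fun _ => false
    simp only [Pi.add_apply, Pi.smul_apply, setTrue_apply, hs, smul_eq_mul] at h4
    have hsingle : ∀ j, j < m → (Ψ + ρ • setTrue (m + 1) Ψ) (single j) = 0 := by
      intro j hj
      have e1 : Θ (Function.update (single j) (m + 1) true) = Θ (single j) :=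
        hΘd _ _ fun i hi => Function.update_of_ne (by omega) _ _
      have e2 : single j m = false := by simp [single]; omega
      have e3 : single j (m + 1) = false := by simp [single]; omega
      simp only [Pi.add_apply, Pi.smul_apply, setTrue_apply, smul_eq_mul, hΨ, rightRefl_apply, hr,
        Function.update_self, Function.update_of_ne (show m ≠ m + 1 by omega), e1, e2, e3]
      simp
    have hfalse : (Ψ + ρ • setTrue (m + 1) Ψ) (fun _ => false) = 0 := by
      have e1 : Θ (Function.update (fun _ => false) (m + 1) true) = Θ (fun _ => false) :=
        hΘd _ _ fun i hi => Function.update_of_ne (by omega) _ _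
      simp only [Pi.add_apply, Pi.smul_apply, setTrue_apply, smul_eq_mul, hΨ, rightRefl_apply, hr,
        Function.update_self, Function.update_of_ne (show m ≠ m + 1 by omega), e1]
      simp
    have hself : (Ψ + ρ • setTrue (m + 1) Ψ) (single m) = (1 - ρ ^ 2) * Θ (fun _ => false) := by
      have e1 : Θ (Function.update (single m) (m + 1) true) = Θ (single m) :=
        hΘd _ _ fun i hi => Function.update_of_ne (by omega) _ _
      have e2 : single m m = true := by simp [single]
      have e3 : single m (m + 1) = false := by simp [single]
      simp only [Pi.add_apply, Pi.smul_apply, setTrue_apply, smul_eq_mul, hΨ, rightRefl_apply, hr,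
        Function.update_self, Function.update_of_ne (show m ≠ m + 1 by omega), e1, e2, e3,
        hΘd.single_eq le_rfl]
      simp
      ring
    rw [h4, Module.End.mul_apply, leftRefl_allFalse, chain_allFalse, hfalse,
      chain_single_of_eq_zero _ _ _ _ _ (by simpa [← hm] using hsingle), ← hm, zero_add, hself]
    ring
  rw [h1, h2, zfun]
  ring

/-- For middle parameter `1`, already the smallest triangle, with the single row parameter `q ^ 2`,
has partition function `0` for all top edges: its right boundary weight is `-1` and its bulk vertex
exchanges the two incoming edges with weight `1`, so the contributions cancel. -/
theorem tri_append_eq_zero {q : K} (hq4 : sigma (q ^ 4) ≠ 0) (us : List K) :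
    tri q 1 (us ++ [q ^ 2]) = 0 := by
  have hq : q ≠ 0 := by rintro rfl; simp [sigma] at hq4
  have hq1 := sigma_ne_zero_of_pow_four hq4
  induction us with
  | nil =>
    have h1 : sigma (q * (q ^ 2)⁻¹) / sigma q = -1 := by
      rw [show q * (q ^ 2)⁻¹ = q⁻¹ by field_simp, sigma_inv, neg_div, div_self hq1]
    have h0 : vtx 0 (sigma (q ^ 4 * (q ^ 2 * q ^ 2)⁻¹) / sigma (q ^ 4))
        (sigma (q ^ 2 * q ^ 2) / sigma (q ^ 4)) (rightRefl 1 (-1) fun _ => (1 : K)) = 0 := by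
      have ha : sigma (q ^ 4 * (q ^ 2 * q ^ 2)⁻¹) / sigma (q ^ 4) = 0 := by
        rw [← pow_add, mul_inv_cancel₀ (by positivity)]; simp [sigma]
      have hb : sigma (q ^ 2 * q ^ 2) / sigma (q ^ 4) = 1 := by
        rw [← pow_add, div_self hq4]
      rw [ha, hb]
      funext s
      simp only [vtx_apply, rightRefl_apply, Function.comp, Equiv.swap_apply_right,
        Equiv.swap_apply_of_ne_of_ne (show 1 + 1 ≠ 0 by omega) (show 1 + 1 ≠ 0 + 1 by omega)]
      simp only [zero_add]
      cases s 0 <;> cases s 1 <;> cases s (1 + 1) <;> simp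
    simp only [List.nil_append, tri, row, List.reverse_nil, List.length_singleton, chain, h1,
      mul_one, Module.End.mul_apply, crossing, h0, map_zero]
  | cons u us ih =>
    rw [List.cons_append, tri, ih, map_zero]

/-! ### Degree in the first parameter -/

open Polynomial in
/-- `x ^ d * f x` is a polynomial in `x ^ 2` of degree at most `d`; that is, `f` is a Laurent
polynomial with exponents between `-d` and `d` that have the parity of `d`. -/
def EvenLaurent (d : ℕ) (f : K → K) : Prop :=
  ∃ P : K[X], P.natDegree ≤ d ∧ ∀ x, x ≠ 0 → x ^ d * f x = P.eval (x ^ 2)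

section EvenLaurent
open Polynomial

theorem EvenLaurent.const (k : K) : EvenLaurent 0 fun _ => k :=
  ⟨C k, by simp, by simp⟩

theorem EvenLaurent.mul {d e : ℕ} {f g : K → K} (hf : EvenLaurent d f) (hg : EvenLaurent e g) :
    EvenLaurent (d + e) fun x => f x * g x := by
  obtain ⟨P, hP, hP'⟩ := hf
  obtain ⟨Q, hQ, hQ'⟩ := hg
  refine ⟨P * Q, natDegree_mul_le.trans (by omega), fun x hx => ?_⟩
  rw [eval_mul, ← hP' x hx, ← hQ' x hx]
  ring

theorem EvenLaurent.add {d : ℕ} {f g : K → K} (hf : EvenLaurent d f) (hg : EvenLaurent d g) :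
    EvenLaurent d fun x => f x + g x := by
  obtain ⟨P, hP, hP'⟩ := hf
  obtain ⟨Q, hQ, hQ'⟩ := hg
  refine ⟨P + Q, natDegree_add_le_of_degree_le hP hQ, fun x hx => ?_⟩
  rw [eval_add, ← hP' x hx, ← hQ' x hx]
  ring

theorem EvenLaurent.linear (a b : K) : EvenLaurent 1 fun x => a * x + b * x⁻¹ :=
  ⟨C a * X + C b, natDegree_linear_le, fun x hx => by simp; field_simp⟩

theorem EvenLaurent.sigma_div (a s : K) :
    EvenLaurent 1 fun x => sigma (a * x) / s := by
  convert EvenLaurent.linear (a / s) (-(a⁻¹ / s)) using 2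
  simp only [sigma, mul_inv]; ring

theorem EvenLaurent.sigma_inv_div (a s : K) :
    EvenLaurent 1 fun x => sigma (a * x⁻¹) / s := by
  convert EvenLaurent.linear (-(a⁻¹ / s)) (a / s) using 2
  simp only [sigma, mul_inv, inv_inv]; ring

theorem EvenLaurent.wA (q w : K) : EvenLaurent 1 fun x => wA q (x * w) := by
  convert EvenLaurent.sigma_inv_div (q ^ 4 * (q ^ 2 * w)⁻¹) (sigma (q ^ 4)) using 2
  simp only [DASASM.wA, mul_inv]
  congr 2; ring

theorem EvenLaurent.wB (q w : K) : EvenLaurent 1 fun x => wB q (x * w) := by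
  convert EvenLaurent.sigma_div (q ^ 2 * w) (sigma (q ^ 4)) using 2
  simp only [DASASM.wB]
  congr 2; ring

theorem EvenLaurent.prodA (q : K) (ws : List K) :
    EvenLaurent ws.length fun x => prodA q x ws := by
  induction ws with
  | nil => simpa [DASASM.prodA] using EvenLaurent.const (1 : K)
  | cons w ws ih =>
    simp only [DASASM.prodA, List.map_cons, List.prod_cons, List.length_cons] at ih ⊢
    rw [add_comm]
    exact (EvenLaurent.wA q w).mul ih

theorem evenLaurent_chain (q : K) (k : ℕ) (ws : List K) (Φ : (ℕ → Bool) → K) :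
    EvenLaurent ws.length fun x => chain q x k ws
      (rightRefl (k + ws.length) (sigma (q * x⁻¹) / sigma q) Φ) (single k) := by
  induction ws generalizing k with
  | nil => simpa [chain, rightRefl_single_self] using EvenLaurent.const (Φ (single k))
  | cons w ws ih =>
    have h1 := ((EvenLaurent.prodA q ws).mul (EvenLaurent.sigma_inv_div q (sigma q))).mul
      (EvenLaurent.const (Φ (single k)))
    have h2 := (EvenLaurent.wB q w).mul (ih (k + 1))
    rw [add_comm 1] at h2
    simp only [chain_cons_single, List.length_cons]
    convert h1.add h2 using 2 with x
    rw [rightRefl_single_of_lt (by omega), show k + 1 + ws.length = k + (ws.length + 1) by omega]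
    ring

theorem evenLaurent_zfun (q c : K) (us : List K) :
    EvenLaurent (2 * us.length + 2) fun x => zfun q c (x :: us) := by
  have h1 := ((EvenLaurent.prodA q (us ++ c :: us.reverse)).mul
    (EvenLaurent.sigma_inv_div q (sigma q))).mul (EvenLaurent.const (tri q c us fun _ => false))
  have h2 := (EvenLaurent.sigma_div q (sigma q)).mul
    (evenLaurent_chain q 0 (us ++ c :: us.reverse) (tri q c us))
  rw [add_comm 1] at h2
  have h := h1.add h2
  rw [length_columns] at h
  simpa only [zfun, tri, row_allFalse, zero_add, length_columns] using h

end EvenLaurent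

/-! ### Summation over orientations, row by row -/

/-- The sum of `F` over the orientations whose upward vertical edges are those in `T` and an
arbitrary part of `EV`, and whose rightward horizontal edges are an arbitrary part of `EH`. -/
def esum (T EV EH : Finset (ℕ × ℕ)) (F : Orientation → K) : K :=
  ∑ V ∈ EV.powerset, ∑ H ∈ EH.powerset, F (V ∪ T, H)

theorem esum_insert_right {T EV EH : Finset (ℕ × ℕ)} {f : ℕ × ℕ} (hf : f ∉ EH)
    (F : Orientation → K) :
    esum T EV (insert f EH) F = esum T EV EH fun C => F C + F (C.1, insert f C.2) := by
  simp only [esum, Finset.sum_powerset_insert hf, Finset.sum_add_distrib]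

theorem esum_insert_left {T EV EH : Finset (ℕ × ℕ)} {e : ℕ × ℕ} (he : e ∉ EV)
    (F : Orientation → K) :
    esum T (insert e EV) EH F = esum T EV EH fun C => F C + F (insert e C.1, C.2) := by
  simp only [esum, Finset.sum_powerset_insert he, Finset.sum_add_distrib, Finset.insert_union]

theorem esum_congr {T EV EH : Finset (ℕ × ℕ)} {F G : Orientation → K}
    (h : ∀ C : Orientation, C.1 ⊆ EV ∪ T → C.2 ⊆ EH → F C = G C) :
    esum T EV EH F = esum T EV EH G :=
  Finset.sum_congr rfl fun _ hV => Finset.sum_congr rfl fun _ hH =>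
    h _ (Finset.union_subset_union_left (Finset.mem_powerset.1 hV)) (Finset.mem_powerset.1 hH)

/-- The state of the cut edges after the left boundary vertex and the first `k` bulk vertices of row
`i` have been passed: the vertical edges below these vertices, the horizontal edge to the right of
the last of them, and the vertical edges above the remaining vertices of the row. -/
def frontier (i k : ℕ) (C : Orientation) : ℕ → Bool := fun p =>
  if p < k then !decide ((i + 1, i + p + 1) ∈ C.1)
  else if p = k then decide ((i, i + k) ∈ C.2)
  else !decide ((i, i + p) ∈ C.1)

/-- The state of the vertical edges above row `i`. -/
def rowFrontier (i : ℕ) (C : Orientation) : ℕ → Bool := fun p => !decide ((i, i + p) ∈ C.1)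

theorem crossing_apply {q : K} (hq : q ≠ 0) (k : ℕ) (x : K) (Φ : (ℕ → Bool) → K)
    (s : ℕ → Bool) :
    crossing q k (q ^ 2 * x) Φ s = ∑ b : Bool, ∑ h : Bool,
      bulkWeight q x (s k) b (!h) (s (k + 1)) *
        Φ (Function.update (Function.update s k (!b)) (k + 1) h) := by
  have ha : q ^ 4 * (q ^ 2 * x)⁻¹ = q ^ 2 * x⁻¹ := by
    rw [mul_inv]; field_simp
  have h1 : Function.update (Function.update s k (s k)) (k + 1) (s (k + 1)) = s := by simp
  have h2 : Function.update (Function.update s k (s (k + 1))) (k + 1) (s k) =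
      s ∘ Equiv.swap k (k + 1) := by
    funext j
    simp only [Function.update_apply, Function.comp, Equiv.swap_apply_def]
    split_ifs <;> first | rfl | omega
  rw [crossing, vtx_apply, ha]
  generalize hsk : s k = x at *
  generalize hsk' : s (k + 1) = y at *
  cases x <;> cases y <;> simp [bulkWeight, h1, h2]
  ring

theorem leftRefl_eq_sum (q x : K) (Φ : (ℕ → Bool) → K) (s : ℕ → Bool) :
    leftRefl (sigma (q * x) / sigma q) Φ s =
      ∑ h : Bool, leftWeight q x (!h) (s 0) * Φ (Function.update s 0 h) := by
  have h1 : Function.update s 0 (s 0) = s := by simp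
  rw [leftRefl_apply]
  generalize hs : s 0 = x at *
  cases x <;> simp [leftWeight, h1]
  ring

theorem rightRefl_eq (q x : K) (m : ℕ) (Φ : (ℕ → Bool) → K) (s : ℕ → Bool) :
    rightRefl m (sigma (q * x⁻¹) / sigma q) Φ s = rightWeight q x (s m) (s (m + 1)) * Φ s := by
  rw [rightRefl_apply]
  cases s m <;> cases s (m + 1) <;> simp [rightWeight]

/-- The weight of the bulk vertex `(i, j)`. -/
def vertexWeight (n : ℕ) (q : K) (u : ℕ → K) (C : Orientation) (i j : ℕ) : K :=
  bulkWeight q (u i * u (min j (2 * n + 2 - j)))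
    (leftIn C i j) (bottomIn C i j) (rightIn C i j) (topIn C i j)

/-- Summation over the bottom and the right edge of the bulk vertex in column `i + k + 1` turns the
operator `crossing` into the weight of that vertex. `P` stands for the weights of the vertices
passed before. -/
theorem esum_vertex {n i k : ℕ} {q : K} (hq : q ≠ 0) (u : ℕ → K) {T EV EH : Finset (ℕ × ℕ)}
    (he : (i + 1, i + k + 1) ∉ EV ∪ T) (hf : (i, i + k + 1) ∉ EH) (P : Orientation → K)
    (hPe : ∀ C : Orientation, P (insert (i + 1, i + k + 1) C.1, C.2) = P C)
    (hPf : ∀ C : Orientation, P (C.1, insert (i, i + k + 1) C.2) = P C)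
    (Φ : (ℕ → Bool) → K) :
    esum T EV EH (fun C => P C * crossing q k
        (q ^ 2 * (u i * u (min (i + k + 1) (2 * n + 2 - (i + k + 1))))) Φ (frontier i k C)) =
      esum T (insert (i + 1, i + k + 1) EV) (insert (i, i + k + 1) EH) fun C =>
        P C * vertexWeight n q u C i (i + k + 1) * Φ (frontier i (k + 1) C) := by
  rw [esum_insert_left (fun h => he (Finset.mem_union_left _ h)), esum_insert_right hf]
  refine esum_congr fun C hC1 hC2 => ?_
  have he' : (i + 1, i + k + 1) ∉ C.1 := fun h => he (hC1 h)
  have hf' : (i, i + k + 1) ∉ C.2 := fun h => hf (hC2 h)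
  have hPe' := hPe (C.1, insert (i, i + k + 1) C.2)
  simp only at hPe'
  rw [crossing_apply hq]
  simp only [hPe, hPf, hPe', Fintype.sum_bool, vertexWeight, leftIn, bottomIn, rightIn, topIn]
  have s1 : frontier i k C k = decide ((i, i + k + 1 - 1) ∈ C.2) := by simp [frontier]
  have s2 : frontier i k C (k + 1) = decide ((i, i + k + 1) ∉ C.1) := by
    simp [frontier, Nat.add_assoc]
  have key : ∀ C' : Orientation,
      (∀ p, (i + 1, p) ∈ C'.1 ↔ (i + 1, p) ∈ C.1 ∨ (p = i + k + 1 ∧ (i + 1, p) ∈ C'.1)) →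
      (∀ p, (i, p) ∈ C'.1 ↔ (i, p) ∈ C.1) →
      frontier i (k + 1) C' =
      Function.update (Function.update (frontier i k C) k
        (!decide ((i + 1, i + k + 1) ∈ C'.1))) (k + 1) (decide ((i, i + k + 1) ∈ C'.2)) := by
    intro C' h1 h2
    funext p
    rcases lt_trichotomy p (k + 1) with h | rfl | h
    · rw [Function.update_of_ne (by omega)]
      rcases Nat.lt_succ_iff_lt_or_eq.1 h with h' | rfl
      · rw [Function.update_of_ne (by omega)]
        have h4 : ¬ p = k := by omega
        have h5 : (i + 1, i + p + 1) ∈ C'.1 ↔ (i + 1, i + p + 1) ∈ C.1 := by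
          simpa [h4] using h1 (i + p + 1)
        simp [frontier, h, h', h5]
      · simp [frontier]
    · simp [frontier, Nat.add_assoc]
    · rw [Function.update_of_ne (by omega), Function.update_of_ne (by omega)]
      simp [frontier, show ¬ p < k + 1 by omega, show ¬ p = k + 1 by omega,
        show ¬ p < k by omega, show ¬ p = k by omega, h2]
  rw [key C (by simp) (by simp),
    key (C.1, insert (i, i + k + 1) C.2) (by simp) (by simp),
    key (insert (i + 1, i + k + 1) C.1, C.2) (by simp; tauto) (by simp),
    key (insert (i + 1, i + k + 1) C.1, insert (i, i + k + 1) C.2) (by simp; tauto) (by simp),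
    s1, s2]
  simp [he', hf']
  ring

theorem esum_leftRefl {i : ℕ} (q : K) (u : ℕ → K) {T EV EH : Finset (ℕ × ℕ)}
    (hf : (i, i) ∉ EH) (P : Orientation → K)
    (hPf : ∀ C : Orientation, P (C.1, insert (i, i) C.2) = P C) (Φ : (ℕ → Bool) → K) :
    esum T EV EH (fun C => P C * leftRefl (sigma (q * u i) / sigma q) Φ (rowFrontier i C)) =
      esum T EV (insert (i, i) EH) fun C =>
        P C * leftWeight q (u i) (rightIn C i i) (topIn C i i) * Φ (frontier i 0 C) := by
  rw [esum_insert_right hf]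
  refine esum_congr fun C hC1 hC2 => ?_
  have hf' : (i, i) ∉ C.2 := fun h => hf (hC2 h)
  have key : ∀ H, frontier i 0 (C.1, H) =
      Function.update (rowFrontier i C) 0 (decide ((i, i) ∈ H)) := by
    intro H
    funext p
    rcases Nat.eq_zero_or_pos p with rfl | h
    · simp [frontier]
    · rw [Function.update_of_ne (by omega)]
      simp [frontier, rowFrontier, show ¬ p = 0 by omega]
  rw [leftRefl_eq_sum, show frontier i 0 C = frontier i 0 (C.1, C.2) from rfl, key, key, hPf]
  simp [rightIn, topIn, hf', rowFrontier]
  ring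

/-- `EV` together with the vertical edges below the first `k` bulk vertices of row `i`. -/
def addV (i : ℕ) (EV : Finset (ℕ × ℕ)) : ℕ → Finset (ℕ × ℕ)
  | 0 => EV
  | k + 1 => insert (i + 1, i + k + 1) (addV i EV k)

/-- `EH` together with the first `k + 1` horizontal edges of row `i`. -/
def addH (i : ℕ) (EH : Finset (ℕ × ℕ)) : ℕ → Finset (ℕ × ℕ)
  | 0 => insert (i, i) EH
  | k + 1 => insert (i, i + k + 1) (addH i EH k)

theorem mem_addV {i k : ℕ} {EV : Finset (ℕ × ℕ)} {p : ℕ × ℕ} :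
    p ∈ addV i EV k ↔ p ∈ EV ∨ (p.1 = i + 1 ∧ i + 1 ≤ p.2 ∧ p.2 ≤ i + k) := by
  induction k with
  | zero =>
    simp only [addV]
    grind
  | succ k ih =>
    simp only [addV, Finset.mem_insert, ih, Prod.ext_iff]
    grind

theorem mem_addH {i k : ℕ} {EH : Finset (ℕ × ℕ)} {p : ℕ × ℕ} :
    p ∈ addH i EH k ↔ p ∈ EH ∨ (p.1 = i ∧ i ≤ p.2 ∧ p.2 ≤ i + k) := by
  induction k with
  | zero =>
    simp only [addH, Finset.mem_insert, Prod.ext_iff]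
    grind
  | succ k ih =>
    simp only [addH, Finset.mem_insert, ih, Prod.ext_iff]
    grind

/-- The parameters of the first `m` columns met by the bulk of row `i`. -/
def columnParams (n : ℕ) (u : ℕ → K) (i m : ℕ) : List K :=
  (List.range m).map fun k => u (min (i + k + 1) (2 * n + 2 - (i + k + 1)))

theorem leftWeight_insert_left {i : ℕ} {e : ℕ × ℕ} (he : e.1 = i + 1) (q x : K) (C : Orientation) :
    leftWeight q x (rightIn (insert e C.1, C.2) i i) (topIn (insert e C.1, C.2) i i) =
      leftWeight q x (rightIn C i i) (topIn C i i) := by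
  have : ¬ ((i, i) = e) := by rintro rfl; simp at he
  simp [rightIn, topIn, this]

theorem esum_row_prefix {n i : ℕ} {q : K} (hq : q ≠ 0) (u : ℕ → K) {T EV EH : Finset (ℕ × ℕ)}
    (hEV : ∀ p ∈ EV ∪ T, p.1 ≤ i) (hEH : ∀ p ∈ EH, p.1 < i) (P : Orientation → K)
    (hPe : ∀ C : Orientation, ∀ e : ℕ × ℕ, e.1 = i + 1 → P (insert e C.1, C.2) = P C)
    (hPf : ∀ C : Orientation, ∀ f : ℕ × ℕ, f.1 = i → P (C.1, insert f C.2) = P C)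
    (k : ℕ) (Φ : (ℕ → Bool) → K) :
    esum T EV EH (fun C => P C * (leftRefl (sigma (q * u i) / sigma q) *
        chain q (u i) 0 (columnParams n u i k)) Φ (rowFrontier i C)) =
      esum T (addV i EV k) (addH i EH k) fun C =>
        P C * leftWeight q (u i) (rightIn C i i) (topIn C i i) *
          (∏ j ∈ Finset.range k, vertexWeight n q u C i (i + j + 1)) * Φ (frontier i k C) := by
  induction k generalizing Φ with
  | zero =>
    simp only [columnParams, List.range_zero, List.map_nil, chain, mul_one, addV, addH,
      Finset.prod_range_zero]
    exact esum_leftRefl q u (fun h => absurd (hEH _ h) (by simp)) P (fun C => hPf C _ rfl) Φ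
  | succ k ih =>
    have hcp : columnParams n u i (k + 1) = columnParams n u i k ++
        [u (min (i + k + 1) (2 * n + 2 - (i + k + 1)))] := by
      simp [columnParams, List.range_succ]
    have hlen : (columnParams n u i k).length = k := by simp [columnParams]
    rw [hcp]
    simp only [chain_append, hlen, zero_add, chain, mul_one]
    simp only [← mul_assoc (leftRefl _)]
    simp only [Module.End.mul_apply (_ * _)]
    rw [ih, esum_vertex hq u]
    · simp only [addV, addH, Finset.prod_range_succ, mul_assoc]
    · rw [Finset.mem_union, mem_addV]
      rintro ((h | h) | h)
      · exact absurd (hEV _ (Finset.mem_union_left _ h)) (by simp)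
      · omega
      · exact absurd (hEV _ (Finset.mem_union_right _ h)) (by simp)
    · rw [mem_addH]
      rintro (h | h)
      · exact absurd (hEH _ h) (by simp)
      · omega
    · intro C
      rw [hPe C _ rfl, leftWeight_insert_left rfl]
      congr 1
      refine Finset.prod_congr rfl fun j hj => ?_
      rw [Finset.mem_range] at hj
      simp [vertexWeight, leftIn, bottomIn, rightIn, topIn, show ¬ j = k by omega]
    · intro C
      rw [hPf C _ rfl]
      congr 1
      · simp [rightIn, topIn, show ¬ i = i + k + 1 by omega]
      · refine Finset.prod_congr rfl fun j hj => ?_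
        rw [Finset.mem_range] at hj
        simp [vertexWeight, leftIn, bottomIn, rightIn, topIn, show ¬ j = k by omega,
          show ¬ i + j = i + k + 1 by omega]

/-- The product of the weights of all vertices of row `i`. -/
def rowWeight (n : ℕ) (q : K) (u : ℕ → K) (i : ℕ) (C : Orientation) : K :=
  leftWeight q (u i) (rightIn C i i) (topIn C i i) *
    (∏ j ∈ Finset.Icc (i + 1) (2 * n + 1 - i), vertexWeight n q u C i j) *
    rightWeight q (u i) (leftIn C i (2 * n + 2 - i)) (topIn C i (2 * n + 2 - i))

theorem esum_row {n i : ℕ} {q : K} (hq : q ≠ 0) (u : ℕ → K) {T EV EH : Finset (ℕ × ℕ)}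
    (hi : i ≤ n)
    (hEV : ∀ p ∈ EV ∪ T, p.1 ≤ i) (hEH : ∀ p ∈ EH, p.1 < i) (P : Orientation → K)
    (hPe : ∀ C : Orientation, ∀ e : ℕ × ℕ, e.1 = i + 1 → P (insert e C.1, C.2) = P C)
    (hPf : ∀ C : Orientation, ∀ f : ℕ × ℕ, f.1 = i → P (C.1, insert f C.2) = P C)
    {Φ : (ℕ → Bool) → K} (hΦ : DependsBelow (2 * (n - i) + 1) Φ) :
    esum T EV EH (fun C => P C *
        row q (u i) (columnParams n u i (2 * (n - i) + 1)) Φ (rowFrontier i C)) =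
      esum T (addV i EV (2 * (n - i) + 1)) (addH i EH (2 * (n - i) + 1)) fun C =>
        P C * rowWeight n q u i C * Φ (rowFrontier (i + 1) C) := by
  set m := 2 * (n - i) + 1 with hm
  have hlen : (columnParams n u i m).length = m := by simp [columnParams]
  simp only [row, hlen]
  simp only [Module.End.mul_apply (_ * _)]
  rw [esum_row_prefix hq u hEV hEH P hPe hPf]
  refine esum_congr fun C _ _ => ?_
  have h1 : (∏ j ∈ Finset.Icc (i + 1) (2 * n + 1 - i), vertexWeight n q u C i j) =
      ∏ j ∈ Finset.range m, vertexWeight n q u C i (i + j + 1) := by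
    have : Finset.Icc (i + 1) (2 * n + 1 - i) = Finset.Ico (i + 1) (i + 1 + m) := by
      ext j
      simp only [Finset.mem_Icc, Finset.mem_Ico]
      omega
    rw [this, Finset.prod_Ico_eq_prod_range, show i + 1 + m - (i + 1) = m by omega]
    refine Finset.prod_congr rfl fun j _ => ?_
    rw [show i + 1 + j = i + j + 1 by omega]
  have h2 : Φ (frontier i m C) = Φ (rowFrontier (i + 1) C) := by
    refine hΦ _ _ fun p hp => ?_
    simp [frontier, rowFrontier, hp, show i + 1 + p = i + p + 1 by omega]
  have h3 : 2 * n + 2 - i = i + m + 1 := by omega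
  rw [rightRefl_eq, h2, rowWeight, h1, h3]
  simp [frontier, leftIn, topIn, Nat.add_assoc]
  ring

/-- The list `u i, …, u n`. -/
def paramsFrom (n : ℕ) (u : ℕ → K) (i : ℕ) : List K :=
  (List.range (n + 1 - i)).map fun k => u (i + k)

omit [Field K] in
theorem paramsFrom_eq_cons {n i : ℕ} (u : ℕ → K) (hi : i ≤ n) :
    paramsFrom n u i = u i :: paramsFrom n u (i + 1) := by
  simp only [paramsFrom]
  rw [show n + 1 - i = (n + 1 - (i + 1)) + 1 by omega, List.range_succ_eq_map]
  simp only [List.map_cons, List.map_map, add_zero]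
  congr 1
  refine List.map_congr_left fun k _ => ?_
  simp only [Function.comp]
  congr 1
  omega

omit [Field K] in
theorem columns_paramsFrom {n i : ℕ} (u : ℕ → K) (hi : i ≤ n) :
    paramsFrom n u (i + 1) ++ u (n + 1) :: (paramsFrom n u (i + 1)).reverse =
      columnParams n u i (2 * (n - i) + 1) := by
  refine List.ext_getElem ?_ fun k h1 h2 => ?_
  · simp [paramsFrom, columnParams]; omega
  · simp only [paramsFrom, columnParams, List.getElem_append, List.getElem_cons, List.getElem_map,
      List.getElem_range, List.getElem_reverse, List.length_map, List.length_range]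
    simp only [columnParams, List.length_map, List.length_range] at h2
    split_ifs <;> congr 1 <;> omega

/-- The edges at the top vertices. -/
def topEdges (n : ℕ) : Finset (ℕ × ℕ) := {1} ×ˢ Finset.Icc 1 (2 * n + 1)

/-- The vertical edges between the first `j + 1` rows. -/
def vertUpTo (n j : ℕ) : Finset (ℕ × ℕ) := (vertEdges n).filter fun p => 2 ≤ p.1 ∧ p.1 ≤ j + 1

/-- The horizontal edges of the first `j` rows. -/
def horizUpTo (n j : ℕ) : Finset (ℕ × ℕ) := (horizEdges n).filter fun p => p.1 ≤ j

theorem mem_topEdges {n : ℕ} {p : ℕ × ℕ} :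
    p ∈ topEdges n ↔ p.1 = 1 ∧ 1 ≤ p.2 ∧ p.2 ≤ 2 * n + 1 := by
  rw [topEdges, Finset.mem_product, Finset.mem_singleton, Finset.mem_Icc]

theorem mem_vertUpTo {n j : ℕ} {p : ℕ × ℕ} : p ∈ vertUpTo n j ↔
    p.1 ≤ n + 1 ∧ 2 ≤ p.1 ∧ p.1 ≤ j + 1 ∧ p.1 ≤ p.2 ∧ p.1 + p.2 ≤ 2 * n + 2 := by
  simp only [vertUpTo, vertEdges, Finset.mem_filter, Finset.mem_product, Finset.mem_Icc]
  omega

theorem mem_horizUpTo {n j : ℕ} {p : ℕ × ℕ} : p ∈ horizUpTo n j ↔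
    p.1 ≤ n ∧ 1 ≤ p.1 ∧ p.1 ≤ j ∧ p.1 ≤ p.2 ∧ p.1 + p.2 ≤ 2 * n + 1 := by
  simp only [horizUpTo, horizEdges, Finset.mem_filter, Finset.mem_product, Finset.mem_Icc]
  omega

theorem addV_vertUpTo {n j : ℕ} (hj : j < n) :
    addV (j + 1) (vertUpTo n j) (2 * (n - (j + 1)) + 1) = vertUpTo n (j + 1) := by
  ext p
  simp only [mem_addV, mem_vertUpTo]
  omega

theorem addH_horizUpTo {n j : ℕ} (hj : j < n) :
    addH (j + 1) (horizUpTo n j) (2 * (n - (j + 1)) + 1) = horizUpTo n (j + 1) := by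
  ext p
  simp only [mem_addH, mem_horizUpTo]
  omega

theorem rowWeight_insert_left {n r : ℕ} (q : K) (u : ℕ → K) (C : Orientation) {e : ℕ × ℕ}
    (he : r + 1 < e.1) : rowWeight n q u r (insert e C.1, C.2) = rowWeight n q u r C := by
  have h1 : ∀ j, ¬ ((r, j) = e) := by rintro j rfl; simp at he
  have h2 : ∀ j, ¬ ((r + 1, j) = e) := by rintro j rfl; simp at he
  simp [rowWeight, vertexWeight, leftIn, bottomIn, rightIn, topIn, h1, h2]

theorem rowWeight_insert_right {n r : ℕ} (q : K) (u : ℕ → K) (C : Orientation) {f : ℕ × ℕ}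
    (hf : r < f.1) : rowWeight n q u r (C.1, insert f C.2) = rowWeight n q u r C := by
  have h1 : ∀ j, ¬ ((r, j) = f) := by rintro j rfl; simp at hf
  simp [rowWeight, vertexWeight, leftIn, bottomIn, rightIn, topIn, h1]

/-- The first `j` row operators are replaced by a sum over the orientations of the edges in and
directly below the first `j` rows. -/
theorem zfun_eq_esum_rows {n : ℕ} {q : K} (hq : q ≠ 0) (u : ℕ → K) {j : ℕ} (hj : j ≤ n) :
    zfun q (u (n + 1)) (paramsFrom n u 1) =
      esum (topEdges n) (vertUpTo n j) (horizUpTo n j) fun C =>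
        (∏ r ∈ Finset.Icc 1 j, rowWeight n q u r C) *
          tri q (u (n + 1)) (paramsFrom n u (j + 1)) (rowFrontier (j + 1) C) := by
  induction j with
  | zero =>
    have h1 : vertUpTo n 0 = ∅ := by
      ext p
      simp only [mem_vertUpTo, Finset.notMem_empty, iff_false]
      omega
    have h2 : horizUpTo n 0 = ∅ := by
      ext p
      simp only [mem_horizUpTo, Finset.notMem_empty, iff_false]
      omega
    rw [h1, h2]
    simp only [esum, Finset.powerset_empty, Finset.sum_singleton, Finset.empty_union, zero_add,
      Finset.Icc_eq_empty_of_lt zero_lt_one, Finset.prod_empty, one_mul]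
    refine dependsBelow_tri _ _ _ _ _ fun p hp => ?_
    simp only [paramsFrom, List.length_map, List.length_range] at hp
    simp only [rowFrontier, mem_topEdges]
    simp
    omega
  | succ j ih =>
    rw [ih (by omega), paramsFrom_eq_cons u hj]
    simp only [tri, columns_paramsFrom u hj]
    rw [esum_row hq u hj, addV_vertUpTo hj, addH_horizUpTo hj]
    · simp only [Finset.prod_Icc_succ_top (Nat.le_add_left 1 j)]
    · intro p hp
      rw [Finset.mem_union, mem_vertUpTo, mem_topEdges] at hp
      omega
    · intro p hp
      rw [mem_horizUpTo] at hp
      omega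
    · intro C e he
      refine Finset.prod_congr rfl fun r hr => rowWeight_insert_left q u C ?_
      rw [Finset.mem_Icc] at hr
      omega
    · intro C f hf
      refine Finset.prod_congr rfl fun r hr => rowWeight_insert_right q u C ?_
      rw [Finset.mem_Icc] at hr
      omega
    · refine (dependsBelow_tri _ _ _).mono ?_
      simp only [paramsFrom, List.length_map, List.length_range]
      omega

theorem bulkWeight_eq_zero (q x : K) (l b r t : Bool)
    (h : l.toNat + b.toNat + r.toNat + t.toNat ≠ 2) : bulkWeight q x l b r t = 0 := by
  revert h
  cases l <;> cases b <;> cases r <;> cases t <;> simp [bulkWeight]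

/-- The six-vertex rule may be dropped, because bulk vertices that violate it have weight `0`. -/
theorem sum_configurations {n : ℕ} (q : K) (u : ℕ → K) :
    ∑ C ∈ configurations n, ∏ r ∈ Finset.Icc 1 n, rowWeight n q u r C =
      esum (topEdges n) (vertUpTo n n) (horizUpTo n n) fun C =>
        ∏ r ∈ Finset.Icc 1 n, rowWeight n q u r C := by
  have h1 : configurations n ⊆
      ((vertEdges n).powerset ×ˢ (horizEdges n).powerset).filter (TopUp n) :=
    fun C hC => by
      simp only [configurations, Finset.mem_filter] at hC ⊢
      exact ⟨hC.1, hC.2.1⟩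
  rw [Finset.sum_subset h1]
  · have hh : horizUpTo n n = horizEdges n := by
      ext p
      simp only [horizUpTo, horizEdges, Finset.mem_filter, Finset.mem_product, Finset.mem_Icc]
      omega
    rw [esum, ← Finset.sum_product', hh]
    refine Finset.sum_nbij' (fun C => (C.1 \ topEdges n, C.2)) (fun C => (C.1 ∪ topEdges n, C.2))
      ?_ ?_ ?_ ?_ ?_
    · intro C hC
      simp only [Finset.mem_filter, Finset.mem_product, Finset.mem_powerset] at hC ⊢
      refine ⟨fun p hp => ?_, hC.1.2⟩
      rw [Finset.mem_sdiff, mem_topEdges] at hp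
      have := hC.1.1 hp.1
      simp only [vertEdges, Finset.mem_filter, Finset.mem_product, Finset.mem_Icc] at this
      rw [mem_vertUpTo]
      omega
    · intro C hC
      simp only [Finset.mem_filter, Finset.mem_product, Finset.mem_powerset] at hC ⊢
      refine ⟨⟨fun p hp => ?_, hC.2⟩, fun j hj => ?_⟩
      · simp only [vertEdges, Finset.mem_filter, Finset.mem_product, Finset.mem_Icc]
        rcases Finset.mem_union.1 hp with hp | hp
        · have := hC.1 hp
          rw [mem_vertUpTo] at this
          omega
        · rw [mem_topEdges] at hp
          omega
      · rw [Finset.mem_Icc] at hj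
        exact Finset.mem_union_right _ (mem_topEdges.2 ⟨rfl, hj⟩)
    · intro C hC
      simp only [Finset.mem_filter] at hC
      refine Prod.ext (Finset.sdiff_union_of_subset fun p hp => ?_) rfl
      rw [mem_topEdges] at hp
      have := hC.2 p.2 (Finset.mem_Icc.2 hp.2)
      rwa [show ((1, p.2) : ℕ × ℕ) = p from Prod.ext hp.1.symm rfl] at this
    · intro C hC
      simp only [Finset.mem_product, Finset.mem_powerset] at hC
      refine Prod.ext (Finset.union_sdiff_cancel_right ?_) rfl
      rw [Finset.disjoint_left]
      intro p hp hp'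
      have := hC.1 hp
      rw [mem_vertUpTo] at this
      rw [mem_topEdges] at hp'
      omega
    · intro C hC
      simp only [Finset.mem_filter] at hC
      congr 1
      funext r
      rw [Finset.sdiff_union_of_subset]
      intro p hp
      rw [mem_topEdges] at hp
      have := hC.2 p.2 (Finset.mem_Icc.2 hp.2)
      rwa [show ((1, p.2) : ℕ × ℕ) = p from Prod.ext hp.1.symm rfl] at this
  · intro C hC hC'
    have : ¬ SixVertexRule n C := fun h => by
      refine hC' ?_
      simp only [configurations, Finset.mem_filter] at hC ⊢
      exact ⟨hC.1, hC.2, h⟩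
    simp only [SixVertexRule, not_forall] at this
    obtain ⟨i, hi, j, hj, h⟩ := this
    refine Finset.prod_eq_zero hi ?_
    rw [rowWeight, Finset.prod_eq_zero hj (bulkWeight_eq_zero _ _ _ _ _ _ h)]
    simp

theorem partitionFunction_eq_zfun {q : K} (hq : q ≠ 0) (n : ℕ) (u : ℕ → K) :
    partitionFunction n q u = zfun q (u (n + 1)) (paramsFrom n u 1) := by
  rw [zfun_eq_esum_rows hq u le_rfl]
  have : paramsFrom n u (n + 1) = [] := by simp [paramsFrom]
  simp only [this, tri, mul_one]
  rw [← sum_configurations]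
  rfl

/-! ### The bordered determinant -/

open Polynomial

/-- Expansion of a determinant along its first row and its first column. -/
theorem det_eq_sub_sum_adjugate {R : Type*} [CommRing R] {m : ℕ}
    (A : Matrix (Fin (m + 1)) (Fin (m + 1)) R) :
    A.det = A 0 0 * (A.submatrix Fin.succ Fin.succ).det -
      ∑ j, ∑ k, A 0 (Fin.succ j) * (A.submatrix Fin.succ Fin.succ).adjugate j k *
        A (Fin.succ k) 0 := by
  rw [Matrix.det_succ_row_zero, Fin.sum_univ_succ, sub_eq_add_neg, ← Finset.sum_neg_distrib]
  congr 1
  · simp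
  · refine Finset.sum_congr rfl fun j _ => ?_
    cases m with
    | zero => exact j.elim0
    | succ m =>
      rw [Matrix.det_succ_column_zero, Finset.mul_sum, ← Finset.sum_neg_distrib]
      refine Finset.sum_congr rfl fun k _ => ?_
      rw [Matrix.adjugate_fin_succ_eq_det_submatrix]
      have : ((A.submatrix Fin.succ (Fin.succ j).succAbove).submatrix k.succAbove Fin.succ) =
          (A.submatrix Fin.succ Fin.succ).submatrix k.succAbove j.succAbove := by
        ext x y
        simp
      rw [this]
      simp only [Matrix.submatrix_apply, Fin.succ_succAbove_zero, Fin.val_succ]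
      ring

/-- The matrix entry of the determinant in terms of `p = q ^ 2`, `a = u_i ^ 2` and `b = u_j ^ 2`;
see `entry_sq`. -/
def entry (p a b : K) : K :=
  (p + p⁻¹ + a + b⁻¹) * (p ^ 2 * a * b) / ((p ^ 2 - a * b) * (p ^ 2 * a * b - 1))

/-- The matrix of the determinant in terms of `p = q ^ 2` and `a i = u_i ^ 2`. -/
def entryMatrix {m : ℕ} (p : K) (a : Fin m → K) : Matrix (Fin m) (Fin m) K :=
  Matrix.of fun i j => entry p (a i) (a j)

/-- The polynomial in `a` that is proportional to the denominator of `entry p a b`; up to monomials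
it is `σ(q ^ 2 * u * w) * σ(q ^ 2 * u⁻¹ * w⁻¹)` in `a = u ^ 2`, for `b = w ^ 2`. -/
noncomputable def ghat (p b : K) : K[X] := (C (p ^ 2) - C b * X) * (C (p ^ 2 * b) * X - 1)

/-- The denominator of the diagonal entry `entry p a a` after cancellation, as a polynomial in `a`.
-/
noncomputable def bhat (p : K) : K[X] := (C p - X) * (C p * X - 1)

/-- The entries of the new row of a matrix enlarged by the parameter `X`, divided by `X` and cleared
of denominators. -/
noncomputable def rowPoly {m : ℕ} (p : K) (a : Fin m → K) (j : Fin m) : K[X] :=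
  C (p ^ 2 * a j) * (X + C (p + p⁻¹ + (a j)⁻¹)) * ∏ l ∈ Finset.univ.erase j, ghat p (a l)

/-- The entries of the new column of a matrix enlarged by the parameter `X`, cleared of
denominators. -/
noncomputable def colPoly {m : ℕ} (p : K) (a : Fin m → K) (j : Fin m) : K[X] :=
  C (p ^ 2 * a j) * (C (p + p⁻¹ + a j) * X + 1) * ∏ l ∈ Finset.univ.erase j, ghat p (a l)

/-- The determinant of the matrix enlarged by the parameter `X`, divided by `X` and cleared of
denominators; see `det_entryMatrix_cons`. -/
noncomputable def bordered {m : ℕ} (p : K) (a : Fin m → K) : K[X] :=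
  C (p * (entryMatrix p a).det) * (∏ l, ghat p (a l)) ^ 2 -
    bhat p * ∑ j, ∑ k, rowPoly p a j * C ((entryMatrix p a).adjugate j k) * colPoly p a k

/-- No denominator of `entryMatrix p a` vanishes. -/
structure Nondegenerate {m : ℕ} (p : K) (a : Fin m → K) : Prop where
  ne_zero : ∀ i, a i ≠ 0
  left : ∀ i j, p ^ 2 - a i * a j ≠ 0
  right : ∀ i j, p ^ 2 * a i * a j - 1 ≠ 0

theorem eval_ghat (p b x : K) : (ghat p b).eval x = (p ^ 2 - b * x) * (p ^ 2 * b * x - 1) := by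
  simp [ghat]

theorem eval_bhat (p x : K) : (bhat p).eval x = (p - x) * (p * x - 1) := by
  simp [bhat]

theorem natDegree_ghat_le (p b : K) : (ghat p b).natDegree ≤ 2 := by
  unfold ghat; compute_degree

theorem natDegree_bhat_le (p : K) : (bhat p).natDegree ≤ 2 := by
  unfold bhat; compute_degree

theorem natDegree_prod_ghat_le {m : ℕ} (p : K) (a : Fin m → K) (s : Finset (Fin m)) :
    (∏ l ∈ s, ghat p (a l)).natDegree ≤ 2 * s.card :=
  (natDegree_prod_le _ _).trans <| (Finset.sum_le_card_nsmul _ _ 2 fun _ _ =>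
    natDegree_ghat_le _ _).trans (by simp [mul_comm])

theorem natDegree_bordered_le {m : ℕ} (p : K) (a : Fin m → K) :
    (bordered p a).natDegree ≤ 4 * m := by
  refine (natDegree_sub_le _ _).trans (max_le ?_ ?_)
  · refine (natDegree_C_mul_le _ _).trans (natDegree_pow_le.trans ?_)
    have := natDegree_prod_ghat_le p a Finset.univ
    rw [Finset.card_univ, Fintype.card_fin] at this
    omega
  · rcases Nat.eq_zero_or_pos m with rfl | hm
    · simp
    have hcard : ∀ j : Fin m, (Finset.univ.erase j).card = m - 1 := fun j => by
      rw [Finset.card_erase_of_mem (Finset.mem_univ _), Finset.card_univ, Fintype.card_fin]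
    have h1 : ∀ j, (rowPoly p a j).natDegree ≤ 1 + 2 * (m - 1) := fun j => by
      refine natDegree_mul_le.trans (Nat.add_le_add ?_ ?_)
      · compute_degree
      · exact (natDegree_prod_ghat_le p a _).trans_eq (by rw [hcard])
    have h2 : ∀ j, (colPoly p a j).natDegree ≤ 1 + 2 * (m - 1) := fun j => by
      refine natDegree_mul_le.trans (Nat.add_le_add ?_ ?_)
      · compute_degree
      · exact (natDegree_prod_ghat_le p a _).trans_eq (by rw [hcard])
    have h3 : (∑ j, ∑ k, rowPoly p a j * C ((entryMatrix p a).adjugate j k) *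
        colPoly p a k).natDegree ≤ 2 + 4 * (m - 1) := by
      refine natDegree_sum_le_of_forall_le _ _ fun j _ =>
        natDegree_sum_le_of_forall_le _ _ fun k _ => natDegree_mul_le.trans ?_
      have := (natDegree_mul_C_le (rowPoly p a j) ((entryMatrix p a).adjugate j k)).trans (h1 j)
      have := h2 k
      omega
    have := natDegree_bhat_le p
    refine natDegree_mul_le.trans ?_
    omega

theorem entry_self {p a : K} (hp : p ≠ 0) (ha : a ≠ 0) (h1 : p ^ 2 - a * a ≠ 0)
    (h2 : p ^ 2 * a * a - 1 ≠ 0) : entry p a a = p * a / ((p - a) * (p * a - 1)) := by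
  have e1 : p ^ 2 - a * a = (p - a) * (p + a) := by ring
  have e2 : p ^ 2 * a * a - 1 = (p * a - 1) * (p * a + 1) := by ring
  rw [e1] at h1
  rw [e2] at h2
  have h3 := left_ne_zero_of_mul h1
  have h4 := right_ne_zero_of_mul h1
  have h5 := left_ne_zero_of_mul h2
  have h6 := right_ne_zero_of_mul h2
  rw [entry, e1, e2]
  field_simp
  ring

/-- The double zero of `bordered` at `X = a i`, reduced to the scalars that involve the parameter `a
= a i` alone. The quotient is given explicitly. -/
theorem sq_dvd_diagonal {p a : K} (hp : p ≠ 0) (ha : a ≠ 0) (h1 : p ^ 2 - a * a ≠ 0)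
    (h2 : p ^ 2 * a * a - 1 ≠ 0) :
    (X - C a) ^ 2 ∣ C (a * p) * ghat p a - bhat p *
      (C (p ^ 2 * a) * (C (p + p⁻¹ + a) * X + 1) +
        C a * (C (p ^ 2 * a) * (X + C (p + p⁻¹ + a⁻¹))) - ghat p a * C (entry p a a)) := by
  rw [entry_self hp ha h1 h2]
  have hb1 : p - a ≠ 0 := left_ne_zero_of_mul (b := p + a) (by rwa [show (p - a) * (p + a) =
    p ^ 2 - a * a by ring])
  have hb2 : p * a - 1 ≠ 0 := left_ne_zero_of_mul (b := p * a + 1) (by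
    rwa [show (p * a - 1) * (p * a + 1) = p ^ 2 * a * a - 1 by ring])
  set b := (p - a) * (p * a - 1) with hb
  have hb0 : b ≠ 0 := mul_ne_zero hb1 hb2
  have e1 : C (p ^ 2 * a) * (C (p + p⁻¹ + a) * X + 1) =
      (C p ^ 3 * C a + C p * C a + C p ^ 2 * C a ^ 2) * X + C p ^ 2 * C a := by
    rw [mul_add, ← mul_assoc, ← C_mul, show p ^ 2 * a * (p + p⁻¹ + a) =
      p ^ 3 * a + p * a + p ^ 2 * a ^ 2 by field_simp]
    simp only [C_add, C_mul, C_pow, mul_one]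
  have e2 : C a * (C (p ^ 2 * a) * (X + C (p + p⁻¹ + a⁻¹))) =
      C p ^ 2 * C a ^ 2 * X + (C p ^ 3 * C a ^ 2 + C p * C a ^ 2 + C p ^ 2 * C a) := by
    rw [mul_add, mul_add, ← mul_assoc (C a), ← mul_assoc (C a), ← C_mul, ← C_mul,
      show a * (p ^ 2 * a) * (p + p⁻¹ + a⁻¹) =
      p ^ 3 * a ^ 2 + p * a ^ 2 + p ^ 2 * a by field_simp,
      show a * (p ^ 2 * a) = p ^ 2 * a ^ 2 by ring]
    simp only [C_add, C_mul, C_pow]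
  have hb' : C b = (C p - C a) * (C p * C a - 1) := by
    rw [hb]; simp only [C_mul, C_sub, C_1]
  have e3 : (C p - C a) * (C p * C a - 1) * C (p * a / b) = C p * C a := by
    rw [← hb', ← C_mul, ← C_mul, mul_div_cancel₀ _ hb0]
  have e4 : (C p - C a) * (C p * C a - 1) * C (a / b) = C a := by
    rw [← hb', ← C_mul, mul_div_cancel₀ _ hb0]
  refine ⟨C (a / b) * (C p ^ 4 * C a ^ 2 * X ^ 2 +
    (2 * C p ^ 4 * C a ^ 3 - C p ^ 2 * C a * (C p ^ 4 + 1) - C p ^ 3 * (C p ^ 2 + 1) * C a ^ 2 +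
      C p ^ 2 * C b * (C p ^ 2 + 1 + 2 * C p * C a)) * X +
      C p ^ 2 * ((C p ^ 2 + 1) ^ 2 - C p ^ 2 - C p * C a * (C p ^ 2 + 1))), ?_⟩
  refine mul_left_cancel₀ (C_ne_zero.2 hb0) ?_
  rw [e1, e2, hb']
  simp only [ghat, bhat, C_mul, C_pow] at e3 e4 ⊢
  generalize C (p * a / b) = t₁ at *
  generalize C (a / b) = t₂ at *
  generalize C p = P at *
  generalize C a = A at *
  linear_combination ((P - X) * (P * X - 1) * ((P ^ 2 - A * X) * (P ^ 2 * A * X - 1))) * e3 -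
    ((X - A) ^ 2 * (P ^ 4 * A ^ 2 * X ^ 2 +
    (2 * P ^ 4 * A ^ 3 - P ^ 2 * A * (P ^ 4 + 1) - P ^ 3 * (P ^ 2 + 1) * A ^ 2 +
      P ^ 2 * ((P - A) * (P * A - 1)) * (P ^ 2 + 1 + 2 * P * A)) * X +
      P ^ 2 * ((P ^ 2 + 1) ^ 2 - P ^ 2 - P * A * (P ^ 2 + 1)))) * e4

theorem sum_mul_adjugate {R : Type*} [CommRing R] {m : ℕ} (M : Matrix (Fin m) (Fin m) R)
    (i k : Fin m) : ∑ j, M i j * M.adjugate j k = if i = k then M.det else 0 := by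
  have := congrFun (congrFun (Matrix.mul_adjugate M) i) k
  rw [Matrix.mul_apply] at this
  simpa [Matrix.one_apply] using this

theorem sum_adjugate_mul {R : Type*} [CommRing R] {m : ℕ} (M : Matrix (Fin m) (Fin m) R)
    (j i : Fin m) : ∑ k, M.adjugate j k * M k i = if j = i then M.det else 0 := by
  have := congrFun (congrFun (Matrix.adjugate_mul M) j) i
  rw [Matrix.mul_apply] at this
  simpa [Matrix.one_apply] using this

/-- If `r` and `c` agree modulo `t` with `g` times the `i`-th row and column of `M`, the value of
the adjugate form on them is known modulo `t ^ 2`. This is why a row and a column becoming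
proportional to others at the same time produces a double zero. -/
theorem quadratic_form_expand {R : Type*} [CommRing R] {m : ℕ} (M : Matrix (Fin m) (Fin m) R)
    (i : Fin m) (g t : R) (r c r' c' : Fin m → R) (hr : ∀ j, r j = g * M i j + t * r' j)
    (hc : ∀ k, c k = g * M k i + t * c' k) :
    ∑ j, ∑ k, r j * M.adjugate j k * c k =
      g * M.det * (c i + r i - g * M i i) +
        t ^ 2 * ∑ j, ∑ k, r' j * M.adjugate j k * c' k := by
  have h1 : ∑ j, ∑ k, M i j * M.adjugate j k * c k = M.det * c i := by
    rw [Finset.sum_comm]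
    simp only [← Finset.sum_mul, sum_mul_adjugate]
    simp
  have h2 : ∑ j, ∑ k, r' j * M.adjugate j k * M k i = M.det * r' i := by
    simp only [mul_assoc, ← Finset.mul_sum, sum_adjugate_mul]
    simp [mul_comm]
  calc _ = ∑ j, ∑ k, (g * (M i j * M.adjugate j k * c k) +
        t * g * (r' j * M.adjugate j k * M k i) +
        t ^ 2 * (r' j * M.adjugate j k * c' k)) := by
        refine Finset.sum_congr rfl fun j _ => Finset.sum_congr rfl fun k _ => ?_
        rw [hr j]
        conv_lhs => rw [add_mul, add_mul]
        rw [show t * r' j * M.adjugate j k * c k =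
          t * r' j * M.adjugate j k * (g * M k i + t * c' k) by rw [← hc k]]
        ring
    _ = _ := by
      simp only [Finset.sum_add_distrib, ← Finset.mul_sum, h1, h2]
      rw [hr i]
      ring

theorem sq_dvd_bordered {m : ℕ} {p : K} (hp : p ≠ 0) {a : Fin m → K} (ha : Nondegenerate p a)
    (i : Fin m) : (X - C (a i)) ^ 2 ∣ bordered p a := by
  set G := ∏ l, ghat p (a l) with hG
  have hGj : ∀ j, G = ghat p (a j) * ∏ l ∈ Finset.univ.erase j, ghat p (a l) := fun j =>
    (Finset.mul_prod_erase _ _ (Finset.mem_univ j)).symm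
  have hent : ∀ i j, entry p (a i) (a j) * ((p ^ 2 - a j * a i) * (p ^ 2 * a j * a i - 1)) =
      (p + p⁻¹ + a i + (a j)⁻¹) * (p ^ 2 * a i * a j) := by
    intro i j
    have h1 := ha.left i j
    have h2 := ha.right i j
    rw [entry, show p ^ 2 - a j * a i = p ^ 2 - a i * a j by ring,
      show p ^ 2 * a j * a i - 1 = p ^ 2 * a i * a j - 1 by ring]
    field_simp
  have hr : ∀ j, ∃ r', C (a i) * rowPoly p a j =
      G * C (entry p (a i) (a j)) + (X - C (a i)) * r' := by
    intro j
    have : X - C (a i) ∣ C (a i) * rowPoly p a j - G * C (entry p (a i) (a j)) := by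
      rw [dvd_iff_isRoot, IsRoot, hGj j, rowPoly]
      simp only [eval_sub, eval_mul, eval_C, eval_add, eval_X, eval_ghat]
      linear_combination -(eval (a i) (∏ l ∈ Finset.univ.erase j, ghat p (a l))) * hent i j
    obtain ⟨r', h⟩ := this
    exact ⟨r', by rw [← h]; ring⟩
  have hc : ∀ k, ∃ c', colPoly p a k =
      G * C (entry p (a k) (a i)) + (X - C (a i)) * c' := by
    intro k
    have : X - C (a i) ∣ colPoly p a k - G * C (entry p (a k) (a i)) := by
      rw [dvd_iff_isRoot, IsRoot, hGj k, colPoly]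
      simp only [eval_sub, eval_mul, eval_C, eval_add, eval_X, eval_ghat, eval_one]
      have h3 := hent k i
      have h4 : (a i)⁻¹ * a i = 1 := inv_mul_cancel₀ (ha.ne_zero i)
      linear_combination -(eval (a i) (∏ l ∈ Finset.univ.erase k, ghat p (a l))) * h3 -
        (eval (a i) (∏ l ∈ Finset.univ.erase k, ghat p (a l))) * p ^ 2 * a k * h4
    obtain ⟨c', h⟩ := this
    exact ⟨c', by rw [← h]; ring⟩
  choose r' hr' using hr
  choose c' hc' using hc
  have hadj : ∀ j k, ((entryMatrix p a).map C).adjugate j k =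
      C ((entryMatrix p a).adjugate j k) := by
    intro j k
    have := RingHom.map_adjugate (C : K →+* K[X]) (entryMatrix p a)
    rw [RingHom.mapMatrix_apply, RingHom.mapMatrix_apply] at this
    rw [← this, Matrix.map_apply]
  have hdet : ((entryMatrix p a).map C).det = C (entryMatrix p a).det :=
    (RingHom.map_det (C : K →+* K[X]) (entryMatrix p a)).symm
  have hq := quadratic_form_expand ((entryMatrix p a).map C) i G (X - C (a i))
    (fun j => C (a i) * rowPoly p a j) (colPoly p a) r' c' hr' hc'
  simp only [hadj, hdet] at hq
  have hsum : C (a i) * ∑ j, ∑ k, rowPoly p a j * C ((entryMatrix p a).adjugate j k) *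
      colPoly p a k = ∑ j, ∑ k, C (a i) * rowPoly p a j * C ((entryMatrix p a).adjugate j k) *
      colPoly p a k := by
    simp only [Finset.mul_sum, mul_assoc]
  obtain ⟨d, hd⟩ := sq_dvd_diagonal hp (ha.ne_zero i) (ha.left i i) (ha.right i i)
  have hunit : IsUnit (C (a i)) := isUnit_C.2 (ha.ne_zero i).isUnit
  rw [← hunit.dvd_mul_left]
  have key : C (a i) * bordered p a = (X - C (a i)) ^ 2 *
      (G * C (entryMatrix p a).det * (∏ l ∈ Finset.univ.erase i, ghat p (a l)) * d -
        bhat p * ∑ j, ∑ k, r' j * C ((entryMatrix p a).adjugate j k) * c' k) := by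
    have e0 : C (a i) * bordered p a = C (a i * p) * C (entryMatrix p a).det * G ^ 2 - bhat p *
        (C (a i) * ∑ j, ∑ k, rowPoly p a j * C ((entryMatrix p a).adjugate j k) *
          colPoly p a k) := by
      rw [bordered, ← hG]
      simp only [C_mul]
      ring
    have e1 : (entryMatrix p a).map C i i = C (entry p (a i) (a i)) := rfl
    rw [e0, hsum, hq, e1]
    simp only [rowPoly, colPoly]
    have e2 := hGj i
    set E := ∏ l ∈ Finset.univ.erase i, ghat p (a l)
    linear_combination (G * C (entryMatrix p a).det * E) * hd +
      (C (a i * p) * C (entryMatrix p a).det * G +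
        bhat p * G * C (entryMatrix p a).det * C (entry p (a i) (a i))) * e2
  exact ⟨_, key⟩

theorem exists_bordered_eq_mul {m : ℕ} {p : K} (hp : p ≠ 0) {a : Fin m → K}
    (ha : Nondegenerate p a) (hinj : Function.Injective a) :
    ∃ P : K[X], P.natDegree ≤ 2 * m ∧ bordered p a = P * ∏ j, (X - C (a j)) ^ 2 := by
  have hdvd : ∏ j, (X - C (a j)) ^ 2 ∣ bordered p a := by
    refine Finset.prod_dvd_of_coprime (fun i _ j _ hij => ?_) fun i _ => sq_dvd_bordered hp ha i
    exact (pairwise_coprime_X_sub_C hinj hij).pow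
  obtain ⟨P, hP⟩ := hdvd
  rw [mul_comm] at hP
  refine ⟨P, ?_, hP⟩
  by_cases hP0 : P = 0
  · simp [hP0]
  have hmonic : (∏ j, (X - C (a j)) ^ 2).Monic :=
    monic_prod_of_monic _ _ fun j _ => (monic_X_sub_C _).pow 2
  have hdeg : (∏ j, (X - C (a j)) ^ 2).natDegree = 2 * m := by
    rw [natDegree_prod_of_monic _ _ fun j _ => (monic_X_sub_C _).pow 2]
    simp [mul_comm]
  have := natDegree_bordered_le p a
  rw [hP, mul_comm, hmonic.natDegree_mul' hP0, hdeg] at this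
  omega

theorem eval_bordered_of_bhat {m : ℕ} {p x : K} (a : Fin m → K) (h : (bhat p).eval x = 0) :
    (bordered p a).eval x = p * (entryMatrix p a).det * (∏ l, (ghat p (a l)).eval x) ^ 2 := by
  simp [bordered, h, eval_prod]

/-- At a zero of `ghat p (a j)` only the product of the `j`-th entries of the new row and column
survives, with the minor omitting `j` as its coefficient. -/
theorem eval_bordered_of_ghat {k : ℕ} {p x : K} (a : Fin (k + 1) → K) (j : Fin (k + 1))
    (h : (ghat p (a j)).eval x = 0) :
    (bordered p a).eval x = -(bhat p).eval x *
      ((p ^ 2 * a j) * (x + (p + p⁻¹ + (a j)⁻¹)) * ((p ^ 2 * a j) * ((p + p⁻¹ + a j) * x + 1))) *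
      (∏ l, (ghat p (a (j.succAbove l))).eval x) ^ 2 *
      (entryMatrix p fun l => a (j.succAbove l)).det := by
  have h0 : ∀ i, i ≠ j → ∏ l ∈ Finset.univ.erase i, (ghat p (a l)).eval x = 0 := fun i hi =>
    Finset.prod_eq_zero (Finset.mem_erase.2 ⟨hi.symm, Finset.mem_univ _⟩) h
  have h1 : ∏ l ∈ Finset.univ.erase j, (ghat p (a l)).eval x =
      ∏ l, (ghat p (a (j.succAbove l))).eval x := by
    rw [← Finset.compl_singleton, ← Fin.image_succAbove_univ, Finset.prod_image]
    exact fun _ _ _ _ h => Fin.succAbove_right_injective h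
  have hadj : (entryMatrix p a).adjugate j j = (entryMatrix p fun l => a (j.succAbove l)).det := by
    rw [Matrix.adjugate_fin_succ_eq_det_submatrix, Even.neg_one_pow ⟨_, rfl⟩, one_mul]
    rfl
  have hall : ∏ l, (ghat p (a l)).eval x = 0 := Finset.prod_eq_zero (Finset.mem_univ j) h
  simp only [bordered, eval_sub, eval_mul, eval_pow, eval_C, eval_prod, eval_finsetSum, hall]
  rw [Finset.sum_eq_single j, Finset.sum_eq_single j]
  · simp only [rowPoly, colPoly, eval_mul, eval_C, eval_add, eval_X, eval_one, eval_prod, h1, hadj]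
    ring
  · intro i _ hi
    simp [colPoly, eval_prod, h0 i hi]
  · simp
  · intro i _ hi
    simp [rowPoly, eval_prod, h0 i hi]
  · simp

theorem det_entryMatrix_cons {m : ℕ} {p x : K} (hp : p ≠ 0) {a : Fin m → K}
    (h : Nondegenerate p (Fin.cons x a : Fin (m + 1) → K)) :
    (entryMatrix p (Fin.cons x a : Fin (m + 1) → K)).det *
      ((bhat p).eval x * (∏ l, (ghat p (a l)).eval x) ^ 2) = x * (bordered p a).eval x := by
  have hx : x ≠ 0 := h.ne_zero 0
  have h0 : ∀ l, (ghat p (a l)).eval x ≠ 0 := fun l => by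
    rw [eval_ghat]
    have h1 := h.left 0 l.succ
    have h2 := h.right 0 l.succ
    simp only [Fin.cons_zero, Fin.cons_succ] at h1 h2
    refine mul_ne_zero ?_ ?_
    · rwa [mul_comm]
    · rwa [mul_right_comm]
  have hb : (bhat p).eval x ≠ 0 := by
    rw [eval_bhat]
    have h1 := h.left 0 0
    have h2 := h.right 0 0
    simp only [Fin.cons_zero] at h1 h2
    refine mul_ne_zero (left_ne_zero_of_mul (b := p + x) ?_)
      (left_ne_zero_of_mul (b := p * x + 1) ?_)
    · rwa [show (p - x) * (p + x) = p ^ 2 - x * x by ring]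
    · rwa [show (p * x - 1) * (p * x + 1) = p ^ 2 * x * x - 1 by ring]
  set G := ∏ l, (ghat p (a l)).eval x with hG
  have hGj : ∀ j, G = (ghat p (a j)).eval x * ∏ l ∈ Finset.univ.erase j, (ghat p (a l)).eval x :=
    fun j => (Finset.mul_prod_erase _ _ (Finset.mem_univ j)).symm
  have hr : ∀ j, entry p x (a j) * G = x * (rowPoly p a j).eval x := by
    intro j
    have h1 := h0 j
    have h2 : a j ≠ 0 := h.ne_zero j.succ
    rw [hGj j, rowPoly, entry, show (p ^ 2 - x * a j) * (p ^ 2 * x * a j - 1) =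
      (ghat p (a j)).eval x by rw [eval_ghat]; ring]
    simp only [eval_mul, eval_C, eval_add, eval_X, eval_prod]
    field_simp
    ring
  have hc : ∀ k, entry p (a k) x * G = (colPoly p a k).eval x := by
    intro k
    have h1 := h0 k
    rw [hGj k, colPoly, entry, show (p ^ 2 - a k * x) * (p ^ 2 * a k * x - 1) =
      (ghat p (a k)).eval x by rw [eval_ghat]]
    simp only [eval_mul, eval_C, eval_add, eval_X, eval_prod, eval_one]
    field_simp
  have hd : entry p x x * (bhat p).eval x = p * x := by
    rw [entry_self hp hx (h.left 0 0) (h.right 0 0), eval_bhat]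
    rw [eval_bhat] at hb
    rw [div_mul_cancel₀ _ hb]
  have hsub : (entryMatrix p (Fin.cons x a : Fin (m + 1) → K)).submatrix Fin.succ Fin.succ =
      entryMatrix p a := rfl
  have e1 : ∀ j : Fin m, entryMatrix p (Fin.cons x a : Fin (m + 1) → K) 0 j.succ =
    entry p x (a j) := fun _ => rfl
  have e2 : ∀ j : Fin m, entryMatrix p (Fin.cons x a : Fin (m + 1) → K) j.succ 0 =
    entry p (a j) x := fun _ => rfl
  have e3 : entryMatrix p (Fin.cons x a : Fin (m + 1) → K) 0 0 = entry p x x := rfl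
  have hs : (∑ j, ∑ k, entry p x (a j) * (entryMatrix p a).adjugate j k * entry p (a k) x) *
      G ^ 2 = x * ∑ j, ∑ k, (rowPoly p a j).eval x * (entryMatrix p a).adjugate j k *
        (colPoly p a k).eval x := by
    simp only [Finset.sum_mul, Finset.mul_sum]
    refine Finset.sum_congr rfl fun j _ => Finset.sum_congr rfl fun k _ => ?_
    rw [← hc k]
    linear_combination ((entryMatrix p a).adjugate j k * entry p (a k) x * G) * hr j
  rw [det_eq_sub_sum_adjugate, hsub, e3]
  simp only [e1, e2]
  simp only [bordered, eval_sub, eval_mul, eval_pow, eval_C, eval_prod, eval_finsetSum]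
  rw [← hG]
  linear_combination ((entryMatrix p a).det * G ^ 2) * hd - (bhat p).eval x * hs

/-! ### The product formula and its specializations -/

/-- The constant prefactor of the product formula. -/
def rconst (q : K) (n : ℕ) : K :=
  sigma (q ^ 2) ^ n / (sigma q ^ (2 * n) * sigma (q ^ 4) ^ (n ^ 2))

/-- The factor of the product formula that belongs to a single parameter. -/
def alpha (q u : K) : K :=
  sigma (q * u) * sigma (q * u⁻¹) * sigma (q ^ 2 * u) * sigma (q ^ 2 * u⁻¹)

/-- The factor of the product formula that belongs to a pair of parameters. -/
def pairW (q u w : K) : K :=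
  (sigma (q ^ 2 * u * w) * sigma (q ^ 2 * u⁻¹ * w⁻¹) / sigma (u * w⁻¹)) ^ 2

/-- The product of the factors `alpha` over a list of parameters and `pairW` over its pairs. -/
def pref (q : K) : List K → K
  | [] => 1
  | u :: us => alpha q u * (us.map (pairW q u)).prod * pref q us

/-- The product formula for the parameters `f`. -/
def rhs (q : K) {n : ℕ} (f : Fin n → K) : K :=
  rconst q n * pref q (List.ofFn f) * (entryMatrix (q ^ 2) fun i => f i ^ 2).det

theorem rconst_succ {q : K} (hq4 : sigma (q ^ 4) ≠ 0) (n : ℕ) : rconst q (n + 1) =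
    rconst q n * (sigma (q ^ 2) / (sigma q ^ 2 * sigma (q ^ 4) ^ (2 * n + 1))) := by
  have hq1 := sigma_ne_zero_of_pow_four hq4
  rw [rconst, rconst, show (n + 1) ^ 2 = n ^ 2 + (2 * n + 1) by ring, mul_add, pow_add, pow_add,
    pow_add]
  field_simp

theorem pairW_comm (q u w : K) : pairW q u w = pairW q w u := by
  have h : sigma (w * u⁻¹) = -sigma (u * w⁻¹) := by rw [← sigma_inv]; simp
  rw [pairW, pairW, h, mul_right_comm (q ^ 2) w u, mul_right_comm (q ^ 2) w⁻¹ u⁻¹, div_neg,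
    neg_sq]

theorem pref_perm (q : K) {us vs : List K} (h : us.Perm vs) : pref q us = pref q vs := by
  induction h with
  | nil => rfl
  | cons x h ih => rw [pref, pref, ih, (h.map _).prod_eq]
  | swap x y t =>
    simp only [pref, List.map_cons, List.prod_cons, pairW_comm q x y]
    ring
  | trans _ _ ih₁ ih₂ => rw [ih₁, ih₂]

omit [Field K] in
theorem ofFn_perm_cons {k : ℕ} (v : Fin (k + 1) → K) (j : Fin (k + 1)) :
    (List.ofFn v).Perm (v j :: List.ofFn fun l => v (j.succAbove l)) := by
  have h : List.ofFn (v ∘ j.cycleRange.symm) = v j :: List.ofFn fun l => v (j.succAbove l) := by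
    simp [List.ofFn_succ, Fin.cycleRange_symm_zero, Fin.cycleRange_symm_succ]
  rw [← h]
  exact (Equiv.Perm.ofFn_comp_perm _ _).symm

theorem eval_ghat_sq {q y w : K} (hq4 : sigma (q ^ 4) ≠ 0) (hq : q ≠ 0) (hy : y ≠ 0)
    (hw : w ≠ 0) : (ghat (q ^ 2) (w ^ 2)).eval (y ^ 2) =
      q ^ 4 * y ^ 2 * w ^ 2 * sigma (q ^ 4) ^ 2 * wB q (y * w) * wA q (y * w) := by
  rw [eval_ghat, wA, wB]
  field_simp
  simp only [sigma]
  field_simp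

theorem sq_sub_sq {y w : K} (hy : y ≠ 0) (hw : w ≠ 0) :
    (y ^ 2 - w ^ 2) ^ 2 = sigma (y * w⁻¹) ^ 2 * y ^ 2 * w ^ 2 := by
  simp only [sigma]
  field_simp

theorem wA_eq {q : K} (hq : q ≠ 0) (x : K) :
    wA q x = sigma (q ^ 2 * x⁻¹) / sigma (q ^ 4) := by
  rw [wA, mul_inv, show q ^ 4 * ((q ^ 2)⁻¹ * x⁻¹) = q ^ 2 * x⁻¹ by field_simp]

theorem eval_ghat_self {q w : K} (hq4 : sigma (q ^ 4) ≠ 0) (hq : q ≠ 0) (hw : w ≠ 0) :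
    (ghat (q ^ 2) (w ^ 2)).eval (q ^ 2) ^ 2 = (q ^ 2 - w ^ 2) ^ 2 * q ^ 8 * w ^ 2 * q ^ 2 *
      sigma (q ^ 4) ^ 2 * wB q (q * w) ^ 2 := by
  rw [eval_ghat_sq hq4 hq hq hw, sq_sub_sq hq hw, wA_eq hq,
    show q ^ 2 * (q * w)⁻¹ = q * w⁻¹ by field_simp]
  field_simp

theorem eval_ghat_inv {q w : K} (hq4 : sigma (q ^ 4) ≠ 0) (hq : q ≠ 0) (hw : w ≠ 0) :
    (ghat (q ^ 2) (w ^ 2)).eval (q⁻¹ ^ 2) ^ 2 = (q⁻¹ ^ 2 - w ^ 2) ^ 2 * q ^ 8 * w ^ 2 * q⁻¹ ^ 2 *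
      sigma (q ^ 4) ^ 2 * wA q (q⁻¹ * w) ^ 2 := by
  rw [eval_ghat_sq hq4 hq (inv_ne_zero hq) hw, sq_sub_sq (inv_ne_zero hq) hw, wB,
    show q ^ 2 * (q⁻¹ * w) = (q⁻¹ * w⁻¹)⁻¹ by field_simp, sigma_inv]
  field_simp

theorem eval_ghat_mul_pairW {q y w z : K} (hq4 : sigma (q ^ 4) ≠ 0) (hq : q ≠ 0) (hy : y ≠ 0)
    (hw : w ≠ 0) (hz : z ≠ 0) (hwz : sigma (w * z⁻¹) ≠ 0) (hyw : y * w = q ^ 2) :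
    (ghat (q ^ 2) (z ^ 2)).eval (y ^ 2) ^ 2 * pairW q w z = (y ^ 2 - z ^ 2) ^ 2 * q ^ 8 * z ^ 2 *
      y ^ 2 * sigma (q ^ 4) ^ 4 * wB q (y * z) ^ 2 * wB q (w * z) ^ 2 := by
  rw [← div_eq_mul_inv] at hwz
  rw [eval_ghat_sq hq4 hq hy hz, sq_sub_sq hy hz, pairW, wA_eq hq, wB, wB,
    show q ^ 2 * (y * z)⁻¹ = w * z⁻¹ by rw [← hyw]; field_simp,
    show q ^ 2 * w⁻¹ * z⁻¹ = y * z⁻¹ by rw [← hyw]; field_simp,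
    mul_assoc (q ^ 2) w z]
  field_simp

theorem eval_ghat_mul_pairW' {q y w z : K} (hq4 : sigma (q ^ 4) ≠ 0) (hq : q ≠ 0) (hy : y ≠ 0)
    (hw : w ≠ 0) (hz : z ≠ 0) (hwz : sigma (w * z⁻¹) ≠ 0) (hyw : y * w = (q ^ 2)⁻¹) :
    (ghat (q ^ 2) (z ^ 2)).eval (y ^ 2) ^ 2 * pairW q w z = (y ^ 2 - z ^ 2) ^ 2 * q ^ 8 * z ^ 2 *
      y ^ 2 * sigma (q ^ 4) ^ 4 * wA q (y * z) ^ 2 * wA q (w * z) ^ 2 := by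
  have hq2 : q ^ 2 = (y * w)⁻¹ := by rw [hyw, inv_inv]
  rw [← div_eq_mul_inv] at hwz
  rw [eval_ghat_sq hq4 hq hy hz, sq_sub_sq hy hz, pairW, wA_eq hq, wA_eq hq, wB,
    show q ^ 2 * (y * z) = (w * z⁻¹)⁻¹ by rw [hq2]; field_simp, sigma_inv,
    show q ^ 2 * w * z = (y * z⁻¹)⁻¹ by rw [hq2]; field_simp, sigma_inv,
    show q ^ 2 * (w * z)⁻¹ = q ^ 2 * w⁻¹ * z⁻¹ by rw [mul_inv]; ring]
  field_simp

/-- The scalar part of the comparison of the two recursions at `y * w = q ^ 2`. -/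
theorem scalar_residue {q y w : K} (hq4 : sigma (q ^ 4) ≠ 0) (hq : q ≠ 0) (hy : y ≠ 0)
    (hw : w ≠ 0) (hyw : y * w = q ^ 2) :
    (y ^ 2 - w ^ 2) ^ 2 * y ^ 4 * ((sigma (q * y) / sigma q) * (sigma (q * w) / sigma q) *
      (1 - (sigma (q * y⁻¹) / sigma q) ^ 2) * wB q y * wB q w) *
      (sigma q ^ 4 * sigma (q ^ 4) ^ 4 * q ^ 6) =
    -(sigma (q ^ 2) ^ 2 * alpha q w * (ghat (q ^ 2) 1).eval (y ^ 2) *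
      (bhat (q ^ 2)).eval (y ^ 2) * w ^ 2 *
      (y ^ 2 + (q ^ 2 + (q ^ 2)⁻¹ + (w ^ 2)⁻¹)) * ((q ^ 2 + (q ^ 2)⁻¹ + w ^ 2) * y ^ 2 + 1)) := by
  have hq1 := sigma_ne_zero_of_pow_four hq4
  have : w = q ^ 2 / y := by rw [← hyw]; field_simp
  subst this
  rw [eval_ghat, eval_bhat, wB, wB, alpha]
  field_simp
  simp only [sigma]
  field_simp
  ring

/-- The scalar part of the comparison of the two recursions at `y * w = q ^ (-2)`. -/
theorem scalar_residue' {q y w : K} (hq4 : sigma (q ^ 4) ≠ 0) (hq : q ≠ 0) (hy : y ≠ 0)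
    (hw : w ≠ 0) (hyw : y * w = (q ^ 2)⁻¹) :
    (y ^ 2 - w ^ 2) ^ 2 * y ^ 4 * ((sigma (q * y⁻¹) / sigma q) * (sigma (q * w⁻¹) / sigma q) *
      (1 - (sigma (q * y) / sigma q) ^ 2) * wA q y * wA q w) *
      (sigma q ^ 4 * sigma (q ^ 4) ^ 4 * q ^ 6) =
    -(sigma (q ^ 2) ^ 2 * alpha q w * (ghat (q ^ 2) 1).eval (y ^ 2) *
      (bhat (q ^ 2)).eval (y ^ 2) * w ^ 2 *
      (y ^ 2 + (q ^ 2 + (q ^ 2)⁻¹ + (w ^ 2)⁻¹)) * ((q ^ 2 + (q ^ 2)⁻¹ + w ^ 2) * y ^ 2 + 1)) := by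
  have hq1 := sigma_ne_zero_of_pow_four hq4
  have : w = (q ^ 2 * y)⁻¹ := by rw [mul_inv, ← hyw]; field_simp
  subst this
  rw [eval_ghat, eval_bhat, wA_eq hq, wA_eq hq, alpha]
  field_simp
  simp only [sigma]
  field_simp
  ring

/-! ### Interpolation in the first parameter -/

theorem prodA_columns (q x c : K) {m : ℕ} (v : Fin m → K) :
    prodA q x (List.ofFn v ++ c :: (List.ofFn v).reverse) =
      (∏ l, wA q (x * v l)) ^ 2 * wA q (x * c) := by
  simp only [prodA, List.map_append, List.map_cons, List.map_reverse, List.prod_append,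
    List.prod_cons, List.prod_reverse, List.map_ofFn, List.prod_ofFn, Function.comp]
  ring

theorem prodB_columns (q x c : K) {m : ℕ} (v : Fin m → K) :
    prodB q x (List.ofFn v ++ c :: (List.ofFn v).reverse) =
      (∏ l, wB q (x * v l)) ^ 2 * wB q (x * c) := by
  simp only [prodB, List.map_append, List.map_cons, List.map_reverse, List.prod_append,
    List.prod_cons, List.prod_reverse, List.map_ofFn, List.prod_ofFn, Function.comp]
  ring

/-- The product formula for the parameters `y` and `v`, cleared of denominators. For `y ^ 2`
different from all `v l ^ 2` this is equivalent to an equality of two polynomials of degree at most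
`2 * m + 2` in `y ^ 2`. -/
def Interpolates (q : K) {m : ℕ} (v : Fin m → K) (y : K) : Prop :=
  y ^ (2 * m + 2) * zfun q 1 (y :: List.ofFn v) * (∏ l, (y ^ 2 - v l ^ 2) ^ 2) *
      (q ^ (8 * m + 6) * ∏ l, v l ^ 2) =
    rconst q (m + 1) * pref q (List.ofFn v) * (ghat (q ^ 2) 1).eval (y ^ 2) *
      (bordered (q ^ 2) fun l => v l ^ 2).eval (y ^ 2)

theorem interpolates_self {q : K} (hq4 : sigma (q ^ 4) ≠ 0) (hq : q ≠ 0) {m : ℕ} {v : Fin m → K}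
    (hv : ∀ l, v l ≠ 0) (h : zfun q 1 (List.ofFn v) = rhs q v) : Interpolates q v q := by
  have hq1 := sigma_ne_zero_of_pow_four hq4
  have hb : (bhat (q ^ 2)).eval (q ^ 2) = 0 := by rw [eval_bhat]; ring
  have hE : (∏ l, (ghat (q ^ 2) (v l ^ 2)).eval (q ^ 2)) ^ 2 = (∏ l, (q ^ 2 - v l ^ 2) ^ 2) *
      (q ^ 8) ^ m * (∏ l, v l ^ 2) * (q ^ 2) ^ m * (sigma (q ^ 4) ^ 2) ^ m *
      (∏ l, wB q (q * v l)) ^ 2 := by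
    simp only [← Finset.prod_pow, eval_ghat_self hq4 hq (hv _), Finset.prod_mul_distrib,
      Finset.prod_const, Finset.card_univ, Fintype.card_fin]
  have hg : (ghat (q ^ 2) 1).eval (q ^ 2) = q ^ 6 * sigma q * sigma (q ^ 3) := by
    rw [eval_ghat]; simp only [sigma]; field_simp
  rw [Interpolates, zfun_cons_self hq, prodB_columns, h, rhs, eval_bordered_of_bhat _ hb, hE, hg,
    rconst_succ hq4, wB, show q ^ 2 * (q * 1) = q ^ 3 by ring]
  generalize ∏ l, (q ^ 2 - v l ^ 2) ^ 2 = t₁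
  generalize ∏ l, v l ^ 2 = t₂
  generalize ∏ l, wB q (q * v l) = t₃
  field_simp
  ring

theorem interpolates_inv {q : K} (hq4 : sigma (q ^ 4) ≠ 0) (hq : q ≠ 0) {m : ℕ} {v : Fin m → K}
    (hv : ∀ l, v l ≠ 0) (h : zfun q 1 (List.ofFn v) = rhs q v) : Interpolates q v q⁻¹ := by
  have hq1 := sigma_ne_zero_of_pow_four hq4
  have hb : (bhat (q ^ 2)).eval (q⁻¹ ^ 2) = 0 := by rw [eval_bhat]; field_simp; ring
  have hE : (∏ l, (ghat (q ^ 2) (v l ^ 2)).eval (q⁻¹ ^ 2)) ^ 2 =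
      (∏ l, (q⁻¹ ^ 2 - v l ^ 2) ^ 2) *
      (q ^ 8) ^ m * (∏ l, v l ^ 2) * (q⁻¹ ^ 2) ^ m * (sigma (q ^ 4) ^ 2) ^ m *
      (∏ l, wA q (q⁻¹ * v l)) ^ 2 := by
    simp only [← Finset.prod_pow, eval_ghat_inv hq4 hq (hv _), Finset.prod_mul_distrib,
      Finset.prod_const, Finset.card_univ, Fintype.card_fin]
  have hg : (ghat (q ^ 2) 1).eval (q⁻¹ ^ 2) = q⁻¹ ^ 6 * q ^ 8 * sigma q * sigma (q ^ 3) := by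
    rw [eval_ghat]; simp only [sigma]; field_simp
  rw [Interpolates, zfun_cons_inv hq, prodA_columns, h, rhs, eval_bordered_of_bhat _ hb, hE, hg,
    rconst_succ hq4, wA_eq hq, show q ^ 2 * (q⁻¹ * 1)⁻¹ = q ^ 3 by field_simp]
  rw [show q⁻¹ ^ (2 * m + 2) = (q⁻¹ ^ 2) ^ m * q⁻¹ ^ 2 by ring]
  generalize (q⁻¹ ^ 2) ^ m = t₄
  generalize ∏ l, (q⁻¹ ^ 2 - v l ^ 2) ^ 2 = t₁
  generalize ∏ l, v l ^ 2 = t₂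
  generalize ∏ l, wA q (q⁻¹ * v l) = t₃
  field_simp
  ring

/-- Conditions under which the interpolation argument applies: no denominator vanishes, the
parameters have different squares, the nodes are distinct and different from the parameters, and
rows may be exchanged. The bound `16` is larger than the exponents that occur. -/
structure Generic (q : K) {n : ℕ} (f : Fin n → K) : Prop where
  nondegenerate : Nondegenerate (q ^ 2) fun i => f i ^ 2
  injective : Function.Injective fun i => f i ^ 2
  powers : ∀ i, ∀ k ≤ 16, f i ^ 2 * q ^ 8 ≠ q ^ k
  ratio : ∀ i j, f i ^ 2 ≠ q ^ 8 * f j ^ 2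

theorem Generic.comp {q : K} {n m : ℕ} {f : Fin n → K} (h : Generic q f) {e : Fin m → Fin n}
    (he : Function.Injective e) : Generic q fun i => f (e i) where
  nondegenerate := ⟨fun _ => h.nondegenerate.ne_zero _, fun _ _ => h.nondegenerate.left _ _,
    fun _ _ => h.nondegenerate.right _ _⟩
  injective := fun _ _ hij => he (h.injective hij)
  powers i := h.powers (e i)
  ratio i j := h.ratio (e i) (e j)

theorem Generic.ne_zero {q : K} {n : ℕ} {f : Fin n → K} (h : Generic q f) (i : Fin n) :
    f i ≠ 0 := fun hi => h.nondegenerate.ne_zero i (by simp [hi])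

theorem sigma_ne_zero {x : K} (hx : x ≠ 0) (h : x ^ 2 ≠ 1) : sigma x ≠ 0 := by
  intro h'
  rw [sigma, sub_eq_zero] at h'
  apply h
  rw [sq]
  nth_rw 1 [h']
  exact inv_mul_cancel₀ hx

theorem Generic.sigma_ratio_ne_zero {q : K} (hq : q ≠ 0) {n : ℕ} {f : Fin n → K}
    (h : Generic q f) (i j : Fin n) : sigma (q ^ 4 * (f i / f j)) ≠ 0 := by
  have hi := h.ne_zero i
  have hj := h.ne_zero j
  refine sigma_ne_zero (by positivity) fun h1 => h.ratio j i ?_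
  field_simp at h1
  rw [← h1]

/-- At `y = q ^ 2` the partition function vanishes, as `y` can be moved to the last row; the product
formula vanishes because of the factor `σ(q ^ 2 * y⁻¹)`. -/
theorem interpolates_sq {q : K} (hq4 : sigma (q ^ 4) ≠ 0) (hq : q ≠ 0) {m : ℕ} {v : Fin m → K}
    (hv : Generic q v) : Interpolates q v (q ^ 2) := by
  have h0 : zfun q 1 (q ^ 2 :: List.ofFn v) = 0 := by
    have hσ : ∀ i, sigma (q ^ 4 * (v i / q ^ 2)) ≠ 0 := fun i => by
      have hi := hv.ne_zero i
      refine sigma_ne_zero (by positivity) fun h1 => hv.powers i 4 (by norm_num) ?_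
      field_simp at h1
      linear_combination q ^ 4 * h1
    have := zfun_perm (us := q ^ 2 :: List.ofFn v) (vs := List.ofFn v ++ [q ^ 2]) hq hq4
      one_ne_zero (List.perm_append_singleton _ _).symm ?_ ?_ [] (by simp)
    · rw [List.nil_append, List.nil_append] at this
      rw [this, zfun, tri_append_eq_zero hq4]
      rfl
    · simp only [List.mem_cons, List.mem_ofFn]
      rintro _ (rfl | ⟨i, rfl⟩)
      · positivity
      · exact hv.ne_zero i
    · simp only [List.mem_cons, List.mem_ofFn]
      rintro _ (rfl | ⟨i, rfl⟩) _ (rfl | ⟨j, rfl⟩)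
      · left
        rwa [div_self (by positivity), mul_one]
      · exact Or.inr (hσ j)
      · exact Or.inl (hσ i)
      · exact Or.inl (hv.sigma_ratio_ne_zero hq i j)
  have hg : (ghat (q ^ 2) 1).eval ((q ^ 2) ^ 2) = 0 := by
    rw [eval_ghat]; ring
  rw [Interpolates, h0, hg]
  ring

/-- Comparison of the two recursions at a zero of `ghat`: the scalar identity `hS`, the ratio `hR`
of the constants, and the product `hE` of the contributions of the remaining parameters imply the
identity with all factors. -/
theorem residue_assemble {q y w s₁ s₂ s₄ L b g al e T A G Pw B₁ B₂ c₁ c₂ r r₂ pr D : K} {k : ℕ}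
    (h₁ : s₁ ≠ 0) (h₄ : s₄ ≠ 0)
    (hS : (y ^ 2 - w ^ 2) ^ 2 * y ^ 4 * (L * c₁ * c₂) * (s₁ ^ 4 * s₄ ^ 4 * q ^ 6) =
      -(s₂ ^ 2 * al * g * b * w ^ 2 * e))
    (hR : r₂ * (s₁ ^ 4 * s₄ ^ 4 * (s₄ ^ 4) ^ k) = r * s₂ ^ 2)
    (hE : G ^ 2 * Pw = T * (q ^ 8) ^ k * A * (y ^ 2) ^ k * (s₄ ^ 4) ^ k * B₁ ^ 2 * B₂ ^ 2) :
    y ^ (2 * (k + 1) + 2) * (L * (B₁ ^ 2 * c₁) * (B₂ ^ 2 * c₂) * (r * pr * D)) *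
        ((y ^ 2 - w ^ 2) ^ 2 * T) * (q ^ (8 * (k + 1) + 6) * (w ^ 2 * A)) =
      r₂ * (al * Pw * pr) * g * (-b * (q ^ 8 * w ^ 4 * e) * G ^ 2 * D) := by
  refine mul_right_cancel₀ (b := s₁ ^ 4 * s₄ ^ 4 * (s₄ ^ 4) ^ k) (by positivity) ?_
  linear_combination (y ^ (2 * k) * B₁ ^ 2 * B₂ ^ 2 * r * pr * D * T * q ^ (8 * k) * q ^ 8 *
      w ^ 2 * A * (s₄ ^ 4) ^ k) * hS -
    ((al * Pw * pr) * g * (-b * (q ^ 8 * w ^ 4 * e) * G ^ 2 * D)) * hR -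
    (r * s₂ ^ 2 * al * pr * g * (-b * (q ^ 8 * w ^ 4 * e) * D)) * hE

theorem rconst_add_two {q : K} (hq4 : sigma (q ^ 4) ≠ 0) (k : ℕ) :
    rconst q (k + 1 + 1) * (sigma q ^ 4 * sigma (q ^ 4) ^ 4 * (sigma (q ^ 4) ^ 4) ^ k) =
      rconst q k * sigma (q ^ 2) ^ 2 := by
  have hq1 := sigma_ne_zero_of_pow_four hq4
  rw [rconst_succ hq4, rconst_succ hq4]
  field_simp
  ring

theorem Generic.sigma_mul_inv_ne_zero {q : K} {n : ℕ} {f : Fin n → K} (h : Generic q f)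
    {i j : Fin n} (hij : i ≠ j) : sigma (f i * (f j)⁻¹) ≠ 0 := by
  have hi := h.ne_zero i
  have hj := h.ne_zero j
  refine sigma_ne_zero (by positivity) fun h1 => hij (h.injective ?_)
  field_simp at h1
  exact h1

theorem zfun_cons_perm {q : K} (hq4 : sigma (q ^ 4) ≠ 0) (hq : q ≠ 0) {k : ℕ}
    {v : Fin (k + 1) → K} (hv : Generic q v) (j : Fin (k + 1)) {y : K} (hy : y ≠ 0) :
    zfun q 1 (y :: List.ofFn v) = zfun q 1 (y :: v j :: List.ofFn fun l => v (j.succAbove l)) := by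
  refine zfun_perm hq hq4 one_ne_zero (ofFn_perm_cons v j) ?_ ?_ [y] (by simpa using hy)
  · simp only [List.mem_ofFn]
    rintro _ ⟨i, rfl⟩
    exact hv.ne_zero i
  · simp only [List.mem_ofFn]
    rintro _ ⟨i, rfl⟩ _ ⟨j, rfl⟩
    exact Or.inl (hv.sigma_ratio_ne_zero hq i j)

theorem pref_ofFn_succAbove (q : K) {k : ℕ} (v : Fin (k + 1) → K) (j : Fin (k + 1)) :
    pref q (List.ofFn v) = alpha q (v j) * (∏ l, pairW q (v j) (v (j.succAbove l))) *
      pref q (List.ofFn fun l => v (j.succAbove l)) := by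
  rw [pref_perm q (ofFn_perm_cons v j), pref, List.map_ofFn, List.prod_ofFn]
  rfl

theorem interpolates_mul {q : K} (hq4 : sigma (q ^ 4) ≠ 0) (hq : q ≠ 0) {k : ℕ}
    {v : Fin (k + 1) → K} (hv : Generic q v) (j : Fin (k + 1)) {y : K} (hyw : y * v j = q ^ 2)
    (h : zfun q 1 (List.ofFn fun l => v (j.succAbove l)) = rhs q fun l => v (j.succAbove l)) :
    Interpolates q v y := by
  have hw := hv.ne_zero j
  have hy : y ≠ 0 := by
    rintro rfl
    rw [zero_mul, eq_comm] at hyw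
    exact pow_ne_zero 2 hq hyw
  have hg : (ghat (q ^ 2) (v j ^ 2)).eval (y ^ 2) = 0 := by
    rw [eval_ghat, ← hyw]; ring
  have hE : (∏ l, (ghat (q ^ 2) (v (j.succAbove l) ^ 2)).eval (y ^ 2)) ^ 2 *
      (∏ l, pairW q (v j) (v (j.succAbove l))) =
      (∏ l, (y ^ 2 - v (j.succAbove l) ^ 2) ^ 2) * (q ^ 8) ^ k *
      (∏ l, v (j.succAbove l) ^ 2) * (y ^ 2) ^ k * (sigma (q ^ 4) ^ 4) ^ k *
      (∏ l, wB q (y * v (j.succAbove l))) ^ 2 * (∏ l, wB q (v j * v (j.succAbove l))) ^ 2 := by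
    have : ∀ l, (ghat (q ^ 2) (v (j.succAbove l) ^ 2)).eval (y ^ 2) ^ 2 *
        pairW q (v j) (v (j.succAbove l)) = _ := fun l =>
      eval_ghat_mul_pairW hq4 hq hy hw (hv.ne_zero _)
        (hv.sigma_mul_inv_ne_zero (Fin.succAbove_ne j l).symm) hyw
    simp only [← Finset.prod_pow, ← Finset.prod_mul_distrib, this]
    simp only [Finset.prod_mul_distrib, Finset.prod_const, Finset.card_univ, Fintype.card_fin]
  rw [Interpolates, zfun_cons_perm hq4 hq hv j hy, zfun_cons_cons hq4 hyw, prodB_columns,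
    prodB_columns, h, rhs, eval_bordered_of_ghat (fun l => v l ^ 2) j hg, pref_ofFn_succAbove q v j,
    Fin.prod_univ_succAbove (fun l => (y ^ 2 - v l ^ 2) ^ 2) j,
    Fin.prod_univ_succAbove (fun l => v l ^ 2) j, mul_one, mul_one]
  have hS := scalar_residue hq4 hq hy hw hyw
  rw [mul_assoc _ (y ^ 2 + _), ← neg_mul] at hS
  exact (residue_assemble (sigma_ne_zero_of_pow_four hq4) hq4 (by rw [hS, neg_mul])
    (rconst_add_two hq4 k) hE).trans (by ring)

theorem interpolates_mul_inv {q : K} (hq4 : sigma (q ^ 4) ≠ 0) (hq : q ≠ 0) {k : ℕ}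
    {v : Fin (k + 1) → K} (hv : Generic q v) (j : Fin (k + 1)) {y : K}
    (hyw : y * v j = (q ^ 2)⁻¹)
    (h : zfun q 1 (List.ofFn fun l => v (j.succAbove l)) = rhs q fun l => v (j.succAbove l)) :
    Interpolates q v y := by
  have hw := hv.ne_zero j
  have hy : y ≠ 0 := by
    rintro rfl
    rw [zero_mul, eq_comm, inv_eq_zero] at hyw
    exact pow_ne_zero 2 hq hyw
  have hg : (ghat (q ^ 2) (v j ^ 2)).eval (y ^ 2) = 0 := by
    have : q ^ 2 * (y * v j) = 1 := by rw [hyw]; field_simp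
    rw [eval_ghat]
    linear_combination ((q ^ 2) ^ 2 - v j ^ 2 * y ^ 2) * (q ^ 2 * (y * v j) + 1) * this
  have hE : (∏ l, (ghat (q ^ 2) (v (j.succAbove l) ^ 2)).eval (y ^ 2)) ^ 2 *
      (∏ l, pairW q (v j) (v (j.succAbove l))) =
      (∏ l, (y ^ 2 - v (j.succAbove l) ^ 2) ^ 2) * (q ^ 8) ^ k *
      (∏ l, v (j.succAbove l) ^ 2) * (y ^ 2) ^ k * (sigma (q ^ 4) ^ 4) ^ k *
      (∏ l, wA q (y * v (j.succAbove l))) ^ 2 * (∏ l, wA q (v j * v (j.succAbove l))) ^ 2 := by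
    have : ∀ l, (ghat (q ^ 2) (v (j.succAbove l) ^ 2)).eval (y ^ 2) ^ 2 *
        pairW q (v j) (v (j.succAbove l)) = _ := fun l =>
      eval_ghat_mul_pairW' hq4 hq hy hw (hv.ne_zero _)
        (hv.sigma_mul_inv_ne_zero (Fin.succAbove_ne j l).symm) hyw
    simp only [← Finset.prod_pow, ← Finset.prod_mul_distrib, this]
    simp only [Finset.prod_mul_distrib, Finset.prod_const, Finset.card_univ, Fintype.card_fin]
  rw [Interpolates, zfun_cons_perm hq4 hq hv j hy, zfun_cons_cons_inv hq4 hyw, prodA_columns,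
    prodA_columns, h, rhs, eval_bordered_of_ghat (fun l => v l ^ 2) j hg, pref_ofFn_succAbove q v j,
    Fin.prod_univ_succAbove (fun l => (y ^ 2 - v l ^ 2) ^ 2) j,
    Fin.prod_univ_succAbove (fun l => v l ^ 2) j, mul_one, mul_one]
  have hS := scalar_residue' hq4 hq hy hw hyw
  rw [mul_assoc _ (y ^ 2 + _), ← neg_mul] at hS
  exact (residue_assemble (sigma_ne_zero_of_pow_four hq4) hq4 (by rw [hS, neg_mul])
    (rconst_add_two hq4 k) hE).trans (by ring)

/-! ### The product formula for generic parameters -/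

theorem alpha_eq {q x : K} (hq : q ≠ 0) (hx : x ≠ 0) : alpha q x * x ^ 4 * q ^ 6 =
    (ghat (q ^ 2) 1).eval (x ^ 2) * (bhat (q ^ 2)).eval (x ^ 2) := by
  rw [eval_ghat, eval_bhat, alpha]
  simp only [sigma]
  field_simp

theorem pairW_eq {q x w : K} (hq : q ≠ 0) (hx : x ≠ 0) (hw : w ≠ 0) (h : x ^ 2 ≠ w ^ 2) :
    (x ^ 2 - w ^ 2) ^ 2 * q ^ 8 * w ^ 2 * x ^ 2 * pairW q x w =
      (ghat (q ^ 2) (w ^ 2)).eval (x ^ 2) ^ 2 := by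
  have h' := sub_ne_zero.2 h
  rw [eval_ghat, pairW]
  simp only [sigma]
  field_simp

/-- `Interpolates` restores the product formula when the parameters are non-degenerate. -/
theorem zfun_eq_rhs_of_interpolates {q x : K} (hq : q ≠ 0) {m : ℕ} {v : Fin m → K}
    (h : Generic q (Fin.cons x v : Fin (m + 1) → K)) (hi : Interpolates q v x) :
    zfun q 1 (x :: List.ofFn v) = rhs q (Fin.cons x v : Fin (m + 1) → K) := by
  have hx : x ≠ 0 := h.ne_zero 0
  have hv : ∀ l, v l ≠ 0 := fun l => h.ne_zero l.succ
  have hxv : ∀ l, x ^ 2 ≠ v l ^ 2 := fun l hl =>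
    (Fin.succ_ne_zero l).symm (h.injective hl)
  have hsq : (fun i => (Fin.cons x v : Fin (m + 1) → K) i ^ 2) =
      Fin.cons (x ^ 2) fun l => v l ^ 2 := by
    funext i
    cases i using Fin.cases <;> rfl
  have hnd := h.nondegenerate
  rw [hsq] at hnd
  have hdet := det_entryMatrix_cons (pow_ne_zero 2 hq) hnd
  have hG : (∏ l, (x ^ 2 - v l ^ 2) ^ 2) * (q ^ 8) ^ m * (∏ l, v l ^ 2) * (x ^ 2) ^ m *
      (∏ l, pairW q x (v l)) = (∏ l, (ghat (q ^ 2) (v l ^ 2)).eval (x ^ 2)) ^ 2 := by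
    simp only [← Finset.prod_pow, ← pairW_eq hq hx (hv _) (hxv _), Finset.prod_mul_distrib,
      Finset.prod_const, Finset.card_univ, Fintype.card_fin]
  have hα := alpha_eq hq hx
  have hT : ∏ l, (x ^ 2 - v l ^ 2) ^ 2 ≠ 0 := Finset.prod_ne_zero_iff.2 fun l _ =>
    pow_ne_zero 2 (sub_ne_zero.2 (hxv l))
  have hA : ∏ l, v l ^ 2 ≠ 0 := Finset.prod_ne_zero_iff.2 fun l _ => pow_ne_zero 2 (hv l)
  rw [Interpolates] at hi
  rw [rhs, hsq, List.ofFn_succ, pref, List.map_ofFn, List.prod_ofFn]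
  simp only [Fin.cons_zero, Fin.cons_succ, Function.comp_apply]
  generalize ∏ l, (x ^ 2 - v l ^ 2) ^ 2 = T at *
  generalize ∏ l, v l ^ 2 = A at *
  refine mul_left_cancel₀ (a := x ^ (2 * m + 4) * T * (q ^ (8 * m + 6) * A)) (by positivity) ?_
  linear_combination x ^ 2 * hi - rconst q (m + 1) * pref q (List.ofFn v) *
    (ghat (q ^ 2) 1).eval (x ^ 2) * hdet -
    rconst q (m + 1) * pref q (List.ofFn v) *
      (entryMatrix (q ^ 2) (Fin.cons (x ^ 2) fun l => v l ^ 2 : Fin (m + 1) → K)).det *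
      ((ghat (q ^ 2) 1).eval (x ^ 2) * (bhat (q ^ 2)).eval (x ^ 2) * hG +
        T * (q ^ 8) ^ m * A * (x ^ 2) ^ m * (∏ l, pairW q x (v l)) * hα)

/-- The interpolation nodes, as values of `y`: the solutions of `y * v j = q ^ (±2)`, and `q`,
`q⁻¹`, `q ^ 2`. -/
def node (q : K) {m : ℕ} (v : Fin m → K) : Fin m ⊕ Fin m ⊕ Fin 3 → K :=
  Sum.elim (fun j => q ^ 2 / v j) (Sum.elim (fun j => (q ^ 2)⁻¹ / v j) ![q, q⁻¹, q ^ 2])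

theorem node_ne_zero {q : K} (hq : q ≠ 0) {m : ℕ} {v : Fin m → K} (hv : Generic q v) (i) :
    node q v i ≠ 0 := by
  rcases i with j | j | k
  · exact div_ne_zero (by positivity) (hv.ne_zero j)
  · exact div_ne_zero (by positivity) (hv.ne_zero j)
  · fin_cases k
    · exact hq
    · exact inv_ne_zero hq
    · exact pow_ne_zero 2 hq

theorem node_sq_ne {q : K} (hq : q ≠ 0) {m : ℕ} {v : Fin m → K} (hv : Generic q v) (i) (l) :
    node q v i ^ 2 ≠ v l ^ 2 := by
  rcases i with j | j | k <;> intro h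
  · have hj := hv.ne_zero j
    apply hv.nondegenerate.left j l
    simp only [node, Sum.elim_inl] at h
    field_simp at h
    linear_combination h
  · have hj := hv.ne_zero j
    apply hv.nondegenerate.right j l
    simp only [node, Sum.elim_inl, Sum.elim_inr] at h
    field_simp at h
    linear_combination -h
  · have h10 := hv.powers l 10 (by norm_num)
    have h6 := hv.powers l 6 (by norm_num)
    have h12 := hv.powers l 12 (by norm_num)
    fin_cases k <;> simp [node] at h
    · apply h10
      linear_combination -q ^ 8 * h
    · apply h6
      field_simp at h
      linear_combination -q ^ 6 * h
    · apply h12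
      linear_combination -q ^ 8 * h

theorem node_sq_injective {q : K} (hq4 : sigma (q ^ 4) ≠ 0) (hq : q ≠ 0) (hq6 : q ^ 6 ≠ 1)
    {m : ℕ} {v : Fin m → K} (hv : Generic q v) : Function.Injective fun i => node q v i ^ 2 := by
  have h0 := hv.ne_zero
  have h8 : q ^ 8 ≠ 1 := fun h => hq4 (by
    rw [sigma, sub_eq_zero]
    exact eq_inv_of_mul_eq_one_left (by linear_combination h))
  have h4 : q ^ 4 ≠ 1 := fun h => h8 (by linear_combination (q ^ 4 + 1) * h)
  have h2 : q ^ 2 ≠ 1 := fun h => h4 (by linear_combination (q ^ 2 + 1) * h)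
  have e : (fun i => node q v i ^ 2) = Sum.elim (fun j => (q ^ 2 / v j) ^ 2)
      (Sum.elim (fun j => ((q ^ 2)⁻¹ / v j) ^ 2) ![q ^ 2, (q⁻¹) ^ 2, (q ^ 2) ^ 2]) := by
    funext i
    rcases i with j | j | k
    · rfl
    · rfl
    · fin_cases k <;> rfl
  rw [e]
  refine Function.Injective.sumElim (fun i j h => hv.injective ?_)
    (Function.Injective.sumElim (fun i j h => hv.injective ?_) ?_ ?_) ?_
  · have hi := h0 i
    have hj := h0 j
    simp only at h ⊢
    field_simp at h
    exact h.symm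
  · have hi := h0 i
    have hj := h0 j
    simp only at h ⊢
    field_simp at h
    exact h.symm
  · have n1 : q ^ 2 ≠ q⁻¹ ^ 2 := fun h => h4 (by
      field_simp at h; exact h)
    have n2 : q ^ 2 ≠ (q ^ 2) ^ 2 := fun h => h2 (by
      field_simp at h; exact h.symm)
    have n3 : q⁻¹ ^ 2 ≠ (q ^ 2) ^ 2 := fun h => hq6 (by
      field_simp at h; exact h.symm)
    intro a b h
    fin_cases a <;> fin_cases b <;> simp_all [eq_comm]
  · intro j k h
    have hj := h0 j
    have p2 := hv.powers j 2 (by norm_num)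
    have p6 := hv.powers j 6 (by norm_num)
    have p0 := hv.powers j 0 (by norm_num)
    fin_cases k <;> simp at h <;> field_simp at h
    · exact p2 (by linear_combination -q ^ 2 * h)
    · exact p6 (by linear_combination -q ^ 6 * h)
    · exact p0 (by linear_combination -h)
  · rintro i (j | k) h
    · have hi := h0 i
      have hj := h0 j
      simp only [Sum.elim_inl] at h
      field_simp at h
      exact hv.ratio _ _ h.symm
    · have hi := h0 i
      have p8 := hv.powers i 8 (by norm_num)
      have p10 := hv.powers i 10 (by norm_num)
      have p14 := hv.powers i 14 (by norm_num)
      fin_cases k <;> simp at h <;> field_simp at h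
      · exact p10 (by linear_combination -q ^ 8 * h)
      · exact p14 (by linear_combination -q ^ 8 * h)
      · exact p8 (by linear_combination -q ^ 8 * h)

/-- Two polynomials of degree at most `2 * m + 2` in `x ^ 2` that agree at `2 * m + 3` nodes are
equal. -/
theorem interpolates_of_node {q : K} (hq4 : sigma (q ^ 4) ≠ 0) (hq : q ≠ 0) (hq6 : q ^ 6 ≠ 1)
    {m : ℕ} {v : Fin m → K} (hv : Generic q v) (h : ∀ i, Interpolates q v (node q v i)) {x : K}
    (hx : x ≠ 0) (hxv : ∀ l, x ^ 2 ≠ v l ^ 2) : Interpolates q v x := by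
  obtain ⟨Z, hZd, hZ⟩ := evenLaurent_zfun q 1 (List.ofFn v)
  rw [List.length_ofFn] at hZd hZ
  obtain ⟨P, hPd, hP⟩ := exists_bordered_eq_mul (pow_ne_zero 2 hq) hv.nondegenerate hv.injective
  have hprod : ∀ y : K, (∏ j, (X - C (v j ^ 2)) ^ 2).eval (y ^ 2) =
      ∏ l, (y ^ 2 - v l ^ 2) ^ 2 := fun y => by simp [eval_prod]
  -- after cancelling the double roots both sides are polynomials of degree `2 * m + 2` in `y ^ 2`
  have key : ∀ y, y ≠ 0 → (∀ l, y ^ 2 ≠ v l ^ 2) → (Interpolates q v y ↔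
      (C (q ^ (8 * m + 6) * ∏ l, v l ^ 2) * Z).eval (y ^ 2) =
        (C (rconst q (m + 1) * pref q (List.ofFn v)) * (ghat (q ^ 2) 1 * P)).eval (y ^ 2)) := by
    intro y hy hyv
    have hT : ∏ l, (y ^ 2 - v l ^ 2) ^ 2 ≠ 0 := Finset.prod_ne_zero_iff.2 fun l _ =>
      pow_ne_zero 2 (sub_ne_zero.2 (hyv l))
    rw [← mul_left_inj' hT, Interpolates, hP, eval_mul, hprod, hZ y hy]
    simp only [eval_mul, eval_C]
    constructor <;> intro h <;> linear_combination h
  rw [key x hx hxv]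
  congr 1
  refine eq_of_natDegree_lt_card_of_eval_eq _ _ (node_sq_injective hq4 hq hq6 hv)
    (fun i => (key _ (node_ne_zero hq hv i) (node_sq_ne hq hv i)).1 (h i)) ?_
  have h1 := natDegree_C_mul_le (q ^ (8 * m + 6) * ∏ l, v l ^ 2) Z
  have h2 := natDegree_C_mul_le (rconst q (m + 1) * pref q (List.ofFn v)) (ghat (q ^ 2) 1 * P)
  have h3 : (ghat (q ^ 2) 1 * P).natDegree ≤ _ := natDegree_mul_le
  have h4 := natDegree_ghat_le (q ^ 2) 1
  simp only [Fintype.card_sum, Fintype.card_fin]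
  omega

/-- The product formula for generic parameters, by strong induction on the number of parameters. The
condition `q ^ 6 ≠ 1` separates the nodes `q⁻¹` and `q ^ 2`. -/
theorem zfun_eq_rhs {q : K} (hq4 : sigma (q ^ 4) ≠ 0) (hq : q ≠ 0) (hq6 : q ^ 6 ≠ 1) {n : ℕ}
    {f : Fin n → K} (hf : Generic q f) : zfun q 1 (List.ofFn f) = rhs q f := by
  induction n using Nat.strong_induction_on with
  | _ n ih =>
    cases n with
    | zero => simp [zfun, tri, rhs, rconst, pref]
    | succ m =>
      obtain ⟨x, v, rfl⟩ : ∃ x, ∃ v : Fin m → K, f = Fin.cons x v :=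
        ⟨f 0, Fin.tail f, (Fin.cons_self_tail f).symm⟩
      have hv : Generic q v := hf.comp (Fin.succ_injective m)
      have ihv := ih m (Nat.lt_succ_self m) hv
      rw [List.ofFn_cons]
      refine zfun_eq_rhs_of_interpolates hq hf (interpolates_of_node hq4 hq hq6 hv ?_
        (hf.ne_zero 0) fun l hl => (Fin.succ_ne_zero l).symm (hf.injective hl))
      rintro (j | j | k)
      · cases m with
        | zero => exact j.elim0
        | succ k =>
          exact interpolates_mul hq4 hq hv j (div_mul_cancel₀ _ (hv.ne_zero j))
            (ih k (by omega) (hv.comp Fin.succAbove_right_injective))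
      · cases m with
        | zero => exact j.elim0
        | succ k =>
          exact interpolates_mul_inv hq4 hq hv j (div_mul_cancel₀ _ (hv.ne_zero j))
            (ih k (by omega) (hv.comp Fin.succAbove_right_injective))
      · fin_cases k
        · exact interpolates_self hq4 hq hv.ne_zero ihv
        · exact interpolates_inv hq4 hq hv.ne_zero ihv
        · exact interpolates_sq hq4 hq hv

/-! ### Rational functions regular at the origin -/

open Filter

/-- `f` agrees with a rational function without a pole at `0`, wherever the chosen denominator of
that function does not vanish. -/
def RegularAtZero (f : K → K) : Prop :=
  ∃ P Q : K[X], Q.eval 0 ≠ 0 ∧ ∀ s, Q.eval s ≠ 0 → f s * Q.eval s = P.eval s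

namespace RegularAtZero

theorem eval (P : K[X]) : RegularAtZero fun s => P.eval s :=
  ⟨P, 1, by simp, by simp⟩

theorem const (c : K) : RegularAtZero fun _ : K => c := by
  simpa using eval (C c)

theorem id : RegularAtZero fun s : K => s := by
  simpa using eval (X : K[X])

theorem add {f g : K → K} (hf : RegularAtZero f) (hg : RegularAtZero g) :
    RegularAtZero fun s => f s + g s := by
  obtain ⟨P, Q, hQ, h⟩ := hf
  obtain ⟨P', Q', hQ', h'⟩ := hg
  refine ⟨P * Q' + P' * Q, Q * Q', by simp [hQ, hQ'], fun s hs => ?_⟩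
  rw [eval_mul] at hs
  simp only [eval_mul, eval_add]
  linear_combination Q'.eval s * h s (left_ne_zero_of_mul hs) +
    Q.eval s * h' s (right_ne_zero_of_mul hs)

theorem mul {f g : K → K} (hf : RegularAtZero f) (hg : RegularAtZero g) :
    RegularAtZero fun s => f s * g s := by
  obtain ⟨P, Q, hQ, h⟩ := hf
  obtain ⟨P', Q', hQ', h'⟩ := hg
  refine ⟨P * P', Q * Q', by simp [hQ, hQ'], fun s hs => ?_⟩
  rw [eval_mul] at hs
  rw [eval_mul, eval_mul, ← h s (left_ne_zero_of_mul hs), ← h' s (right_ne_zero_of_mul hs)]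
  ring

theorem inv {f : K → K} (hf : RegularAtZero f) (h0 : f 0 ≠ 0) :
    RegularAtZero fun s => (f s)⁻¹ := by
  obtain ⟨P, Q, hQ, h⟩ := hf
  refine ⟨Q * Q, P * Q, ?_, fun s hs => ?_⟩
  · rw [eval_mul, ← h 0 hQ]
    exact mul_ne_zero (mul_ne_zero h0 hQ) hQ
  · rw [eval_mul] at hs
    have hQs := right_ne_zero_of_mul hs
    rw [eval_mul, eval_mul, ← h s hQs]
    have : f s ≠ 0 := left_ne_zero_of_mul (b := Q.eval s) (by
      rw [h s hQs]; exact left_ne_zero_of_mul hs)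
    field_simp

theorem sub {f g : K → K} (hf : RegularAtZero f) (hg : RegularAtZero g) :
    RegularAtZero fun s => f s - g s := by
  simpa [sub_eq_add_neg] using hf.add ((const (-1)).mul hg)

theorem div {f g : K → K} (hf : RegularAtZero f) (hg : RegularAtZero g) (h0 : g 0 ≠ 0) :
    RegularAtZero fun s => f s / g s := by
  simpa only [div_eq_mul_inv] using hf.mul (hg.inv h0)

theorem prod {ι : Type*} (t : Finset ι) {f : ι → K → K} (h : ∀ i ∈ t, RegularAtZero (f i)) :
    RegularAtZero fun s => ∏ i ∈ t, f i s := by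
  classical
  induction t using Finset.induction_on with
  | empty => simpa using const 1
  | insert i t hi ih =>
    simp only [Finset.prod_insert hi]
    exact (h i (by simp)).mul (ih fun j hj => h j (by simp [hj]))

theorem sum {ι : Type*} (t : Finset ι) {f : ι → K → K} (h : ∀ i ∈ t, RegularAtZero (f i)) :
    RegularAtZero fun s => ∑ i ∈ t, f i s := by
  classical
  induction t using Finset.induction_on with
  | empty => simpa using const 0
  | insert i t hi ih =>
    simp only [Finset.sum_insert hi]
    exact (h i (by simp)).add (ih fun j hj => h j (by simp [hj]))

theorem pow {f : K → K} (hf : RegularAtZero f) (k : ℕ) : RegularAtZero fun s => f s ^ k := by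
  simpa using prod (Finset.range k) fun _ _ => hf

theorem det {n : ℕ} {M : K → Matrix (Fin n) (Fin n) K} (h : ∀ i j, RegularAtZero fun s => M s i j) :
    RegularAtZero fun s => (M s).det := by
  simp only [Matrix.det_apply']
  exact sum _ fun τ _ => (const _).mul (prod _ fun i _ => h _ _)

theorem sigma {f : K → K} (hf : RegularAtZero f) (h0 : f 0 ≠ 0) :
    RegularAtZero fun s => DASASM.sigma (f s) :=
  hf.sub (hf.inv h0)

theorem eventually_ne_zero {f : K → K} (hf : RegularAtZero f) (h0 : f 0 ≠ 0) :
    ∀ᶠ s in cofinite, f s ≠ 0 := by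
  obtain ⟨P, Q, hQ, h⟩ := hf
  have hPQ : P * Q ≠ 0 := fun h' => by
    have : (P * Q).eval 0 ≠ 0 := by
      rw [eval_mul, ← h 0 hQ]
      exact mul_ne_zero (mul_ne_zero h0 hQ) hQ
    simp [h'] at this
  have hfin := (finite_setOfPred_isRoot hPQ).eventually_cofinite_notMem
  filter_upwards [hfin] with s hs hfs
  rw [IsRoot, eval_mul] at hs
  rw [← ne_eq] at hs
  apply left_ne_zero_of_mul hs
  rw [← h s (right_ne_zero_of_mul hs), hfs, zero_mul]

/-- Two functions that are regular at `0` and agree at all but finitely many points agree at `0`. -/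
theorem eq_at_zero [Infinite K] {f g : K → K} (hf : RegularAtZero f) (hg : RegularAtZero g)
    (h : ∀ᶠ s in cofinite, f s = g s) : f 0 = g 0 := by
  by_contra h0
  obtain ⟨s, hs, hs'⟩ := (h.and ((hf.sub hg).eventually_ne_zero (sub_ne_zero.2 h0))).exists
  exact hs' (sub_eq_zero.2 hs)

theorem bulkWeight {Q x : K → K} (hQ : RegularAtZero Q) (hx : RegularAtZero x) (hQ0 : Q 0 ≠ 0)
    (hx0 : x 0 ≠ 0) (hQ4 : DASASM.sigma (Q 0 ^ 4) ≠ 0) (a b c d : Bool) :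
    RegularAtZero fun s => DASASM.bulkWeight (Q s) (x s) a b c d := by
  have h1 : RegularAtZero fun s => DASASM.sigma (Q s ^ 2 * x s) / DASASM.sigma (Q s ^ 4) :=
    (((hQ.pow 2).mul hx).sigma (by positivity)).div ((hQ.pow 4).sigma (by positivity)) hQ4
  have h2 : RegularAtZero fun s => DASASM.sigma (Q s ^ 2 * (x s)⁻¹) / DASASM.sigma (Q s ^ 4) :=
    (((hQ.pow 2).mul (hx.inv hx0)).sigma (by positivity)).div ((hQ.pow 4).sigma (by positivity)) hQ4
  cases a <;> cases b <;> cases c <;> cases d <;>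
    first | exact const 0 | exact const 1 | exact h1 | exact h2

theorem leftWeight {Q x : K → K} (hQ : RegularAtZero Q) (hx : RegularAtZero x) (hQ0 : Q 0 ≠ 0)
    (hx0 : x 0 ≠ 0) (hQ1 : DASASM.sigma (Q 0) ≠ 0) (a b : Bool) :
    RegularAtZero fun s => DASASM.leftWeight (Q s) (x s) a b := by
  have h1 : RegularAtZero fun s => DASASM.sigma (Q s * x s) / DASASM.sigma (Q s) :=
    ((hQ.mul hx).sigma (by positivity)).div (hQ.sigma hQ0) hQ1
  cases a <;> cases b <;> first | exact const 1 | exact h1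

theorem rightWeight {Q x : K → K} (hQ : RegularAtZero Q) (hx : RegularAtZero x) (hQ0 : Q 0 ≠ 0)
    (hx0 : x 0 ≠ 0) (hQ1 : DASASM.sigma (Q 0) ≠ 0) (a b : Bool) :
    RegularAtZero fun s => DASASM.rightWeight (Q s) (x s) a b := by
  have h1 : RegularAtZero fun s => DASASM.sigma (Q s * (x s)⁻¹) / DASASM.sigma (Q s) :=
    ((hQ.mul (hx.inv hx0)).sigma (by positivity)).div (hQ.sigma hQ0) hQ1
  cases a <;> cases b <;> first | exact const 1 | exact h1

theorem partitionFunction {n : ℕ} {Q : K → K} {U : K → ℕ → K} (hQ : RegularAtZero Q)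
    (hU : ∀ i, RegularAtZero fun s => U s i) (hQ0 : Q 0 ≠ 0) (hQ4 : DASASM.sigma (Q 0 ^ 4) ≠ 0)
    (hU0 : ∀ i ∈ Finset.Icc 1 (n + 1), U 0 i ≠ 0) :
    RegularAtZero fun s => DASASM.partitionFunction n (Q s) (U s) := by
  have hQ1 := sigma_ne_zero_of_pow_four hQ4
  refine sum _ fun c _ => prod _ fun i hi => ?_
  rw [Finset.mem_Icc] at hi
  have hi0 : U 0 i ≠ 0 := hU0 i (Finset.mem_Icc.2 (by omega))
  refine ((leftWeight hQ (hU i) hQ0 hi0 hQ1 _ _).mul (prod _ fun j hj => ?_)).mul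
    (rightWeight hQ (hU i) hQ0 hi0 hQ1 _ _)
  rw [Finset.mem_Icc] at hj
  exact bulkWeight hQ ((hU i).mul (hU _)) hQ0
    (mul_ne_zero hi0 (hU0 _ (Finset.mem_Icc.2 (by omega)))) hQ4 _ _ _ _

end RegularAtZero

theorem eventually_eval_ne {P Q : K[X]} (h : P ≠ Q) :
    ∀ᶠ s in cofinite, P.eval s ≠ Q.eval s := by
  have := (finite_setOfPred_isRoot (sub_ne_zero.2 h)).eventually_cofinite_notMem
  filter_upwards [this] with s hs h'
  exact hs (by rw [IsRoot, eval_sub, h', sub_self])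

/-! ### Removal of the genericity conditions -/

theorem pref_paramsFrom (q : K) (n : ℕ) (u : ℕ → K) (i : ℕ) :
    pref q (paramsFrom n u i) = (∏ k ∈ Finset.Icc i n, alpha q (u k)) *
      ∏ k ∈ Finset.Icc i n, ∏ j ∈ Finset.Icc (k + 1) n, pairW q (u k) (u j) := by
  by_cases hi : i ≤ n
  · have h1 : ((paramsFrom n u (i + 1)).map (pairW q (u i))).prod =
        ∏ j ∈ Finset.Icc (i + 1) n, pairW q (u i) (u j) := by
      rw [paramsFrom, List.map_map, ← Finset.Ico_succ_right_eq_Icc, Finset.prod_Ico_eq_prod_range]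
      rfl
    rw [paramsFrom_eq_cons u hi, pref, h1, pref_paramsFrom q n u (i + 1),
      ← Finset.mul_prod_Ioc_eq_prod_Icc hi, ← Finset.mul_prod_Ioc_eq_prod_Icc hi,
      ← Finset.Icc_succ_left_eq_Ioc, Nat.succ_eq_succ, Nat.succ_eq_add_one]
    ring
  · rw [paramsFrom, show n + 1 - i = 0 by omega, Finset.Icc_eq_empty hi]
    simp [pref]
termination_by n + 1 - i

omit [Field K] in
theorem paramsFrom_one (n : ℕ) (u : ℕ → K) :
    paramsFrom n u 1 = List.ofFn fun i : Fin n => u (i + 1) := by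
  refine List.ext_getElem (by simp [paramsFrom]) fun k _ _ => ?_
  simp [paramsFrom, add_comm]

theorem entry_sq {q a b : K} (hq : q ≠ 0) (ha : a ≠ 0) (hb : b ≠ 0) :
    entry (q ^ 2) (a ^ 2) (b ^ 2) = (q ^ 2 + q⁻¹ ^ 2 + a ^ 2 + b⁻¹ ^ 2) /
      (sigma (q ^ 2 * a * b) * sigma (q ^ 2 * a⁻¹ * b⁻¹)) := by
  have h : sigma (q ^ 2 * a * b) * sigma (q ^ 2 * a⁻¹ * b⁻¹) =
      (((q ^ 2) ^ 2 - a ^ 2 * b ^ 2) * ((q ^ 2) ^ 2 * a ^ 2 * b ^ 2 - 1)) /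
        ((q ^ 2) ^ 2 * a ^ 2 * b ^ 2) := by
    simp only [sigma]
    field_simp
  rw [h, entry, div_div_eq_mul_div, inv_pow, inv_pow]

/-- The product formula as a function of `q` and of the sequence of parameters. -/
def productFormula (n : ℕ) (q : K) (u : ℕ → K) : K :=
  sigma (q ^ 2) ^ n / (sigma q ^ (2 * n) * sigma (q ^ 4) ^ (n ^ 2)) *
  (∏ i ∈ Finset.Icc 1 n,
    sigma (q * u i) * sigma (q * (u i)⁻¹) * sigma (q ^ 2 * u i) * sigma (q ^ 2 * (u i)⁻¹)) *
  (∏ i ∈ Finset.Icc 1 n, ∏ j ∈ Finset.Icc (i + 1) n,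
    (sigma (q ^ 2 * u i * u j) * sigma (q ^ 2 * (u i)⁻¹ * (u j)⁻¹) / sigma (u i * (u j)⁻¹)) ^ 2) *
  Matrix.det (Matrix.of fun i j : Fin n =>
    (q ^ 2 + (q⁻¹) ^ 2 + u (i + 1) ^ 2 + ((u (j + 1))⁻¹) ^ 2) /
      (sigma (q ^ 2 * u (i + 1) * u (j + 1)) * sigma (q ^ 2 * (u (i + 1))⁻¹ * (u (j + 1))⁻¹)))

theorem rhs_eq_productFormula {q : K} (hq : q ≠ 0) (n : ℕ) {u : ℕ → K}
    (hu : ∀ i : Fin n, u (i + 1) ≠ 0) :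
    (rhs q fun i : Fin n => u (i + 1)) = productFormula n q u := by
  rw [rhs, ← paramsFrom_one, pref_paramsFrom, ← mul_assoc]
  have : (entryMatrix (q ^ 2) fun i : Fin n => u (i + 1) ^ 2) = Matrix.of fun i j : Fin n =>
    (q ^ 2 + (q⁻¹) ^ 2 + u (i + 1) ^ 2 + ((u (j + 1))⁻¹) ^ 2) /
      (sigma (q ^ 2 * u (i + 1) * u (j + 1)) * sigma (q ^ 2 * (u (i + 1))⁻¹ * (u (j + 1))⁻¹)) := by
    ext i j
    exact entry_sq hq (hu i) (hu j)
  rw [this]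
  rfl

theorem partitionFunction_eq_productFormula_of_generic {q : K} (hq : q ≠ 0)
    (hq4 : sigma (q ^ 4) ≠ 0) (hq6 : q ^ 6 ≠ 1) (n : ℕ) {u : ℕ → K}
    (hu : Generic q fun i : Fin n => u (i + 1)) (hlast : u (n + 1) = 1) :
    partitionFunction n q u = productFormula n q u := by
  rw [partitionFunction_eq_zfun hq, hlast, paramsFrom_one, zfun_eq_rhs hq4 hq hq6 hu,
    rhs_eq_productFormula hq n hu.ne_zero]

theorem RegularAtZero.productFormula {n : ℕ} {Q : K → K} {U : K → ℕ → K} (hQ : RegularAtZero Q)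
    (hU : ∀ i, RegularAtZero fun s => U s i) (hQ0 : Q 0 ≠ 0)
    (hQ4 : DASASM.sigma (Q 0 ^ 4) ≠ 0) (hU0 : ∀ i ∈ Finset.Icc 1 n, U 0 i ≠ 0)
    (hdist : ∀ i ∈ Finset.Icc 1 n, ∀ j ∈ Finset.Icc (i + 1) n,
      DASASM.sigma (U 0 i * (U 0 j)⁻¹) ≠ 0)
    (hden : ∀ i ∈ Finset.Icc 1 n, ∀ j ∈ Finset.Icc 1 n,
      DASASM.sigma (Q 0 ^ 2 * U 0 i * U 0 j) ≠ 0 ∧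
        DASASM.sigma (Q 0 ^ 2 * (U 0 i)⁻¹ * (U 0 j)⁻¹) ≠ 0) :
    RegularAtZero fun s => DASASM.productFormula n (Q s) (U s) := by
  have hQ1 := sigma_ne_zero_of_pow_four hQ4
  have hσ {f : K → K} (hf : RegularAtZero f) (h0 : f 0 ≠ 0) := hf.sigma h0
  refine RegularAtZero.mul (.mul (.mul (.div ?_ ?_ ?_) (prod _ fun i hi => ?_))
    (prod _ fun i hi => prod _ fun j hj => ?_)) (det fun i j => ?_)
  · exact ((hQ.pow 2).sigma (by positivity)).pow n
  · exact ((hQ.sigma hQ0).pow _).mul (((hQ.pow 4).sigma (by positivity)).pow _)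
  · positivity
  · have hi0 := hU0 i hi
    have hui := (hU i).inv hi0
    exact (((hσ (hQ.mul (hU i)) (by positivity)).mul (hσ (hQ.mul hui) (by positivity))).mul
      (hσ ((hQ.pow 2).mul (hU i)) (by positivity))).mul
      (hσ ((hQ.pow 2).mul hui) (by positivity))
  · have hi0 := hU0 i hi
    have hj0 := hU0 j (by rw [Finset.mem_Icc] at hj ⊢; omega)
    have hui := (hU i).inv hi0
    have huj := (hU j).inv hj0
    exact (((hσ (((hQ.pow 2).mul (hU i)).mul (hU j)) (by positivity)).mul
      (hσ (((hQ.pow 2).mul hui).mul huj) (by positivity))).div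
      (hσ ((hU i).mul huj) (by positivity)) (hdist i hi j hj)).pow 2
  · have hi : (i : ℕ) + 1 ∈ Finset.Icc 1 n := Finset.mem_Icc.2 (by omega)
    have hj : (j : ℕ) + 1 ∈ Finset.Icc 1 n := Finset.mem_Icc.2 (by omega)
    have hi0 := hU0 _ hi
    have hj0 := hU0 _ hj
    have hui := (hU (i + 1)).inv hi0
    have huj := (hU (j + 1)).inv hj0
    exact ((((hQ.pow 2).add ((hQ.inv hQ0).pow 2)).add ((hU _).pow 2)).add (huj.pow 2)).div
      ((hσ (((hQ.pow 2).mul (hU _)).mul (hU _)) (by positivity)).mul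
        (hσ (((hQ.pow 2).mul hui).mul huj) (by positivity)))
      (mul_ne_zero (hden _ hi _ hj).1 (hden _ hi _ hj).2)

/-- The parameters deformed by `s`. The exponents grow with `i`, so that the degrees in `s`
distinguish the parameters from each other and from powers of `q + s`. -/
def deform (n : ℕ) (u : ℕ → K) (s : K) (i : ℕ) : K := u i + if i ≤ n then s ^ (5 * (i + 1)) else 0

theorem eventually_eval_ne_of_eval_zero {P Q : K[X]} (h : P.eval 0 ≠ Q.eval 0) :
    ∀ᶠ s in cofinite, P.eval s ≠ Q.eval s :=
  eventually_eval_ne fun h' => h (by rw [h'])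

theorem sigma_eq_zero_of_sq_eq_one {x : K} (h : x ^ 2 = 1) : sigma x = 0 := by
  rw [sigma, sub_eq_zero]
  exact eq_inv_of_mul_eq_one_left (by rw [← sq, h])

theorem eventually_generic {n : ℕ} {q : K} {u : ℕ → K}
    (hu : ∀ i ∈ Finset.Icc 1 n, u i ≠ 0)
    (hdist : ∀ i ∈ Finset.Icc 1 n, ∀ j ∈ Finset.Icc (i + 1) n, sigma (u i * (u j)⁻¹) ≠ 0)
    (hden : ∀ i ∈ Finset.Icc 1 n, ∀ j ∈ Finset.Icc 1 n,
      sigma (q ^ 2 * u i * u j) ≠ 0 ∧ sigma (q ^ 2 * (u i)⁻¹ * (u j)⁻¹) ≠ 0) :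
    ∀ᶠ s in cofinite, Generic (q + s) fun i : Fin n => deform n u s (i + 1) := by
  have hmem : ∀ i : Fin n, (i : ℕ) + 1 ∈ Finset.Icc 1 n := fun i => Finset.mem_Icc.2 (by omega)
  set Q : K[X] := C q + X with hQ
  set U : Fin n → K[X] := fun i => C (u (i + 1)) + X ^ (5 * ((i : ℕ) + 1 + 1)) with hU
  have eQ : ∀ s, Q.eval s = q + s := fun s => by simp [hQ]
  have eU : ∀ i s, (U i).eval s = deform n u s (i + 1) := fun i s => by
    simp [hU, deform, Nat.succ_le_iff.2 i.2]
  have e0 : ∀ i, (U i).eval 0 = u (i + 1) := fun i => by simp [hU]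
  have mQ : Q.Monic := by rw [hQ, add_comm]; exact monic_X_add_C q
  have dQ : Q.natDegree = 1 := by rw [hQ, add_comm]; exact natDegree_X_add_C q
  have mU : ∀ i, (U i).Monic := fun i => by
    simp only [hU]
    rw [add_comm]
    exact monic_X_pow_add_C _ (by omega)
  have dU : ∀ i, (U i).natDegree = 5 * ((i : ℕ) + 1 + 1) := fun i => by
    simp only [hU]
    rw [add_comm]
    exact natDegree_X_pow_add_C
  have h1 : ∀ i, ∀ᶠ s in cofinite, (U i).eval s ≠ (0 : K[X]).eval s := fun i =>
    eventually_eval_ne (mU i).ne_zero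
  have h2 : ∀ i j, ∀ᶠ s in cofinite, ((Q ^ 2) ^ 2).eval s ≠ (U i ^ 2 * U j ^ 2).eval s := by
    refine fun i j => eventually_eval_ne_of_eval_zero fun h => (hden _ (hmem i) _ (hmem j)).2 ?_
    have hi := hu _ (hmem i)
    have hj := hu _ (hmem j)
    simp only [eval_pow, eval_mul, e0, eQ, add_zero] at h
    refine sigma_eq_zero_of_sq_eq_one ?_
    field_simp
    linear_combination h
  have h3 : ∀ i j, ∀ᶠ s in cofinite, ((Q ^ 2) ^ 2 * U i ^ 2 * U j ^ 2).eval s ≠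
      (1 : K[X]).eval s := by
    refine fun i j => eventually_eval_ne_of_eval_zero fun h => (hden _ (hmem i) _ (hmem j)).1 ?_
    have hi := hu _ (hmem i)
    have hj := hu _ (hmem j)
    simp only [eval_pow, eval_mul, e0, eQ, add_zero, eval_one] at h
    refine sigma_eq_zero_of_sq_eq_one ?_
    linear_combination h
  have h4 : ∀ i j, i < j → ∀ᶠ s in cofinite, (U i ^ 2).eval s ≠ (U j ^ 2).eval s := by
    refine fun i j hij => eventually_eval_ne_of_eval_zero fun h =>
      hdist _ (hmem i) (j + 1) (Finset.mem_Icc.2 (by omega)) ?_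
    have hi := hu _ (hmem i)
    have hj := hu _ (hmem j)
    simp only [eval_pow, e0] at h
    refine sigma_eq_zero_of_sq_eq_one ?_
    field_simp
    exact h
  -- both sides are monic, of degrees `10 * (i + 2) + 8` and `k ≤ 16`
  have h5 : ∀ i, ∀ k ∈ Finset.range 17, ∀ᶠ s in cofinite,
      (U i ^ 2 * Q ^ 8).eval s ≠ (Q ^ k).eval s := by
    refine fun i k hk => eventually_eval_ne fun h => ?_
    have := congrArg natDegree h
    rw [((mU i).pow 2).natDegree_mul (mQ.pow 8), (mU i).natDegree_pow, mQ.natDegree_pow,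
      mQ.natDegree_pow, dU, dQ] at this
    rw [Finset.mem_range] at hk
    omega
  -- both sides are monic, and their degrees differ modulo `10`
  have h6 : ∀ i j, ∀ᶠ s in cofinite, (U i ^ 2).eval s ≠ (Q ^ 8 * U j ^ 2).eval s := by
    refine fun i j => eventually_eval_ne fun h => ?_
    have := congrArg natDegree h
    rw [(mQ.pow 8).natDegree_mul ((mU j).pow 2), (mU i).natDegree_pow, (mU j).natDegree_pow,
      mQ.natDegree_pow, dU, dU, dQ] at this
    omega
  filter_upwards [eventually_all.2 h1, eventually_all.2 fun i => eventually_all.2 (h2 i),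
    eventually_all.2 fun i => eventually_all.2 (h3 i),
    eventually_all.2 fun i => eventually_all.2 fun j => eventually_all.2 (h4 i j),
    eventually_all.2 fun i => (Finset.eventually_all _).2 (h5 i),
    eventually_all.2 fun i => eventually_all.2 (h6 i)] with s g1 g2 g3 g4 g5 g6
  simp only [eval_pow, eval_mul, eval_zero, eval_one, eQ, eU] at g1 g2 g3 g4 g5 g6
  refine ⟨⟨fun i => pow_ne_zero 2 (g1 i), fun i j => sub_ne_zero.2 (g2 i j),
    fun i j => sub_ne_zero.2 (g3 i j)⟩, fun i j hij => ?_,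
    fun i k hk => g5 i k (Finset.mem_range.2 (by omega)), g6⟩
  by_contra hne
  rcases lt_or_gt_of_ne hne with h | h
  · exact g4 i j h hij
  · exact g4 j i h hij.symm

theorem partitionFunction_eq_productFormula [Infinite K] {n : ℕ} {q : K} {u : ℕ → K}
    (hq : q ≠ 0) (hq4 : sigma (q ^ 4) ≠ 0) (hu : ∀ i ∈ Finset.Icc 1 n, u i ≠ 0)
    (hdist : ∀ i ∈ Finset.Icc 1 n, ∀ j ∈ Finset.Icc (i + 1) n, sigma (u i * (u j)⁻¹) ≠ 0)
    (hden : ∀ i ∈ Finset.Icc 1 n, ∀ j ∈ Finset.Icc 1 n,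
      sigma (q ^ 2 * u i * u j) ≠ 0 ∧ sigma (q ^ 2 * (u i)⁻¹ * (u j)⁻¹) ≠ 0)
    (hlast : u (n + 1) = 1) : partitionFunction n q u = productFormula n q u := by
  have hQ : RegularAtZero fun s : K => q + s := (RegularAtZero.const q).add RegularAtZero.id
  have hU : ∀ i, RegularAtZero fun s => deform n u s i := fun i => by
    refine (RegularAtZero.const (u i)).add ?_
    split_ifs
    · exact RegularAtZero.id.pow _
    · exact RegularAtZero.const 0
  have hq0 : q + 0 = q := add_zero q
  have hu0 : deform n u 0 = u := by
    funext i
    simp [deform]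
  have hU0 : ∀ i ∈ Finset.Icc 1 (n + 1), u i ≠ 0 := fun i hi => by
    rw [Finset.mem_Icc] at hi
    rcases Nat.lt_or_ge n i with h | h
    · rw [show i = n + 1 by omega, hlast]
      exact one_ne_zero
    · exact hu i (Finset.mem_Icc.2 ⟨hi.1, h⟩)
  have hlim := RegularAtZero.eq_at_zero (f := fun s => partitionFunction n (q + s) (deform n u s))
    (g := fun s => productFormula n (q + s) (deform n u s))
    (RegularAtZero.partitionFunction hQ hU (by rwa [hq0]) (by rwa [hq0]) (by rwa [hu0]))
    (RegularAtZero.productFormula hQ hU (by rwa [hq0]) (by rwa [hq0]) (by rwa [hu0])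
      (by rwa [hu0]) (by rwa [hq0, hu0])) ?_
  · simpa only [hq0, hu0] using hlim
  have hs6 : ∀ᶠ s in cofinite, ((C q + X) ^ 6).eval s ≠ (1 : K[X]).eval s :=
    eventually_eval_ne fun h => by
      have := congrArg natDegree h
      rw [natDegree_pow, add_comm, natDegree_X_add_C, natDegree_one] at this
      omega
  filter_upwards [hQ.eventually_ne_zero (by rwa [hq0]),
    ((hQ.pow 4).sigma (pow_ne_zero 4 (by rwa [hq0]))).eventually_ne_zero (by rwa [hq0]), hs6,
    eventually_generic hu hdist hden] with s h1 h2 h3 h4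
  refine partitionFunction_eq_productFormula_of_generic h1 h2 (by simpa using h3) n h4 ?_
  simp [deform, hlast]

end DASASM

theorem mainTheorem5 {K : Type*} [Field K] [CharZero K] (n : ℕ) (q : K) (u : ℕ → K)
    (hq : q ≠ 0) (hq4 : DASASM.sigma (q ^ 4) ≠ 0)
    (hu : ∀ i ∈ Finset.Icc 1 n, u i ≠ 0)
    (hdist : ∀ i ∈ Finset.Icc 1 n, ∀ j ∈ Finset.Icc (i + 1) n,
      DASASM.sigma (u i * (u j)⁻¹) ≠ 0)
    (hden : ∀ i ∈ Finset.Icc 1 n, ∀ j ∈ Finset.Icc 1 n,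
      DASASM.sigma (q ^ 2 * u i * u j) ≠ 0 ∧ DASASM.sigma (q ^ 2 * (u i)⁻¹ * (u j)⁻¹) ≠ 0)
    (hlast : u (n + 1) = 1) :
    DASASM.partitionFunction n q u =
      DASASM.sigma (q ^ 2) ^ n / (DASASM.sigma q ^ (2 * n) * DASASM.sigma (q ^ 4) ^ (n ^ 2)) *
      (∏ i ∈ Finset.Icc 1 n,
        DASASM.sigma (q * u i) * DASASM.sigma (q * (u i)⁻¹) *
          DASASM.sigma (q ^ 2 * u i) * DASASM.sigma (q ^ 2 * (u i)⁻¹)) *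
      (∏ i ∈ Finset.Icc 1 n, ∏ j ∈ Finset.Icc (i + 1) n,
        (DASASM.sigma (q ^ 2 * u i * u j) * DASASM.sigma (q ^ 2 * (u i)⁻¹ * (u j)⁻¹) /
          DASASM.sigma (u i * (u j)⁻¹)) ^ 2) *
      Matrix.det (Matrix.of fun i j : Fin n =>
        (q ^ 2 + (q⁻¹) ^ 2 + u (i + 1) ^ 2 + ((u (j + 1))⁻¹) ^ 2) /
          (DASASM.sigma (q ^ 2 * u (i + 1) * u (j + 1)) *
            DASASM.sigma (q ^ 2 * (u (i + 1))⁻¹ * (u (j + 1))⁻¹))) := by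
  exact DASASM.partitionFunction_eq_productFormula hq hq4 hu hdist hden hlast
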